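/- An instance $\mathbf I=(\mathbf A,x,b,l,u,\eta)$ of ILP consists of an integer matrix $\mathbf A$ with $m$ rows and $n$ columns, $b\in\mathbb Z^m$, $l,u\in(\mathbb Z\cup\{\pm\infty\})^n$ and $\eta\in\mathbb Z^n$. An assignment $\alpha\in\mathbb Z^n$ is feasible if $\mathbf A\alpha=b$ and $l\le\alpha\le u$, and it is a solution if moreover $\eta\alpha$ is maximal among all feasible assignments. The task is to compute a solution or to determine correctly that none exists (because the instance is infeasible or unbounded). In Unary ILP all numbers of the instance are encoded in unary; $|\mathbf I|$ denotes the length of the resulting bit string. The incidence graph of $\mathbf I$ has the $n$ variables and the $m$ constraints (rows) as vertices; a variable and a constraint are adjacent iff the variable has a non-zero coefficient in the constraint. For $\ell\in\mathbb N$ let $b^C_\ell(\mathbf I)$ be the least cardinality of a set $Z$ of constraints such that, after removing $Z$ from the instance, each connected component of its incidence graph has at most $\ell$ vertices ($\infty$ if there is no such $Z$). The constraint fracture number is $\mathfrak p^C(\mathbf I)=\min_{\ell\in\mathbb N}\max(\ell,b^C_\ell(\mathbf I))$, which is always finite. Theorem. Unary ILP is solvable in polynomial time for every fixed value of $\mathfrak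 p^C(\mathbf I)$. More precisely, it is in XP parameterized by $\mathfrak p^C$: there are a deterministic algorithm (a program of a random access machine with unit-cost integer addition and subtraction and without multiplication, where polynomial time is the same as on Turing machines) and a computable function $f:\mathbb N\to\mathbb N$ such that, given any instance $\mathbf I$ of Unary ILP, the algorithm outputs a solution of $\mathbf I$, or correctly reports that none exists, after at most $f(k)\cdot|\mathbf I|^{f(k)}$ steps, where $k=\mathfrak p^C(\mathbf I)$. -/

import Mathlib

/-! ### Integer linear programs in equation form -/

/-- Integers extended by `-∞` and `+∞`. -/
abbrev ExtInt : Type := WithBot (WithTop ℤ)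

/-- The inclusion of the integers into the extended integers. -/
def ExtInt.ofInt (z : ℤ) : ExtInt := ((z : WithTop ℤ) : WithBot (WithTop ℤ))

/-- An ILP instance with variables indexed by `V` and constraints indexed by `C`:
maximize `obj ⬝ x` subject to `A x = rhs` and `lower ≤ x ≤ upper`. -/
structure ILP (V C : Type) where
  /-- the constraint matrix -/
  A : Matrix C V ℤ
  /-- the right-hand side -/
  rhs : C → ℤ
  /-- the lower bounds -/
  lower : V → ExtInt
  /-- the upper bounds -/
  upper : V → ExtInt
  /-- the optimization function -/
  obj : V → ℤ

namespace ILP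

variable {V C : Type}

/-- `x` satisfies every constraint and all lower and upper bounds. -/
def IsFeasible [Fintype V] (I : ILP V C) (x : V → ℤ) : Prop :=
  (∀ c, ∑ v, I.A c v * x v = I.rhs c) ∧
    ∀ v, I.lower v ≤ ExtInt.ofInt (x v) ∧ ExtInt.ofInt (x v) ≤ I.upper v

/-- A solution is a feasible assignment at which the objective is maximal among all
feasible assignments. -/
def IsSolution [Fintype V] (I : ILP V C) (x : V → ℤ) : Prop :=
  I.IsFeasible x ∧ ∀ y, I.IsFeasible y → ∑ v, I.obj v * y v ≤ ∑ v, I.obj v * x v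

/-! ### The constraint fracture number -/

/-- Incidence between variables and constraints. -/
def incident (I : ILP V C) : V ⊕ C → V ⊕ C → Prop
  | Sum.inl v, Sum.inr c => I.A c v ≠ 0
  | Sum.inr c, Sum.inl v => I.A c v ≠ 0
  | _, _ => False

/-- The incidence graph: its vertices are the variables and the constraints, and a variable is
adjacent to a constraint iff it occurs there with a non-zero coefficient. -/
def incidenceGraph (I : ILP V C) : SimpleGraph (V ⊕ C) where
  Adj := I.incident
  symm := ⟨by rintro (v | c) (w | d) h <;> exact h⟩
  loopless := ⟨by rintro (v | c) h <;> exact h⟩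

/-- The instance `I \ Z`: the constraints in `Z` are removed, and the variables in `Z` are removed
from the remaining constraints and from the optimization function. -/
def delete (I : ILP V C) (Z : Set (V ⊕ C)) :
    ILP {v : V // Sum.inl v ∉ Z} {c : C // Sum.inr c ∉ Z} where
  A c v := I.A c.1 v.1
  rhs c := I.rhs c.1
  lower v := I.lower v.1
  upper v := I.upper v.1
  obj v := I.obj v.1

/-- Every connected component contains at most `l` variables and constraints (together). -/
def IsCompact (I : ILP V C) (l : ℕ) : Prop :=
  ∀ K : I.incidenceGraph.ConnectedComponent, K.supp.encard ≤ l

/-- `Z` is a constraint-backdoor to `l`-compactness: it contains no variables, and `I \ Z` is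
`l`-compact. -/
def IsConstraintBackdoor (I : ILP V C) (l : ℕ) (Z : Set (V ⊕ C)) : Prop :=
  (∀ v, Sum.inl v ∉ Z) ∧ (I.delete Z).IsCompact l

/-- The least cardinality of a constraint-backdoor to `l`-compactness (`⊤` if there is none). -/
noncomputable def constraintBackdoorNumber (I : ILP V C) (l : ℕ) : ℕ∞ :=
  ⨅ (Z : Set (V ⊕ C)) (_ : I.IsConstraintBackdoor l Z), Z.encard

/-- The constraint fracture number, the minimum over `l` of `max l b_l`, where `b_l` is
`constraintBackdoorNumber l`. It is finite for every instance with finitely many variables and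
constraints, see `constraintFractureNumber_ne_top`. -/
noncomputable def constraintFractureNumber (I : ILP V C) : ℕ∞ :=
  ⨅ l : ℕ, max (l : ℕ∞) (I.constraintBackdoorNumber l)

theorem constraintFractureNumber_ne_top [Finite V] [Finite C] (I : ILP V C) :
    I.constraintFractureNumber ≠ ⊤ := by
  have hb : I.IsConstraintBackdoor (Nat.card (V ⊕ C)) ∅ := by
    refine ⟨fun v => Set.notMem_empty _, fun K => ?_⟩
    refine (Set.encard_le_encard (Set.subset_univ _)).trans ?_
    rw [Set.encard_univ, ENat.card_eq_coe_natCard, Nat.cast_le]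
    let g : {v : V // Sum.inl v ∉ (∅ : Set (V ⊕ C))} ⊕ {c : C // Sum.inr c ∉ (∅ : Set (V ⊕ C))} →
        V ⊕ C := Sum.map Subtype.val Subtype.val
    exact Nat.card_le_card_of_injective g
      (Sum.map_injective.2 ⟨Subtype.val_injective, Subtype.val_injective⟩)
  have h : I.constraintFractureNumber ≤ (Nat.card (V ⊕ C) : ℕ∞) := by
    refine (iInf_le _ (Nat.card (V ⊕ C))).trans (max_le le_rfl ?_)
    refine (iInf₂_le (∅ : Set (V ⊕ C)) hb).trans ?_
    simp
  exact ne_top_of_le_ne_top (ENat.natCast_ne_top _) h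

end ILP

/-! ### The unary bit encoding of an instance -/

namespace Unary

/-- `n` is written as `n` ones followed by a zero. -/
def encodeNat (n : ℕ) : List Bool := List.replicate n true ++ [false]

/-- A sign bit, followed by the absolute value in unary. -/
def encodeInt (z : ℤ) : List Bool := decide (z < 0) :: encodeNat z.natAbs

/-- A finite bound is a zero followed by its unary encoding; `-∞` and `+∞` are two further
codewords. -/
def encodeExtInt : ExtInt → List Bool
  | ⊥ => [true, true]
  | ((⊤ : WithTop ℤ) : WithBot (WithTop ℤ)) => [true, false]
  | ((z : ℤ) : WithTop ℤ) => false :: encodeInt z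

/-- The unary encoding of an instance: the number of variables, the number of constraints,
the matrix row by row, the right-hand side, the lower and the upper bounds, and the optimization
function. -/
def encode {n m : ℕ} (I : ILP (Fin n) (Fin m)) : List Bool :=
  encodeNat n ++ encodeNat m ++
    ((List.finRange m).flatMap fun i => (List.finRange n).flatMap fun j => encodeInt (I.A i j)) ++
    ((List.finRange m).flatMap fun i => encodeInt (I.rhs i)) ++
    ((List.finRange n).flatMap fun j => encodeExtInt (I.lower j)) ++
    ((List.finRange n).flatMap fun j => encodeExtInt (I.upper j)) ++
    ((List.finRange n).flatMap fun j => encodeInt (I.obj j))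

end Unary

/-! ### A random access machine with unit-cost addition and subtraction

The programs are structured programs with conditionals and loops, over integer registers and
integer arrays with indirect addressing. Every operation costs one step. There is no
multiplication, so numbers gain at most one bit per operation and polynomial time on this machine
is polynomial time on a Turing machine. -/

namespace RAM

/-- A memory state: registers numbered `0, 1, …` and arrays numbered `0, 1, …`. A program mentions
only finitely many of them. -/
structure State where
  /-- the registers -/
  reg : ℕ → ℤ
  /-- `arr a i` is the `i`-th cell of the array `a` -/
  arr : ℕ → ℤ → ℤ

/-- Arithmetic expressions. -/
inductive Expr where
  | const (c : ℤ)
  | reg (r : ℕ)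
  | read (a : ℕ) (index : Expr)
  | add (e₁ e₂ : Expr)
  | sub (e₁ e₂ : Expr)

/-- The value of an expression in a state. -/
def Expr.eval (s : State) : Expr → ℤ
  | .const c => c
  | .reg r => s.reg r
  | .read a e => s.arr a (e.eval s)
  | .add e₁ e₂ => e₁.eval s + e₂.eval s
  | .sub e₁ e₂ => e₁.eval s - e₂.eval s

/-- The number of steps needed to evaluate an expression: one for each node. -/
def Expr.cost : Expr → ℕ
  | .const _ => 1
  | .reg _ => 1
  | .read _ e => e.cost + 1
  | .add e₁ e₂ => e₁.cost + e₂.cost + 1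
  | .sub e₁ e₂ => e₁.cost + e₂.cost + 1

/-- Programs. A test is passed iff its expression has a positive value. -/
inductive Program where
  | skip
  | assign (r : ℕ) (e : Expr)
  | write (a : ℕ) (index e : Expr)
  | seq (p q : Program)
  | ite (test : Expr) (p q : Program)
  | loop (test : Expr) (p : Program)

/-- Overwrite a register. -/
def State.setReg (s : State) (r : ℕ) (x : ℤ) : State where
  reg := Function.update s.reg r x
  arr := s.arr

/-- Overwrite a cell of an array. -/
def State.setArr (s : State) (a : ℕ) (i x : ℤ) : State where
  reg := s.reg
  arr := Function.update s.arr a (Function.update (s.arr a) i x)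

/-- `Runs p s t s'`: started in the state `s`, the program `p` halts after exactly `t` steps in the
state `s'`. -/
inductive Runs : Program → State → ℕ → State → Prop where
  | skip (s : State) : Runs .skip s 1 s
  | assign (r : ℕ) (e : Expr) (s : State) :
      Runs (.assign r e) s (e.cost + 1) (s.setReg r (e.eval s))
  | write (a : ℕ) (i e : Expr) (s : State) :
      Runs (.write a i e) s (i.cost + e.cost + 1) (s.setArr a (i.eval s) (e.eval s))
  | seq {p q : Program} {s s' s'' : State} {t t' : ℕ} :
      Runs p s t s' → Runs q s' t' s'' → Runs (.seq p q) s (t + t') s''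
  | ite_pos {e : Expr} {p q : Program} {s s' : State} {t : ℕ} :
      0 < e.eval s → Runs p s t s' → Runs (.ite e p q) s (e.cost + 1 + t) s'
  | ite_neg {e : Expr} {p q : Program} {s s' : State} {t : ℕ} :
      ¬ 0 < e.eval s → Runs q s t s' → Runs (.ite e p q) s (e.cost + 1 + t) s'
  | loop_pos {e : Expr} {p : Program} {s s' s'' : State} {t t' : ℕ} :
      0 < e.eval s → Runs p s t s' → Runs (.loop e p) s' t' s'' →
        Runs (.loop e p) s (e.cost + 1 + t + t') s''
  | loop_neg {e : Expr} {p : Program} {s : State} :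
      ¬ 0 < e.eval s → Runs (.loop e p) s (e.cost + 1) s

/-- The machine is deterministic: the step count and the final state are determined by the program
and the initial state. -/
theorem Runs.deterministic {p : Program} {s s₁ s₂ : State} {t₁ t₂ : ℕ}
    (h₁ : Runs p s t₁ s₁) (h₂ : Runs p s t₂ s₂) : t₁ = t₂ ∧ s₁ = s₂ := by
  induction h₁ generalizing t₂ s₂ with
  | skip => cases h₂; exact ⟨rfl, rfl⟩
  | assign => cases h₂; exact ⟨rfl, rfl⟩
  | write => cases h₂; exact ⟨rfl, rfl⟩
  | seq _ _ ih₁ ih₂ =>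
    cases h₂ with
    | seq a b =>
      obtain ⟨rfl, rfl⟩ := ih₁ a
      obtain ⟨rfl, rfl⟩ := ih₂ b
      exact ⟨rfl, rfl⟩
  | ite_pos hp _ ih =>
    cases h₂ with
    | ite_pos _ a => obtain ⟨rfl, rfl⟩ := ih a; exact ⟨rfl, rfl⟩
    | ite_neg hn _ => exact absurd hp hn
  | ite_neg hn _ ih =>
    cases h₂ with
    | ite_pos hp _ => exact absurd hp hn
    | ite_neg _ a => obtain ⟨rfl, rfl⟩ := ih a; exact ⟨rfl, rfl⟩
  | loop_pos hp _ _ ih₁ ih₂ =>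
    cases h₂ with
    | loop_pos _ a b =>
      obtain ⟨rfl, rfl⟩ := ih₁ a
      obtain ⟨rfl, rfl⟩ := ih₂ b
      exact ⟨rfl, rfl⟩
    | loop_neg hn => exact absurd hp hn
  | loop_neg hn =>
    cases h₂ with
    | loop_pos hp _ _ => exact absurd hp hn
    | loop_neg _ => exact ⟨rfl, rfl⟩

/-- The initial state on the input string `w`: register `0` holds the length of `w`, the cells
`0, 1, …` of array `0` hold the bits of `w`, and everything else is `0`. -/
def State.init (w : List Bool) : State where
  reg r := if r = 0 then (w.length : ℤ) else 0
  arr a i := if a = 0 ∧ 0 ≤ i ∧ w.getD i.toNat false = true then 1 else 0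

/-- The final state `s` carries a correct answer for `I`: either register `0` holds `1` and the
first `n` cells of array `0` are a solution of `I`, or register `0` holds `0` and `I` has no
solution. -/
def State.IsAnswer (s : State) {n m : ℕ} (I : ILP (Fin n) (Fin m)) : Prop :=
  (s.reg 0 = 1 ∧ I.IsSolution fun j => s.arr 0 (j : ℕ)) ∨
    (s.reg 0 = 0 ∧ ¬ ∃ x, I.IsSolution x)

/-- Started on the unary encoding of `I`, the program halts after at most `T` steps with a correct
answer for `I`. -/
def Program.SolvesWithin (P : Program) {n m : ℕ} (I : ILP (Fin n) (Fin m)) (T : ℕ) : Prop :=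
  ∃ (t : ℕ) (s : State), Runs P (State.init (Unary.encode I)) t s ∧ t ≤ T ∧ s.IsAnswer I

end RAM

/-! The algorithm never computes the fracture number `k` or an optimal backdoor. It finds some set
of few global constraints whose removal leaves classes of at most `l` vertices, bounds the variables
by a number `M`, and optimizes over a box by dynamic programming. For fixed `k` everything is
polynomial in the input length `N`.

Classes. For `l = 1, 2, …` the constraints are added one by one, each merging the classes of its
variables; a constraint that would create a class with more than `l` vertices becomes global.
Compare this with a backdoor `S` of size at most `k` that leaves components of size at most `k ≤ l`.
A class without a constraint from `S` lies inside one component, so a constraint outside `S` becomes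
global only if it touches a class that contains a constraint from `S`. There are at most `k` such
classes, each has at most `l` vertices, and each variable occurs in at most `k` constraints outside
`S`. Hence at most `k + k * l * k` constraints are global (`IsTight.card_le`), and the search, which
accepts `4 ^ l` of them, stops at `l = k + 1` at the latest.

Bound. An integer vector is a sum of signed unit vectors. A long family of integers with small
entries and small sum has a short zero-sum subfamily, by pigeonhole; induction on the rows gives the
same for vectors (`exists_zero_sum`). This is applied inside each class for its at most `l` rows,
and then to the resulting blocks for the global rows. So a large vector with small image contains a
nonzero kernel vector with the same signs, where the exponent of the bound depends only on `l` and
the number of global rows (`exists_kernel_vector`). Consequently a large feasible assignment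
contains a recession direction (`exists_recession_of_large`). Arguments with vectors of minimal norm
then show that a solution, if there is one, can be chosen in the box of size `M`, and that an
optimum of this box is a solution as soon as the box of size `2 * M` has no better assignment
(`exists_small_solution`, `isSolution_of_double`). Comparing the two boxes thus decides the
instance, including unboundedness.

Optimization. Variables are processed class by class. Partial assignments with the same row sums
have the same completions, so only a best one is kept. Finished rows have a forced sum, rows of
later classes have sum zero, the rows of the current class are determined by at most `l` variables,
and the few global rows have polynomially many possible sums; so the table stays small
(`Represents.card_le`).

Running time. The program is fixed, so a bound `X` on the number of iterations of every single loop
bounds the time by its size times a fixed power of `X + 1`. The logic `wp X` proves correctness and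
this bound together. -/

/-! ### A weakest-precondition calculus for the random access machine -/

namespace RAM

instance : Add Expr := ⟨Expr.add⟩
instance : Sub Expr := ⟨Expr.sub⟩

@[simp] theorem Expr.eval_add' (s : State) (a b : Expr) : (a + b).eval s = a.eval s + b.eval s := rfl
@[simp] theorem Expr.eval_sub' (s : State) (a b : Expr) : (a - b).eval s = a.eval s - b.eval s := rfl
@[simp] theorem Expr.eval_reg (s : State) (r : ℕ) : (Expr.reg r).eval s = s.reg r := rfl
@[simp] theorem Expr.eval_const (s : State) (c : ℤ) : (Expr.const c).eval s = c := rfl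
@[simp] theorem Expr.eval_read (s : State) (a : ℕ) (e : Expr) :
    (Expr.read a e).eval s = s.arr a (e.eval s) := rfl

@[simp] theorem State.setReg_arr (s : State) (r : ℕ) (x : ℤ) : (s.setReg r x).arr = s.arr := rfl
@[simp] theorem State.setReg_reg (s : State) (r q : ℕ) (x : ℤ) :
    (s.setReg r x).reg q = if q = r then x else s.reg q := by
  simp [State.setReg, Function.update_apply]
@[simp] theorem State.setArr_reg (s : State) (a : ℕ) (i x : ℤ) : (s.setArr a i x).reg = s.reg := rfl
@[simp] theorem State.setArr_arr (s : State) (a b : ℕ) (i x : ℤ) :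
    (s.setArr a i x).arr b = if b = a then Function.update (s.arr a) i x else s.arr b := by
  by_cases h : b = a
  · subst h; simp [State.setArr]
  · simp [State.setArr, h]

/-- Unrolling of a loop at most `fuel` times. -/
def loopWp (test : State → Prop) (body : (State → Prop) → State → Prop) (Q : State → Prop) :
    ℕ → State → Prop
  | 0, s => ¬ test s ∧ Q s
  | fuel + 1, s => (test s → body (loopWp test body Q fuel) s) ∧ (¬ test s → Q s)

/-- Started in `s`, the program `p` halts in a state satisfying `Q`, and every execution of a loop
consists of at most `X` iterations. -/
def wp (X : ℕ) : Program → (State → Prop) → State → Prop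
  | .skip, Q => Q
  | .assign r e, Q => fun s => Q (s.setReg r (e.eval s))
  | .write a i e, Q => fun s => Q (s.setArr a (i.eval s) (e.eval s))
  | .seq p q, Q => wp X p (wp X q Q)
  | .ite e p q, Q => fun s => (0 < e.eval s → wp X p Q s) ∧ (¬ 0 < e.eval s → wp X q Q s)
  | .loop e p, Q => loopWp (fun s => 0 < e.eval s) (wp X p) Q X

section

variable {X : ℕ} {Q : State → Prop} {s : State}

@[simp] theorem wp_skip : wp X .skip Q s ↔ Q s := Iff.rfl

@[simp] theorem wp_assign {r : ℕ} {e : Expr} :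
    wp X (.assign r e) Q s ↔ Q (s.setReg r (e.eval s)) := Iff.rfl

@[simp] theorem wp_write {a : ℕ} {i e : Expr} :
    wp X (.write a i e) Q s ↔ Q (s.setArr a (i.eval s) (e.eval s)) := Iff.rfl

@[simp] theorem wp_seq {p q : Program} : wp X (.seq p q) Q s ↔ wp X p (fun s' => wp X q Q s') s :=
  Iff.rfl

@[simp] theorem wp_ite {e : Expr} {p q : Program} : wp X (.ite e p q) Q s ↔
    (0 < e.eval s → wp X p Q s) ∧ (¬ 0 < e.eval s → wp X q Q s) := Iff.rfl

end

/-- An upper bound on the number of steps if every execution of a loop consists of at most `X`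
iterations. -/
def Program.bound (X : ℕ) : Program → ℕ
  | .skip => 1
  | .assign _ e => e.cost + 1
  | .write _ i e => i.cost + e.cost + 1
  | .seq p q => p.bound X + q.bound X
  | .ite e p q => e.cost + 1 + p.bound X + q.bound X
  | .loop e p => (X + 1) * (e.cost + 1 + p.bound X)

/-- Once every loop is limited to `X` iterations, the step count is bounded by a number that depends
on the program and on `X` but not on the state. One derivation therefore yields both termination in
time and correctness. -/
theorem exists_runs_of_wp {X : ℕ} {p : Program} {Q : State → Prop} {s : State} (h : wp X p Q s) :
    ∃ t s', Runs p s t s' ∧ t ≤ p.bound X ∧ Q s' := by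
  induction p generalizing Q s with
  | skip => exact ⟨1, s, .skip s, le_rfl, h⟩
  | assign r e => exact ⟨_, _, .assign r e s, le_rfl, h⟩
  | write a i e => exact ⟨_, _, .write a i e s, le_rfl, h⟩
  | seq p q ihp ihq =>
    obtain ⟨t, s', hr, ht, h'⟩ := ihp h
    obtain ⟨t', s'', hr', ht', h''⟩ := ihq h'
    exact ⟨_, _, .seq hr hr', Nat.add_le_add ht ht', h''⟩
  | ite e p q ihp ihq =>
    by_cases he : 0 < e.eval s
    · obtain ⟨t, s', hr, ht, h'⟩ := ihp (h.1 he)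
      exact ⟨_, _, .ite_pos he hr, by simp only [Program.bound]; omega, h'⟩
    · obtain ⟨t, s', hr, ht, h'⟩ := ihq (h.2 he)
      exact ⟨_, _, .ite_neg he hr, by simp only [Program.bound]; omega, h'⟩
  | loop e p ih =>
    have key : ∀ (n : ℕ) (s : State), loopWp (fun s => 0 < e.eval s) (wp X p) Q n s →
        ∃ t s', Runs (.loop e p) s t s' ∧ t ≤ (n + 1) * (e.cost + 1 + p.bound X) ∧ Q s' := by
      intro n
      induction n with
      | zero =>
        intro s h
        exact ⟨_, _, .loop_neg h.1, by nlinarith, h.2⟩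
      | succ n ihn =>
        intro s h
        by_cases he : 0 < e.eval s
        · obtain ⟨t, s', hr, ht, h'⟩ := ih (h.1 he)
          obtain ⟨t', s'', hr', ht', h''⟩ := ihn s' h'
          exact ⟨_, _, .loop_pos he hr hr', by linarith, h''⟩
        · exact ⟨_, _, .loop_neg he, by nlinarith, h.2 he⟩
    exact key X s h

/-- The registers assigned by a program. -/
def Program.regs : Program → List ℕ
  | .skip => []
  | .assign r _ => [r]
  | .write _ _ _ => []
  | .seq p q => p.regs ++ q.regs
  | .ite _ p q => p.regs ++ q.regs
  | .loop _ p => p.regs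

/-- The arrays written by a program. -/
def Program.arrs : Program → List ℕ
  | .skip => []
  | .assign _ _ => []
  | .write a _ _ => [a]
  | .seq p q => p.arrs ++ q.arrs
  | .ite _ p q => p.arrs ++ q.arrs
  | .loop _ p => p.arrs

/-- `s'` differs from `s` at most in the registers in `R` and in the arrays in `A`. -/
structure Agree (R A : List ℕ) (s s' : State) : Prop where
  reg : ∀ r, r ∉ R → s'.reg r = s.reg r
  arr : ∀ a, a ∉ A → s'.arr a = s.arr a

theorem Agree.refl (R A : List ℕ) (s : State) : Agree R A s s := ⟨fun _ _ => rfl, fun _ _ => rfl⟩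

theorem Agree.mono {R A R' A' : List ℕ} {s s' : State} (h : Agree R A s s') (hR : R ⊆ R')
    (hA : A ⊆ A') : Agree R' A' s s' :=
  ⟨fun r hr => h.reg r fun h' => hr (hR h'), fun a ha => h.arr a fun h' => ha (hA h')⟩

theorem Agree.trans {R A : List ℕ} {s s' s'' : State} (h : Agree R A s s')
    (h' : Agree R A s' s'') : Agree R A s s'' :=
  ⟨fun r hr => (h'.reg r hr).trans (h.reg r hr), fun a ha => (h'.arr a ha).trans (h.arr a ha)⟩

theorem agree_setReg {R A : List ℕ} {s : State} {r : ℕ} {x : ℤ} (h : r ∈ R) :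
    Agree R A s (s.setReg r x) :=
  ⟨fun q hq => by
    have : q ≠ r := fun e => hq (e ▸ h)
    simp [this], fun _ _ => rfl⟩

/-- The frame rule. Specifications need to mention only what changes; all other registers and arrays
are transported by `Agree`, with side conditions on explicit lists that are decidable. -/
theorem wp_frame {X : ℕ} {p : Program} {Q Q' : State → Prop} {s : State} (h : wp X p Q s)
    (hQ : ∀ s', Q s' → Agree p.regs p.arrs s s' → Q' s') : wp X p Q' s := by
  induction p generalizing Q Q' s with
  | skip => exact hQ s h (Agree.refl _ _ _)
  | assign r e =>
    exact hQ _ h ⟨fun q hq => by simp_all [Program.regs], fun _ _ => rfl⟩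
  | write a i e =>
    exact hQ _ h ⟨fun _ _ => rfl, fun q hq => by simp_all [Program.arrs]⟩
  | seq p q ihp ihq =>
    refine ihp h fun s' h' hs' => ihq h' fun s'' h'' hs'' => hQ s'' h'' ?_
    exact (hs'.mono (by simp [Program.regs]) (by simp [Program.arrs])).trans
      (hs''.mono (by simp [Program.regs]) (by simp [Program.arrs]))
  | ite e p q ihp ihq =>
    exact ⟨fun he => ihp (h.1 he) fun s' h' hs' => hQ s' h'
        (hs'.mono (by simp [Program.regs]) (by simp [Program.arrs])),
      fun he => ihq (h.2 he) fun s' h' hs' => hQ s' h'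
        (hs'.mono (by simp [Program.regs]) (by simp [Program.arrs]))⟩
  | loop e p ih =>
    have key : ∀ (n : ℕ) (s : State), loopWp (fun s => 0 < e.eval s) (wp X p) Q n s →
        (∀ s', Q s' → Agree p.regs p.arrs s s' → Q' s') →
        loopWp (fun s => 0 < e.eval s) (wp X p) Q' n s := by
      intro n
      induction n with
      | zero => exact fun s h hQ => ⟨h.1, hQ s h.2 (Agree.refl _ _ _)⟩
      | succ n ihn =>
        exact fun s h hQ => ⟨fun he => ih (h.1 he) fun s' h' hs' => ihn s' h' fun s'' h'' hs'' =>
            hQ s'' h'' (hs'.trans hs''), fun he => hQ s (h.2 he) (Agree.refl _ _ _)⟩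
    exact key X s h hQ

/-- The consequence rule, together with the fact that a program changes only the registers and
arrays that it mentions. -/
theorem wp_conseq {X : ℕ} {p : Program} {Q Q' : State → Prop} {s : State} (h : wp X p Q s)
    (R A : List ℕ) (hR : p.regs ⊆ R) (hA : p.arrs ⊆ A)
    (hQ : ∀ s', Q s' → Agree R A s s' → Q' s') : wp X p Q' s :=
  wp_frame h fun s' h' hs' => hQ s' h' (hs'.mono hR hA)

/-- The rule for loops: the invariant `Inv a` holds after `a` iterations. -/
theorem wp_loop {X : ℕ} {e : Expr} {p : Program} {Q : State → Prop} {s : State}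
    (R A : List ℕ) (hR : p.regs ⊆ R) (hA : p.arrs ⊆ A) (Inv : ℕ → State → Prop) (h0 : Inv 0 s)
    (step : ∀ a s', Agree R A s s' → Inv a s' → 0 < e.eval s' → a < X ∧ wp X p (Inv (a + 1)) s')
    (post : ∀ a s', Agree R A s s' → Inv a s' → ¬ 0 < e.eval s' → Q s') :
    wp X (.loop e p) Q s := by
  have key : ∀ (n a : ℕ) (s' : State), a + n = X → Agree R A s s' → Inv a s' →
      loopWp (fun s => 0 < e.eval s) (wp X p) Q n s' := by
    intro n
    induction n with
    | zero =>
      intro a s' ha hs hI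
      have hn : ¬ 0 < e.eval s' := fun he => by have := (step a s' hs hI he).1; omega
      exact ⟨hn, post a s' hs hI hn⟩
    | succ n ih =>
      intro a s' ha hs hI
      exact ⟨fun he => wp_frame (step a s' hs hI he).2 fun s'' h'' hs'' =>
        ih (a + 1) s'' (by omega) (hs.trans (hs''.mono hR hA)) h'', post a s' hs hI⟩
  exact key X 0 s (by omega) (Agree.refl _ _ _) h0

/-- `for i = 0, …, h - 1 do body`, where `h` is a register. -/
def Program.forLoop (i h : ℕ) (body : Program) : Program :=
  .seq (.assign i (.const 0))
    (.loop (.sub (.reg h) (.reg i)) (.seq body (.assign i (.add (.reg i) (.const 1)))))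

theorem wp_for {X : ℕ} {i h : ℕ} {body : Program} {Q : State → Prop} {s : State} (N : ℕ)
    (R A : List ℕ) (hR : (Program.forLoop i h body).regs ⊆ R) (hA : (Program.forLoop i h body).arrs ⊆ A)
    (hh : h ∉ R) (hi : i ∉ body.regs) (hs : s.reg h = N) (hN : N ≤ X)
    (Inv : ℕ → State → Prop) (h0 : Inv 0 (s.setReg i 0))
    (step : ∀ a < N, ∀ s', Agree R A s s' → s'.reg i = a → Inv a s' →
      wp X body (fun s'' => Inv (a + 1) (s''.setReg i ((a + 1 : ℕ) : ℤ))) s')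
    (post : ∀ s', Agree R A s s' → Inv N s' → Q s') :
    wp X (.forLoop i h body) Q s := by
  have hiR : i ∈ R := hR (by simp [Program.forLoop, Program.regs])
  have hRb : body.regs ⊆ R := fun r hr => hR (by simp [Program.forLoop, Program.regs, hr])
  have hAb : body.arrs ⊆ A := fun r hr => hA (by simp [Program.forLoop, Program.arrs, hr])
  have hini : Agree R A s (s.setReg i 0) := agree_setReg hiR
  change wp X (.loop _ _) Q (s.setReg i 0)
  refine wp_loop R A (by simpa [Program.regs] using ⟨hRb, hiR⟩) (by simpa [Program.arrs] using hAb)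
    (fun a s' => a ≤ N ∧ s'.reg i = a ∧ Inv a s') ⟨Nat.zero_le _, by simp, h0⟩ ?_ ?_
  · rintro a s' hs' ⟨ha, hia, hI⟩ he
    have hs' := hini.trans hs'
    have haN : a < N := by
      have := hs'.reg h hh
      simp only [Expr.eval, this, hs, hia] at he
      omega
    refine ⟨by omega, ?_⟩
    change wp X body _ s'
    refine wp_frame (step a haN s' hs' hia hI) fun s'' h'' hs'' => ?_
    have h1 : s''.reg i = a := (hs''.reg i hi).trans hia
    have h2 : (Expr.add (Expr.reg i) (Expr.const 1)).eval s'' = ((a + 1 : ℕ) : ℤ) := by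
      simp [Expr.eval, h1]
    simp only [wp, h2]
    exact ⟨haN, by simp, h''⟩
  · rintro a s' hs' ⟨ha, hia, hI⟩ he
    have hs' := hini.trans hs'
    have haN : a = N := by
      have := hs'.reg h hh
      simp only [Expr.eval, this, hs, hia] at he
      omega
    exact post s' hs' (haN ▸ hI)

/-- The number of nodes of a program, counting the expressions in it. -/
def Program.size : Program → ℕ
  | .skip => 1
  | .assign _ e => e.cost + 1
  | .write _ i e => i.cost + e.cost + 1
  | .seq p q => p.size + q.size
  | .ite e p q => e.cost + 1 + p.size + q.size
  | .loop e p => e.cost + 1 + p.size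

/-- The nesting depth of loops. -/
def Program.depth : Program → ℕ
  | .skip => 0
  | .assign _ _ => 0
  | .write _ _ _ => 0
  | .seq p q => p.depth + q.depth
  | .ite _ p q => p.depth + q.depth
  | .loop _ p => p.depth + 1

/-- Depths add up along a sequence, so the powers of `X + 1` multiply and each summand is at most
the product. The exponent is larger than the true nesting depth, but it is still a constant of the
program. -/
theorem Program.bound_le (X : ℕ) (p : Program) : p.bound X ≤ p.size * (X + 1) ^ p.depth := by
  have h1 : ∀ d : ℕ, 1 ≤ (X + 1) ^ d := fun d => Nat.one_le_pow _ _ (by omega)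
  induction p with
  | skip => simp [bound, size, depth]
  | assign r e => simp [bound, size, depth]
  | write a i e => simp [bound, size, depth]
  | seq p q ihp ihq =>
    simp only [bound, size, depth, pow_add]
    have := h1 p.depth; have := h1 q.depth
    generalize (X + 1) ^ p.depth = a at *
    generalize (X + 1) ^ q.depth = b at *
    have hp : p.size * a ≤ p.size * (a * b) := Nat.mul_le_mul_left _ (by nlinarith)
    have hq : q.size * b ≤ q.size * (a * b) := Nat.mul_le_mul_left _ (by nlinarith)
    nlinarith
  | ite e p q ihp ihq =>
    simp only [bound, size, depth, pow_add]
    have := h1 p.depth; have := h1 q.depth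
    generalize (X + 1) ^ p.depth = a at *
    generalize (X + 1) ^ q.depth = b at *
    have hp : p.size * a ≤ p.size * (a * b) := Nat.mul_le_mul_left _ (by nlinarith)
    have hq : q.size * b ≤ q.size * (a * b) := Nat.mul_le_mul_left _ (by nlinarith)
    have he : (e.cost + 1) * 1 ≤ (e.cost + 1) * (a * b) := Nat.mul_le_mul_left _ (by nlinarith)
    nlinarith
  | loop e p ih =>
    simp only [bound, size, depth, pow_succ]
    have := h1 p.depth
    generalize (X + 1) ^ p.depth = a at *
    have he : (e.cost + 1) * 1 ≤ (e.cost + 1) * a := Nat.mul_le_mul_left _ this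
    calc (X + 1) * (e.cost + 1 + p.bound X) ≤ (X + 1) * ((e.cost + 1) * a + p.size * a) := by
          gcongr; omega
      _ = _ := by ring

end RAM

/-- Sequential composition of programs. -/
infixr:60 " ;; " => RAM.Program.seq

/-- A register as an expression. -/
prefix:max "§" => RAM.Expr.reg
/-- A numeral as an expression. -/
prefix:max "¢" => RAM.Expr.const

namespace RAM.Program

/-! ### The program

Registers: `0` input length and answer, `1` position in the input, `2` value read, `3` sign or kind,
`4` number `n` of variables, `5` number `m` of constraints, `6` record length `w = n + m + 1`,
`7` `n + m`, `8, 9` loop counters, `10` pointer, `11` component size `l`, `12` threshold `4 ^ l`,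
`13` number of global constraints, `14` constraint, `15` label, `16` size of a class, `17` vertex,
`18` bound on the variables, `19` number of squarings, `20, 21, 22` arithmetic,
`23` box size, `24` label, `25` variable, `26` its column, `27, 28, 29` ends of the two layers of the
table, `30` record, `31` value of the variable, `32, 33` bounds of the variable, `34, 35, 36`
search in the table, `37` result of a test, `38, 39, 43` loop counters, `40` pointer,
`41, 42` result of the first run.

Arrays: `0` input and output, `1` extended columns, `2` right-hand side, `3, 4, 5, 6` kinds and
values of lower and upper bounds, `7` labels, `8` touched labels, `9` table, `10` candidate,
`11` processed variables, `12` open constraints. -/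

/-- Read a natural number in unary into register `2`. -/
def readNat : Program :=
  assign 2 ¢0 ;; loop (.read 0 §1) (assign 2 (§2 + ¢1) ;; assign 1 (§1 + ¢1)) ;;
    assign 1 (§1 + ¢1)

/-- Read an integer into register `2`. -/
def readInt : Program :=
  assign 3 (.read 0 §1) ;; assign 1 (§1 + ¢1) ;; readNat ;; ite §3 (assign 2 (¢0 - §2)) skip

/-- Read an extended integer: its kind into register `3`, its value into register `2`. -/
def readExtInt : Program :=
  ite (.read 0 §1)
    -- With second bit `b` the kind is `1 - 2 * b`, that is `-1` for `-∞` and `1` for `+∞`.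
    (assign 3 (¢1 - .read 0 (§1 + ¢1) - .read 0 (§1 + ¢1)) ;; assign 1 (§1 + ¢2) ;; assign 2 ¢0)
    (assign 1 (§1 + ¢1) ;; readInt ;; assign 3 ¢0)

/-- Read the numbers of variables and constraints. -/
def readSizes : Program :=
  readNat ;; assign 4 §2 ;; readNat ;; assign 5 §2 ;; assign 7 (§4 + §5) ;; assign 6 (§7 + ¢1)

/-- Read one row of the matrix. -/
def readRow : Program :=
  assign 10 §8 ;; forLoop 9 4 (readInt ;; write 1 §10 §2 ;; assign 10 (§10 + §6))

/-- Read the matrix. -/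
def readMatrix : Program := forLoop 8 5 readRow

/-- Read the right-hand side. -/
def readRhs : Program := forLoop 8 5 (readInt ;; write 2 §8 §2)

/-- Read the lower bounds. -/
def readLower : Program := forLoop 8 4 (readExtInt ;; write 3 §8 §3 ;; write 4 §8 §2)

/-- Read the upper bounds. -/
def readUpper : Program := forLoop 8 4 (readExtInt ;; write 5 §8 §3 ;; write 6 §8 §2)

/-- Read the objective and write the unit vectors. -/
def readObj : Program :=
  assign 10 §5 ;; forLoop 8 4
    (readInt ;; write 1 §10 §2 ;; write 1 (§10 + ¢1 + §8) ¢1 ;; assign 10 (§10 + §6))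

/-- Read the instance. -/
def parse : Program :=
  readSizes ;; readMatrix ;; readRhs ;; readLower ;; readUpper ;; readObj

/-- Give every variable its own label, and the constraints the label `-1`. -/
def initLabels : Program :=
  assign 13 ¢0 ;; forLoop 17 7 (ite (§4 - §17) (write 7 §17 §17) (write 7 §17 (¢(-1))))

/-- Mark the labels of the variables of a constraint, and let register `15` be one of them. -/
def touch : Program :=
  forLoop 17 4 (write 8 §17 ¢0) ;; assign 15 (¢(-1)) ;; assign 10 §14 ;;
    forLoop 17 4
      (ite (.read 1 §10) (write 8 (.read 7 §17) ¢1 ;; assign 15 (.read 7 §17))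
          (ite (¢0 - .read 1 §10) (write 8 (.read 7 §17) ¢1 ;; assign 15 (.read 7 §17)) skip) ;;
        assign 10 (§10 + §6))

/-- The number of vertices with a touched label, plus one. -/
def touchedSize : Program :=
  assign 16 ¢1 ;; forLoop 17 7 (assign 16 (§16 + .read 8 (.read 7 §17)))

/-- Merge the touched classes and the current constraint. -/
def merge : Program :=
  forLoop 17 7 (ite (.read 8 (.read 7 §17)) (write 7 §17 §15) skip) ;; write 7 (§4 + §14) §15

/-- Process one constraint: make it global if it would lead to a class that is too large. -/
def labelRow : Program :=
  touch ;; touchedSize ;; ite (§16 - §11) (assign 13 (§13 + ¢1)) merge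

/-- Compute the classes for the size `l`. -/
def label : Program := initLabels ;; forLoop 14 5 labelRow

/-- Find a size for which there are few global constraints. -/
def search : Program :=
  -- The fictitious count `2` exceeds the threshold `4 ^ 0`, which forces the first round with `l =
  -- 1`.
  assign 11 ¢0 ;; assign 12 ¢1 ;; assign 13 ¢2 ;;
    loop (§13 - §12) (assign 11 (§11 + ¢1) ;; assign 12 (§12 + §12 + §12 + §12) ;; label)

/-- Compute the bound on the variables by repeated squaring. -/
def computeBound : Program :=
  assign 18 §0 ;; assign 20 (§11 + §13) ;; assign 19 (§20 + §20 + §20 + §20 + ¢6) ;;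
    forLoop 20 19 (assign 21 ¢0 ;; forLoop 22 18 (assign 21 (§21 + §18)) ;; assign 18 §21)

/-- Determine the open constraints, those with an unprocessed variable. -/
def openRows : Program :=
  forLoop 38 5 (write 12 §38 ¢0 ;; assign 40 §38 ;;
    forLoop 39 4
      (ite (.read 11 §39) skip
          (ite (.read 1 §40) (write 12 §38 ¢1) (ite (¢0 - .read 1 §40) (write 12 §38 ¢1) skip)) ;;
        assign 40 (§40 + §6)))

/-- Test whether the candidate satisfies all constraints that are not open. -/
def check : Program :=
  assign 37 ¢1 ;; forLoop 38 5
    (ite (.read 12 §38) skip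
      (ite (.read 10 §38 - .read 2 §38) (assign 37 ¢0)
        (ite (.read 2 §38 - .read 10 §38) (assign 37 ¢0) skip)))

/-- Copy the candidate to the record that starts in register `36`. -/
def store : Program := forLoop 38 6 (write 9 (§36 + §38) (.read 10 §38))

/-- Let register `35` be `1` if the keys of the candidate and of the record at register `34` differ,
otherwise `0`. -/
def compare : Program :=
  assign 35 ¢0 ;; forLoop 38 5
    (ite (.read 10 §38 - .read 9 (§34 + §38)) (assign 35 ¢1)
      (ite (.read 9 (§34 + §38) - .read 10 §38) (assign 35 ¢1) skip))

/-- Find the first record with the key of the candidate. -/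
def find : Program :=
  assign 34 §28 ;; assign 35 ¢1 ;;
    loop §35 (compare ;; ite §35 (assign 34 (§34 + §6)) skip)

/-- Insert the candidate into the table. -/
def insert : Program :=
  -- The candidate is first written behind the last record. It serves as a sentinel for the search
  -- and becomes a record by moving the end pointer.
  assign 36 §29 ;; store ;; find ;;
    ite (§29 - §34)
      (ite (.read 10 §5 - .read 9 (§34 + §5)) (assign 36 §34 ;; store) skip)
      (assign 29 (§29 + §6))

/-- Insert the candidate into the table if it passes the test. -/
def tryInsert : Program := check ;; ite §37 insert skip

/-- Load the record at register `30` into the candidate. -/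
def load : Program := forLoop 38 6 (write 10 §38 (.read 9 (§30 + §38)))

/-- Add the column at register `26` to the candidate. -/
def addColumn : Program := forLoop 38 6 (write 10 §38 (.read 10 §38 + .read 1 (§26 + §38)))

/-- Subtract the column at register `26` from the candidate. -/
def subColumn : Program := forLoop 38 6 (write 10 §38 (.read 10 §38 - .read 1 (§26 + §38)))

/-- Insert all extensions of one record. -/
def extendRecord : Program :=
  -- Without multiplication, the value `-B` is reached by subtracting the column `B` times; the
  -- later values by adding it once each.
  load ;; forLoop 43 23 subColumn ;; assign 31 (¢0 - §23) ;;
    loop (§23 - §31 + ¢1)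
      (ite (§31 - §32 + ¢1) (ite (§33 - §31 + ¢1) tryInsert skip) skip ;; addColumn ;;
        assign 31 (§31 + ¢1))

/-- The bounds of the current variable. -/
def variableBounds : Program :=
  -- A lower bound `+∞` becomes `B + 1`, and below an upper bound `-∞` becomes `-B - 1`, so that no
  -- value in the box passes.
  ite (.read 3 §25) (assign 32 (§23 + ¢1))
      (ite (¢0 - .read 3 §25) (assign 32 (¢0 - §23)) (assign 32 (.read 4 §25))) ;;
    ite (.read 5 §25) (assign 33 §23)
      (ite (¢0 - .read 5 §25) (assign 33 (¢0 - §23 - ¢1)) (assign 33 (.read 6 §25)))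

/-- Process one variable. -/
def processVariable : Program :=
  write 11 §25 ¢1 ;; openRows ;; variableBounds ;; assign 30 §27 ;;
    loop (§28 - §30) (extendRecord ;; assign 30 (§30 + §6)) ;; assign 27 §28 ;; assign 28 §29

/-- The table for the empty set of variables. -/
def initTable : Program :=
  forLoop 39 4 (write 11 §39 ¢0) ;; openRows ;; forLoop 38 6 (write 10 §38 ¢0) ;;
    assign 27 ¢0 ;; assign 28 ¢0 ;; assign 29 ¢0 ;; tryInsert ;; assign 28 §29

/-- Process the variables with label `L`, where `L` is in register `24`. -/
def processClass : Program :=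
  assign 26 ¢0 ;; forLoop 25 4
    (ite (.read 7 §25 - §24) skip (ite (§24 - .read 7 §25) skip processVariable) ;;
      assign 26 (§26 + §6))

/-- Find a best feasible assignment in the box whose size is in register `23`. -/
def optimize : Program := initTable ;; forLoop 24 4 processClass

/-- Write the assignment of the record at register `27` to the output. -/
def output : Program := forLoop 38 4 (write 0 §38 (.read 9 (§27 + §5 + ¢1 + §38)))

/-- The answer, from the results of the two runs. -/
def answer : Program :=
  assign 0 ¢0 ;;
    ite (§28 - §27)
      (ite (§42 - .read 9 (§27 + §5)) skip (assign 0 ¢1 ;; output)) skip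

/-- The program for Unary ILP. -/
def solve : Program :=
  -- The box of size `2 * M` comes first, and only its optimal value is kept; the final table
  -- belongs to the box of size `M`, from which the answer is taken.
  parse ;; search ;; computeBound ;; assign 23 (§18 + §18) ;; optimize ;;
    assign 42 (.read 9 (§27 + §5)) ;; assign 23 §18 ;; optimize ;; answer

end RAM.Program

namespace RAM

/-! ### Reading the input -/

/-- The cells of `f` from `p` on hold the bits of `w`, followed by zeros. -/
def HoldsFrom (f : ℤ → ℤ) (p : ℤ) (w : List Bool) : Prop :=
  ∀ i : ℕ, f (p + i) = if w.getD i false = true then 1 else 0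

theorem HoldsFrom.head {f : ℤ → ℤ} {p : ℤ} {b : Bool} {w : List Bool}
    (h : HoldsFrom f p (b :: w)) : f p = if b = true then 1 else 0 := by
  simpa using h 0

theorem HoldsFrom.tail {f : ℤ → ℤ} {p : ℤ} {b : Bool} {w : List Bool}
    (h : HoldsFrom f p (b :: w)) : HoldsFrom f (p + 1) w := by
  intro i
  have := h (i + 1)
  rw [List.getD_cons_succ] at this
  rw [← this]
  congr 1
  push_cast
  ring

open Program

theorem readNat_spec {X k : ℕ} {s : State} {w : List Bool} (hk : k ≤ X)
    (h : HoldsFrom (s.arr 0) (s.reg 1) (Unary.encodeNat k ++ w)) :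
    wp X readNat (fun s' => s'.reg 2 = k ∧ HoldsFrom (s.arr 0) (s'.reg 1) w) s := by
  simp only [readNat, wp_seq, wp_assign, Expr.eval_const]
  refine wp_loop [2, 1] [] (by decide) (by decide) (fun a s' => a ≤ k ∧ s'.reg 2 = a ∧
    HoldsFrom (s.arr 0) (s'.reg 1) (Unary.encodeNat (k - a) ++ w)) ⟨by simp, by simp, by simpa using h⟩ ?_ ?_
  · rintro a s' hs ⟨hak, h2, h1⟩ he
    have harr := hs.arr 0 (by decide)
    simp only [Expr.eval_read, Expr.eval_reg, harr, State.setReg_arr] at he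
    have hlt : a < k := by
      by_contra hlt
      have : k - a = 0 := by omega
      rw [this] at h1
      have := h1.head
      simp only [Bool.false_eq_true, if_false] at this
      omega
    refine ⟨by omega, ?_⟩
    obtain ⟨d, hd⟩ : ∃ d, k - a = d + 1 := ⟨k - a - 1, by omega⟩
    rw [hd, Unary.encodeNat, List.replicate_succ, List.cons_append, List.cons_append] at h1
    simp only [wp_seq, wp_assign, Expr.eval_add', Expr.eval_reg, Expr.eval_const]
    refine ⟨hlt, by simp [h2], ?_⟩
    have hd' : k - (a + 1) = d := by omega
    rw [hd']
    simpa [Unary.encodeNat] using h1.tail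
  · rintro a s' hs ⟨hak, h2, h1⟩ he
    have harr := hs.arr 0 (by decide)
    simp only [Expr.eval_read, Expr.eval_reg, harr, State.setReg_arr] at he
    have hlt : a = k := by
      by_contra hlt
      obtain ⟨d, hd⟩ : ∃ d, k - a = d + 1 := ⟨k - a - 1, by omega⟩
      rw [hd, Unary.encodeNat, List.replicate_succ, List.cons_append, List.cons_append] at h1
      have := h1.head
      simp only [if_true] at this
      omega
    subst hlt
    rw [Nat.sub_self] at h1
    simp only [Expr.eval_add', Expr.eval_reg, Expr.eval_const]
    exact ⟨by simp [h2], by simpa using h1.tail⟩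

theorem readInt_spec {X : ℕ} {z : ℤ} {s : State} {w : List Bool} (hk : z.natAbs ≤ X)
    (h : HoldsFrom (s.arr 0) (s.reg 1) (Unary.encodeInt z ++ w)) :
    wp X readInt (fun s' => s'.reg 2 = z ∧ HoldsFrom (s.arr 0) (s'.reg 1) w) s := by
  simp only [readInt, wp_seq, wp_assign, wp_ite, wp_skip, Expr.eval_read, Expr.eval_reg, Expr.eval_const, Expr.eval_add']
  have h0 := h.head
  refine wp_conseq (readNat_spec hk (w := w) (by simpa using h.tail)) [1, 2] [] (by decide)
    (by decide) ?_
  rintro s' ⟨h2, h1⟩ hs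
  have h3 := hs.reg 3 (by decide)
  simp at h3 h1
  rw [h3, h0]
  by_cases hz : z < 0
  · simp [hz, h2, h1, abs_of_neg]
  · simp [hz, h2, h1, abs_of_nonneg (not_lt.1 hz)]

/-- The pair `k, v` represents the extended integer `e`: the kind `k` is `-1` for `-∞`, `1` for
`+∞`, and `0` for the finite value `v`. -/
def Represents (e : ExtInt) (k v : ℤ) : Prop :=
  (e = ⊥ ∧ k = -1) ∨ (e = ((⊤ : WithTop ℤ) : WithBot (WithTop ℤ)) ∧ k = 1) ∨
    (e = ExtInt.ofInt v ∧ k = 0)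

theorem readExtInt_spec {X : ℕ} {z : ExtInt} {s : State} {w : List Bool}
    (hk : (Unary.encodeExtInt z).length ≤ X)
    (h : HoldsFrom (s.arr 0) (s.reg 1) (Unary.encodeExtInt z ++ w)) :
    wp X readExtInt (fun s' => Represents z (s'.reg 3) (s'.reg 2) ∧
      HoldsFrom (s.arr 0) (s'.reg 1) w) s := by
  simp only [readExtInt, wp_seq, wp_assign, wp_ite, Expr.eval_read, Expr.eval_reg, Expr.eval_const, Expr.eval_add',
    Expr.eval_sub']
  match z, hk, h with
  | ⊥, hk, h =>
    have h0 := h.head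
    have h1 := h.tail.head
    have h2 := h.tail.tail
    simp only [if_true] at h0 h1
    rw [h0, h1]
    refine ⟨fun _ => ⟨Or.inl ⟨rfl, by simp⟩, ?_⟩, by simp⟩
    rw [add_assoc] at h2
    simpa using h2
  | ((⊤ : WithTop ℤ) : WithBot (WithTop ℤ)), hk, h =>
    have h0 := h.head
    have h1 := h.tail.head
    have h2 := h.tail.tail
    simp only [if_true, Bool.false_eq_true, if_false] at h0 h1
    rw [h0, h1]
    refine ⟨fun _ => ⟨Or.inr (Or.inl ⟨rfl, by simp⟩), ?_⟩, by simp⟩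
    rw [add_assoc] at h2
    simpa using h2
  | ((z : ℤ) : WithTop ℤ), hk, h =>
    have h0 := h.head
    have h1 := h.tail
    simp only [Bool.false_eq_true, if_false] at h0
    rw [h0]
    refine ⟨by simp, fun _ => ?_⟩
    have hz : z.natAbs ≤ X := by
      simp [Unary.encodeExtInt, Unary.encodeInt, Unary.encodeNat] at hk
      omega
    refine wp_conseq (readInt_spec hz (w := w) (by simpa using h1)) [1, 2, 3] [] (by decide)
      (by decide) ?_
    rintro s' ⟨h2, h1⟩ hs
    simp at h1
    exact ⟨Or.inr (Or.inr ⟨by simp [h2, ExtInt.ofInt], by simp⟩), by simpa using h1⟩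

end RAM

/-- The columns of the instance, extended by the objective and by the unit vectors. -/
def ILP.extended {n m : ℕ} (I : ILP (Fin n) (Fin m)) (j i : ℕ) : ℤ :=
  if hj : j < n then
    if hi : i < m then I.A ⟨i, hi⟩ ⟨j, hj⟩
    -- The unit-vector block makes a combination of columns carry its own coefficients, so the
    -- assignment can be read off from a record.
    else if i = m then I.obj ⟨j, hj⟩ else if i = m + 1 + j then 1 else 0
  else 0

namespace RAM

theorem flatMap_drop_finRange {m : ℕ} (f : Fin m → List Bool) {a : ℕ} (h : a < m) :
    ((List.finRange m).drop a).flatMap f =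
      f ⟨a, h⟩ ++ ((List.finRange m).drop (a + 1)).flatMap f := by
  rw [List.drop_eq_getElem_cons (by simpa using h)]
  simp

theorem flatMap_drop_finRange_self {m : ℕ} (f : Fin m → List Bool) :
    ((List.finRange m).drop m).flatMap f = [] := by
  rw [List.drop_eq_nil_of_le (by simp)]
  rfl

theorem cell_inj {w a b i j : ℕ} (ha : a < w) (hi : i < w) :
    j * w + i = b * w + a ↔ j = b ∧ i = a := by
  constructor
  · intro h
    have h1 : (j * w + i) / w = (b * w + a) / w := by rw [h]
    have h2 : (j * w + i) % w = (b * w + a) % w := by rw [h]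
    rw [Nat.mul_comm j, Nat.mul_comm b, Nat.mul_add_div (by omega), Nat.mul_add_div (by omega),
      Nat.div_eq_of_lt ha, Nat.div_eq_of_lt hi] at h1
    rw [Nat.mul_comm j, Nat.mul_comm b, Nat.mul_add_mod, Nat.mul_add_mod,
      Nat.mod_eq_of_lt ha, Nat.mod_eq_of_lt hi] at h2
    exact ⟨by simpa using h1, h2⟩
  · rintro ⟨rfl, rfl⟩; rfl

theorem update_cell {w a b i j : ℕ} (ha : a < w) (hi : i < w) (f : ℤ → ℤ) (v : ℤ) :
    Function.update f ((b * w + a : ℕ) : ℤ) v ((j * w + i : ℕ) : ℤ) =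
      if j = b ∧ i = a then v else f ((j * w + i : ℕ) : ℤ) := by
  rw [Function.update_apply]
  simp only [Nat.cast_inj, cell_inj ha hi]

/-- The cells of `f` hold the extended columns in those positions `(j, i)` for which `D j i`,
and `0` elsewhere. -/
def HoldsColumns {n m : ℕ} (I : ILP (Fin n) (Fin m)) (f : ℤ → ℤ) (D : ℕ → ℕ → Prop) : Prop :=
  ∀ j < n, ∀ i < n + m + 1, (D j i → f ((j * (n + m + 1) + i : ℕ) : ℤ) = I.extended j i) ∧
    (¬ D j i → f ((j * (n + m + 1) + i : ℕ) : ℤ) = 0)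

theorem HoldsColumns.congr {n m : ℕ} {I : ILP (Fin n) (Fin m)} {f : ℤ → ℤ} {D D' : ℕ → ℕ → Prop}
    (h : HoldsColumns I f D) (hD : ∀ j < n, ∀ i < n + m + 1, D j i ↔ D' j i) :
    HoldsColumns I f D' :=
  fun j hj i hi => ⟨fun h' => (h j hj i hi).1 ((hD j hj i hi).2 h'),
    fun h' => (h j hj i hi).2 fun h'' => h' ((hD j hj i hi).1 h'')⟩

theorem HoldsColumns.update {n m : ℕ} {I : ILP (Fin n) (Fin m)} {f : ℤ → ℤ} {D : ℕ → ℕ → Prop}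
    (h : HoldsColumns I f D) {b a : ℕ} (ha : a < n + m + 1) :
    HoldsColumns I (Function.update f ((b * (n + m + 1) + a : ℕ) : ℤ) (I.extended b a))
      (fun j i => (j = b ∧ i = a) ∨ D j i) := by
  intro j hj i hi
  rw [update_cell ha hi]
  by_cases h' : j = b ∧ i = a
  · obtain ⟨rfl, rfl⟩ := h'; simp
  · simpa [h'] using h j hj i hi

/-- The size registers hold the right values. -/
structure HasSizes (n m : ℕ) (s : State) : Prop where
  vars : s.reg 4 = n
  rows : s.reg 5 = m
  len : s.reg 6 = ((n + m + 1 : ℕ) : ℤ)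
  verts : s.reg 7 = ((n + m : ℕ) : ℤ)

theorem HasSizes.of_agree {n m : ℕ} {R A : List ℕ} {s s' : State} (h : HasSizes n m s)
    (hs : Agree R A s s') (hR : 4 ∉ R ∧ 5 ∉ R ∧ 6 ∉ R ∧ 7 ∉ R) : HasSizes n m s' :=
  ⟨(hs.reg 4 hR.1).trans h.vars, (hs.reg 5 hR.2.1).trans h.rows, (hs.reg 6 hR.2.2.1).trans h.len,
    (hs.reg 7 hR.2.2.2).trans h.verts⟩

open Program

theorem readSizes_spec {X n m : ℕ} {s : State} {w : List Bool} (hn : n ≤ X) (hm : m ≤ X)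
    (h : HoldsFrom (s.arr 0) (s.reg 1) (Unary.encodeNat n ++ (Unary.encodeNat m ++ w))) :
    wp X readSizes (fun s' => HasSizes n m s' ∧ HoldsFrom (s.arr 0) (s'.reg 1) w) s := by
  simp only [readSizes, wp_seq, wp_assign, Expr.eval_reg, Expr.eval_const, Expr.eval_add']
  refine wp_conseq (readNat_spec hn h) [1, 2] [] (by decide) (by decide) ?_
  rintro s1 ⟨h2, h1⟩ hs1
  have h0 := hs1.arr 0 (by decide)
  refine wp_conseq (readNat_spec (s := s1.setReg 4 (s1.reg 2)) hm (w := w) (by simpa [h0] using h1))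
    [1, 2] [] (by decide) (by decide) ?_
  rintro s2 ⟨h2', h1'⟩ hs2
  have h4 := hs2.reg 4 (by decide)
  simp only [State.setReg_reg, State.setReg_arr, h0, if_true] at h4 h1'
  refine ⟨⟨by simp [h4, h2], by simp [h2'], by simp [h4, h2, h2'], by simp [h4, h2, h2']⟩,
    by simpa using h1'⟩

variable {n m : ℕ} (I : ILP (Fin n) (Fin m)) {X : ℕ} {s : State} {w : List Bool}

/-- The input lists the matrix by rows while the memory stores columns, so the invariant describes a
region of positions and not an initial segment of the array. Cells outside the region are known to
be `0`, which finally supplies the zeros of the unit vectors. -/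
theorem readRow_spec (hn : n ≤ X) {i : ℕ} (hi : i < m) (hA : ∀ j, (I.A ⟨i, hi⟩ j).natAbs ≤ X)
    (hs : HasSizes n m s) (h8 : s.reg 8 = i)
    (h : HoldsFrom (s.arr 0) (s.reg 1)
      (((List.finRange n).flatMap fun j => Unary.encodeInt (I.A ⟨i, hi⟩ j)) ++ w))
    (hE : HoldsColumns I (s.arr 1) (fun _ i' => i' < i)) :
    wp X readRow (fun s' => HoldsColumns I (s'.arr 1) (fun _ i' => i' < i + 1) ∧
      HoldsFrom (s.arr 0) (s'.reg 1) w) s := by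
  simp only [readRow, wp_seq, wp_assign, Expr.eval_reg]
  refine wp_for n [1, 2, 3, 9, 10] [1] (by decide) (by decide) (by decide) (by decide)
    (by simp [hs.vars]) hn (fun a s' => s'.reg 10 = ((a * (n + m + 1) + i : ℕ) : ℤ) ∧
      HoldsColumns I (s'.arr 1) (fun j' i' => i' < i ∨ i' = i ∧ j' < a) ∧
      HoldsFrom (s.arr 0) (s'.reg 1)
        ((((List.finRange n).drop a).flatMap fun j => Unary.encodeInt (I.A ⟨i, hi⟩ j)) ++ w))
    ⟨by simp [h8], hE.congr (by simp), by simpa using h⟩ ?_ ?_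
  · rintro a ha s1 hs1 h9 ⟨h10, hcol, hst⟩
    have h0 := hs1.arr 0 (by decide)
    simp only [State.setReg_arr] at h0
    rw [flatMap_drop_finRange _ ha, List.append_assoc, ← h0] at hst
    rw [wp_seq]
    refine wp_conseq (readInt_spec (hA _) hst) [1, 2, 3] [] (by decide)
      (by decide) ?_
    rintro s2 ⟨h2, h1⟩ hs2
    simp only [wp_seq, wp_assign, wp_write, Expr.eval_reg, Expr.eval_add']
    have h6 : s2.reg 6 = ((n + m + 1 : ℕ) : ℤ) := by
      rw [hs2.reg 6 (by decide), hs1.reg 6 (by decide)]; simp [hs.len]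
    have h10' := hs2.reg 10 (by decide)
    have e1 := hs2.arr 1 (by decide)
    refine ⟨?_, ?_, ?_⟩
    · simp [h10', h10, h6]; ring
    · have e2 := (hcol.update (b := a) (a := i) (by omega)).congr
        (D' := fun j' i' => i' < i ∨ i' = i ∧ j' < a + 1) (by intro j _ i' _; omega)
      have e3 : I.extended a i = I.A ⟨i, hi⟩ ⟨a, ha⟩ := by simp [ILP.extended, ha, hi]
      rw [e3] at e2
      simpa [h10', h10, e1, h2] using e2
    · rw [h0] at h1
      simpa using h1
  · rintro s1 hs1 ⟨h10, hcol, hst⟩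
    rw [flatMap_drop_finRange_self] at hst
    exact ⟨hcol.congr (by intro j hj i' _; omega), hst⟩

theorem readMatrix_spec (hn : n ≤ X) (hm : m ≤ X) (hA : ∀ i j, (I.A i j).natAbs ≤ X)
    (hs : HasSizes n m s)
    (h : HoldsFrom (s.arr 0) (s.reg 1) (((List.finRange m).flatMap fun i =>
      (List.finRange n).flatMap fun j => Unary.encodeInt (I.A i j)) ++ w))
    (hE : HoldsColumns I (s.arr 1) (fun _ _ => False)) :
    wp X readMatrix (fun s' => HoldsColumns I (s'.arr 1) (fun _ i' => i' < m) ∧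
      HoldsFrom (s.arr 0) (s'.reg 1) w) s := by
  refine wp_for m [1, 2, 3, 8, 9, 10] [1] (by decide) (by decide) (by decide) (by decide)
    (by simp [hs.rows]) hm (fun a s' => HoldsColumns I (s'.arr 1) (fun _ i' => i' < a) ∧
      HoldsFrom (s.arr 0) (s'.reg 1) ((((List.finRange m).drop a).flatMap fun i =>
      (List.finRange n).flatMap fun j => Unary.encodeInt (I.A i j)) ++ w))
    ⟨hE.congr (by simp), by simpa using h⟩ ?_ ?_
  · rintro a ha s1 hs1 h8 ⟨hcol, hst⟩
    have h0 := hs1.arr 0 (by decide)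
    rw [flatMap_drop_finRange _ ha, List.append_assoc, ← h0] at hst
    refine wp_conseq (readRow_spec I hn ha (hA _) (hs.of_agree hs1 (by decide)) h8 hst hcol)
      [1, 2, 3, 9, 10] [1] (by decide) (by decide) ?_
    rintro s2 ⟨h2, h1⟩ hs2
    rw [h0] at h1
    exact ⟨by simpa using h2, by simpa using h1⟩
  · rintro s1 hs1 ⟨hcol, hst⟩
    rw [flatMap_drop_finRange_self] at hst
    exact ⟨hcol, hst⟩

theorem readRhs_spec (hm : m ≤ X) (hb : ∀ i, (I.rhs i).natAbs ≤ X) (hs : HasSizes n m s)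
    (h : HoldsFrom (s.arr 0) (s.reg 1)
      (((List.finRange m).flatMap fun i => Unary.encodeInt (I.rhs i)) ++ w)) :
    wp X readRhs (fun s' => (∀ i : Fin m, s'.arr 2 (i : ℕ) = I.rhs i) ∧
      HoldsFrom (s.arr 0) (s'.reg 1) w) s := by
  refine wp_for m [1, 2, 3, 8] [2] (by decide) (by decide) (by decide) (by decide)
    (by simp [hs.rows]) hm (fun a s' => (∀ i : Fin m, i < a → s'.arr 2 (i : ℕ) = I.rhs i) ∧
      HoldsFrom (s.arr 0) (s'.reg 1)
        ((((List.finRange m).drop a).flatMap fun i => Unary.encodeInt (I.rhs i)) ++ w))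
    ⟨by simp, by simpa using h⟩ ?_ ?_
  · rintro a ha s1 hs1 h8 ⟨hb', hst⟩
    have h0 := hs1.arr 0 (by decide)
    rw [flatMap_drop_finRange _ ha, List.append_assoc, ← h0] at hst
    simp only [wp_seq, wp_write, Expr.eval_reg]
    refine wp_conseq (readInt_spec (hb _) hst) [1, 2, 3] [] (by decide) (by decide) ?_
    rintro s2 ⟨h2, h1⟩ hs2
    rw [h0] at h1
    have e1 := hs2.arr 2 (by decide)
    have e2 := hs2.reg 8 (by decide)
    refine ⟨fun i hi => ?_, by simpa using h1⟩
    simp only [State.setReg_arr, State.setArr_arr, if_true, e1, e2, h8, h2, Function.update_apply,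
      Nat.cast_inj]
    split_ifs with h
    · subst h; rfl
    · exact hb' i (by omega)
  · rintro s1 hs1 ⟨hb', hst⟩
    rw [flatMap_drop_finRange_self] at hst
    exact ⟨fun i => hb' i i.2, hst⟩

theorem readLower_spec (hn : n ≤ X) (hb : ∀ j, (Unary.encodeExtInt (I.lower j)).length ≤ X)
    (hs : HasSizes n m s)
    (h : HoldsFrom (s.arr 0) (s.reg 1)
      (((List.finRange n).flatMap fun i => Unary.encodeExtInt (I.lower i)) ++ w)) :
    wp X readLower (fun s' => (∀ i : Fin n, Represents (I.lower i) (s'.arr 3 (i : ℕ))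
        (s'.arr 4 (i : ℕ))) ∧ HoldsFrom (s.arr 0) (s'.reg 1) w) s := by
  refine wp_for n [1, 2, 3, 8] [3, 4] (by decide) (by decide) (by decide) (by decide)
    (by simp [hs.vars]) hn (fun a s' => (∀ i : Fin n, i < a →
        Represents (I.lower i) (s'.arr 3 (i : ℕ)) (s'.arr 4 (i : ℕ))) ∧
      HoldsFrom (s.arr 0) (s'.reg 1)
        ((((List.finRange n).drop a).flatMap fun i => Unary.encodeExtInt (I.lower i)) ++ w))
    ⟨by simp, by simpa using h⟩ ?_ ?_
  · rintro a ha s1 hs1 h8 ⟨hb', hst⟩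
    have h0 := hs1.arr 0 (by decide)
    rw [flatMap_drop_finRange _ ha, List.append_assoc, ← h0] at hst
    simp only [wp_seq, wp_write, Expr.eval_reg]
    refine wp_conseq (readExtInt_spec (hb _) hst) [1, 2, 3] [] (by decide) (by decide) ?_
    rintro s2 ⟨h2, h1⟩ hs2
    rw [h0] at h1
    have e1 := hs2.arr 3 (by decide)
    have e1' := hs2.arr 4 (by decide)
    have e2 := hs2.reg 8 (by decide)
    refine ⟨fun i hi => ?_, by simpa using h1⟩
    simp [e1, e1', e2, h8, Function.update_apply]
    split_ifs with h
    · subst h; exact h2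
    · exact hb' i (by omega)
  · rintro s1 hs1 ⟨hb', hst⟩
    rw [flatMap_drop_finRange_self] at hst
    exact ⟨fun i => hb' i i.2, hst⟩

theorem readUpper_spec (hn : n ≤ X) (hb : ∀ j, (Unary.encodeExtInt (I.upper j)).length ≤ X)
    (hs : HasSizes n m s)
    (h : HoldsFrom (s.arr 0) (s.reg 1)
      (((List.finRange n).flatMap fun i => Unary.encodeExtInt (I.upper i)) ++ w)) :
    wp X readUpper (fun s' => (∀ i : Fin n, Represents (I.upper i) (s'.arr 5 (i : ℕ))
        (s'.arr 6 (i : ℕ))) ∧ HoldsFrom (s.arr 0) (s'.reg 1) w) s := by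
  refine wp_for n [1, 2, 3, 8] [5, 6] (by decide) (by decide) (by decide) (by decide)
    (by simp [hs.vars]) hn (fun a s' => (∀ i : Fin n, i < a →
        Represents (I.upper i) (s'.arr 5 (i : ℕ)) (s'.arr 6 (i : ℕ))) ∧
      HoldsFrom (s.arr 0) (s'.reg 1)
        ((((List.finRange n).drop a).flatMap fun i => Unary.encodeExtInt (I.upper i)) ++ w))
    ⟨by simp, by simpa using h⟩ ?_ ?_
  · rintro a ha s1 hs1 h8 ⟨hb', hst⟩
    have h0 := hs1.arr 0 (by decide)
    rw [flatMap_drop_finRange _ ha, List.append_assoc, ← h0] at hst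
    simp only [wp_seq, wp_write, Expr.eval_reg]
    refine wp_conseq (readExtInt_spec (hb _) hst) [1, 2, 3] [] (by decide) (by decide) ?_
    rintro s2 ⟨h2, h1⟩ hs2
    rw [h0] at h1
    have e1 := hs2.arr 5 (by decide)
    have e1' := hs2.arr 6 (by decide)
    have e2 := hs2.reg 8 (by decide)
    refine ⟨fun i hi => ?_, by simpa using h1⟩
    simp [e1, e1', e2, h8, Function.update_apply]
    split_ifs with h
    · subst h; exact h2
    · exact hb' i (by omega)
  · rintro s1 hs1 ⟨hb', hst⟩
    rw [flatMap_drop_finRange_self] at hst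
    exact ⟨fun i => hb' i i.2, hst⟩

theorem readObj_spec (hn : n ≤ X) (hb : ∀ i, (I.obj i).natAbs ≤ X) (hs : HasSizes n m s)
    (h : HoldsFrom (s.arr 0) (s.reg 1)
      (((List.finRange n).flatMap fun i => Unary.encodeInt (I.obj i)) ++ w))
    (hE : HoldsColumns I (s.arr 1) (fun _ i' => i' < m)) :
    wp X readObj (fun s' => HoldsColumns I (s'.arr 1) (fun _ _ => True)) s := by
  simp only [readObj, wp_seq, wp_assign, Expr.eval_reg]
  refine wp_for n [1, 2, 3, 8, 10] [1] (by decide) (by decide) (by decide) (by decide)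
    (by simp [hs.vars]) hn (fun a s' => s'.reg 10 = ((a * (n + m + 1) + m : ℕ) : ℤ) ∧
      HoldsColumns I (s'.arr 1) (fun j' i' => i' < m ∨ i' = m ∧ j' < a ∨ i' = m + 1 + j' ∧ j' < a) ∧
      HoldsFrom (s.arr 0) (s'.reg 1)
        ((((List.finRange n).drop a).flatMap fun j => Unary.encodeInt (I.obj j)) ++ w))
    ⟨by simp [hs.rows], hE.congr (by simp), by simpa using h⟩ ?_ ?_
  · rintro a ha s1 hs1 h8 ⟨h10, hcol, hst⟩
    have h0 := hs1.arr 0 (by decide)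
    simp only [State.setReg_arr] at h0
    rw [flatMap_drop_finRange _ ha, List.append_assoc, ← h0] at hst
    rw [wp_seq]
    refine wp_conseq (readInt_spec (hb _) hst) [1, 2, 3] [] (by decide)
      (by decide) ?_
    rintro s2 ⟨h2, h1⟩ hs2
    simp only [wp_seq, wp_assign, wp_write, Expr.eval_reg, Expr.eval_add', Expr.eval_const]
    have h6 : s2.reg 6 = ((n + m + 1 : ℕ) : ℤ) := by
      rw [hs2.reg 6 (by decide), hs1.reg 6 (by decide)]; simp [hs.len]
    have h10' := hs2.reg 10 (by decide)
    have h8' := hs2.reg 8 (by decide)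
    have e1 := hs2.arr 1 (by decide)
    refine ⟨?_, ?_, ?_⟩
    · simp [h10', h10, h6]; ring
    · have e2 := ((hcol.update (b := a) (a := m) (by omega)).update (b := a) (a := m + 1 + a)
        (by omega)).congr
        (D' := fun j' i' => i' < m ∨ i' = m ∧ j' < a + 1 ∨ i' = m + 1 + j' ∧ j' < a + 1)
        (by intro j _ i' _; omega)
      have e3 : I.extended a m = I.obj ⟨a, ha⟩ := by simp [ILP.extended, ha]
      have e4 : I.extended a (m + 1 + a) = 1 := by
        have h1 : ¬ m + 1 + a < m := by omega
        have h2 : ¬ m + 1 + a = m := by omega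
        simp [ILP.extended, ha, h1, h2]
      have e5 : ((a * (n + m + 1) + (m + 1 + a) : ℕ) : ℤ) =
          ((a * (n + m + 1) + m : ℕ) : ℤ) + 1 + a := by push_cast; ring
      rw [e3, e4, e5] at e2
      simpa only [State.setReg_arr, State.setArr_arr, State.setArr_reg, if_true, h10', h10, h8', h8,
        e1, h2] using e2
    · rw [h0] at h1
      simpa using h1
  · rintro s1 hs1 ⟨h10, hcol, hst⟩
    intro j hj i hi
    refine ⟨fun _ => ?_, fun h => absurd trivial h⟩
    by_cases hD : i < m ∨ i = m ∧ j < n ∨ i = m + 1 + j ∧ j < n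
    · exact (hcol j hj i hi).1 hD
    · rw [(hcol j hj i hi).2 hD]
      have h1 : ¬ i < m := by omega
      have h2 : ¬ i = m := by omega
      have h3 : ¬ i = m + 1 + j := by omega
      simp [ILP.extended, h1, h2, h3]

/-- The instance `I`, whose encoding has length `N`, has been loaded into the memory. -/
structure Loaded {n m : ℕ} (I : ILP (Fin n) (Fin m)) (s : State) : Prop where
  sizes : HasSizes n m s
  cols : ∀ j < n, ∀ i < n + m + 1, s.arr 1 ((j * (n + m + 1) + i : ℕ) : ℤ) = I.extended j i
  rhs : ∀ i : Fin m, s.arr 2 (i : ℕ) = I.rhs i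
  lower : ∀ j : Fin n, Represents (I.lower j) (s.arr 3 (j : ℕ)) (s.arr 4 (j : ℕ))
  upper : ∀ j : Fin n, Represents (I.upper j) (s.arr 5 (j : ℕ)) (s.arr 6 (j : ℕ))

theorem Loaded.of_agree {I : ILP (Fin n) (Fin m)} {s s' : State} (h : Loaded I s) {R A : List ℕ}
    (hs : Agree R A s s') (hR : 4 ∉ R ∧ 5 ∉ R ∧ 6 ∉ R ∧ 7 ∉ R)
    (hA : 1 ∉ A ∧ 2 ∉ A ∧ 3 ∉ A ∧ 4 ∉ A ∧ 5 ∉ A ∧ 6 ∉ A) : Loaded I s' := by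
  obtain ⟨h1, h2, h3, h4, h5⟩ := h
  obtain ⟨a1, a2, a3, a4, a5, a6⟩ := hA
  refine ⟨h1.of_agree hs hR, ?_, ?_, ?_, ?_⟩
  · rwa [hs.arr 1 a1]
  · rwa [hs.arr 2 a2]
  · rwa [hs.arr 3 a3, hs.arr 4 a4]
  · rwa [hs.arr 5 a5, hs.arr 6 a6]

theorem holdsFrom_init (w : List Bool) : HoldsFrom ((State.init w).arr 0) ((State.init w).reg 1) w := by
  intro i
  simp [State.init]

/-- Here the unary encoding enters: not only the number of entries but every entry itself is at most
the input length. All further estimates are in terms of this length. -/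
theorem le_length_encode (I : ILP (Fin n) (Fin m)) :
    n + m + 2 ≤ (Unary.encode I).length ∧
      (∀ i j, (I.A i j).natAbs ≤ (Unary.encode I).length) ∧
      (∀ i, (I.rhs i).natAbs ≤ (Unary.encode I).length) ∧
      (∀ j, (Unary.encodeExtInt (I.lower j)).length ≤ (Unary.encode I).length) ∧
      (∀ j, (Unary.encodeExtInt (I.upper j)).length ≤ (Unary.encode I).length) ∧
      ∀ j, (I.obj j).natAbs ≤ (Unary.encode I).length := by
  have hnat : ∀ k, (Unary.encodeNat k).length = k + 1 := fun k => by simp [Unary.encodeNat]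
  have hint : ∀ z, z.natAbs ≤ (Unary.encodeInt z).length := fun z => by
    simp [Unary.encodeInt, hnat]; omega
  have hflat : ∀ {p : ℕ} (f : Fin p → List Bool) (i : Fin p),
      (f i).length ≤ ((List.finRange p).flatMap f).length := by
    intro p f i
    rw [List.length_flatMap]
    exact List.single_le_sum (by simp) _ (List.mem_map.2 ⟨i, List.mem_finRange i, rfl⟩)
  simp only [Unary.encode, List.length_append, hnat]
  refine ⟨by omega, fun i j => ?_, fun i => ?_, fun j => ?_, fun j => ?_, fun j => ?_⟩
  · have h1 := hflat (fun i => (List.finRange n).flatMap fun j => Unary.encodeInt (I.A i j)) i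
    have h2 := hflat (fun j => Unary.encodeInt (I.A i j)) j
    have h3 := hint (I.A i j)
    omega
  · have h2 := hflat (fun i => Unary.encodeInt (I.rhs i)) i
    have h3 := hint (I.rhs i)
    omega
  · have h2 := hflat (fun i => Unary.encodeExtInt (I.lower i)) j
    omega
  · have h2 := hflat (fun i => Unary.encodeExtInt (I.upper i)) j
    omega
  · have h2 := hflat (fun i => Unary.encodeInt (I.obj i)) j
    have h3 := hint (I.obj j)
    omega

theorem parse_spec (I : ILP (Fin n) (Fin m)) (hX : (Unary.encode I).length ≤ X) :
    wp X parse (fun s' => Loaded I s' ∧ s'.reg 0 = (Unary.encode I).length ∧ s'.arr 8 (-1) = 0)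
      (State.init (Unary.encode I)) := by
  obtain ⟨hsz, hA, hb, hl, hu, ho⟩ := le_length_encode I
  have hini := holdsFrom_init (Unary.encode I)
  set s := State.init (Unary.encode I) with hs
  have hz1 : s.arr 1 = fun _ => 0 := by simp [hs, State.init]
  have hz8 : s.arr 8 (-1) = 0 := by simp [hs, State.init]
  have hz0 : s.reg 0 = (Unary.encode I).length := by simp [hs, State.init]
  clear_value s
  simp only [Unary.encode, List.append_assoc] at hini
  simp only [parse, wp_seq]
  refine wp_conseq (readSizes_spec (by omega) (by omega) hini) [1, 2, 4, 5, 6, 7] [] (by decide)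
    (by decide) ?_
  rintro s1 ⟨hsz1, hst⟩ hs1
  rw [← hs1.arr 0 (by decide)] at hst
  refine wp_conseq (readMatrix_spec I (by omega) (by omega) (fun i j => (hA i j).trans hX) hsz1 hst
    (by rw [hs1.arr 1 (by decide), hz1]; intro j _ i _; simp)) [1, 2, 3, 8, 9, 10] [1] (by decide)
    (by decide) ?_
  rintro s2 ⟨hE, hst⟩ hs2
  have hsz2 := hsz1.of_agree hs2 (by decide)
  rw [← hs2.arr 0 (by decide)] at hst
  refine wp_conseq (readRhs_spec I (by omega) (fun i => (hb i).trans hX) hsz2 hst)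
    [1, 2, 3, 8] [2] (by decide) (by decide) ?_
  rintro s3 ⟨hrhs, hst⟩ hs3
  have hsz3 := hsz2.of_agree hs3 (by decide)
  rw [← hs3.arr 0 (by decide)] at hst
  refine wp_conseq (readLower_spec I (by omega) (fun i => (hl i).trans hX) hsz3 hst)
    [1, 2, 3, 8] [3, 4] (by decide) (by decide) ?_
  rintro s4 ⟨hlow, hst⟩ hs4
  have hsz4 := hsz3.of_agree hs4 (by decide)
  rw [← hs4.arr 0 (by decide)] at hst
  refine wp_conseq (readUpper_spec I (by omega) (fun i => (hu i).trans hX) hsz4 hst)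
    [1, 2, 3, 8] [5, 6] (by decide) (by decide) ?_
  rintro s5 ⟨hupp, hst⟩ hs5
  have hsz5 := hsz4.of_agree hs5 (by decide)
  rw [← hs5.arr 0 (by decide)] at hst
  refine wp_conseq (readObj_spec I (w := []) (by omega) (fun i => (ho i).trans hX) hsz5
    (by simpa using hst)
    (by rwa [hs5.arr 1 (by decide), hs4.arr 1 (by decide), hs3.arr 1 (by decide)]))
    [1, 2, 3, 8, 10] [1] (by decide) (by decide) ?_
  rintro s6 hE hs6
  have hsz6 := hsz5.of_agree hs6 (by decide)
  refine ⟨⟨hsz6, fun j hj i hi => (hE j hj i hi).1 trivial, ?_, ?_, ?_⟩, ?_, ?_⟩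
  · rwa [hs6.arr 2 (by decide), hs5.arr 2 (by decide), hs4.arr 2 (by decide)]
  · rwa [hs6.arr 3 (by decide), hs5.arr 3 (by decide), hs6.arr 4 (by decide),
      hs5.arr 4 (by decide)]
  · rwa [hs6.arr 5 (by decide), hs6.arr 6 (by decide)]
  · rw [hs6.reg 0 (by decide), hs5.reg 0 (by decide), hs4.reg 0 (by decide), hs3.reg 0 (by decide),
      hs2.reg 0 (by decide), hs1.reg 0 (by decide), hz0]
  · rw [hs6.arr 8 (by decide), hs5.arr 8 (by decide), hs4.arr 8 (by decide), hs3.arr 8 (by decide),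
      hs2.arr 8 (by decide), hs1.arr 8 (by decide), hz8]

end RAM

/-! ### Zero-sum subfamilies -/

namespace ZeroSum

variable {ι κ : Type}

theorem exists_fiber {f : ι → ℤ} {W : ℕ} {s : Finset ι} (h1 : ∀ i ∈ s, 0 < f i)
    (hW : ∀ i ∈ s, f i ≤ W) (hcard : W * W < s.card) :
    ∃ a : ℕ, 0 < a ∧ a ≤ W ∧ W < (s.filter fun i => f i = a).card := by
  obtain ⟨y, hy, h⟩ := Finset.exists_lt_card_fiber_of_mul_lt_card_of_maps_to
    (s := s) (t := Finset.Icc (1 : ℤ) W) (f := f) (n := W)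
    (fun i hi => Finset.mem_Icc.2 ⟨h1 i hi, hW i hi⟩) (by simpa using hcard)
  rw [Finset.mem_Icc] at hy
  lift y to ℕ using by omega
  exact ⟨y, by omega, by omega, h⟩

/-- If at most `W ^ 2` terms were positive, their sum would be at most `W ^ 3`, so the negative
terms, each at most `-1`, would number at most `S + W ^ 3`, contradicting `hcard`; symmetrically for
the negative terms. So both signs are frequent, and by pigeonhole some value `a` and some value `-b`
each occur more than `W` times. -/
theorem exists_zero_sum_single [DecidableEq ι] (φ : ι → ℤ) {W S : ℕ} {s : Finset ι} (hW : ∀ i ∈ s, |φ i| ≤ W)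
    (hS : |∑ i ∈ s, φ i| ≤ S) (hcard : S + W ^ 3 + W ^ 2 < s.card) :
    ∃ g ⊆ s, g.Nonempty ∧ g.card ≤ 2 * W + 1 ∧ ∑ i ∈ g, φ i = 0 := by
  by_cases h0 : ∃ i ∈ s, φ i = 0
  · obtain ⟨i, hi, h⟩ := h0
    exact ⟨{i}, by simpa using hi, by simp, by simp, by simpa using h⟩
  push Not at h0
  set p := s.filter fun i => 0 < φ i with hp
  set q := s.filter fun i => ¬ 0 < φ i with hq
  have hpq : p.card + q.card = s.card := Finset.card_filter_add_card_filter_not _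
  have hsum : ∑ i ∈ p, φ i + ∑ i ∈ q, φ i = ∑ i ∈ s, φ i :=
    Finset.sum_filter_add_sum_filter_not _ _ _
  have hp1 : ∀ i ∈ p, 1 ≤ φ i ∧ φ i ≤ W := fun i hi => by
    rw [hp, Finset.mem_filter] at hi
    exact ⟨hi.2, (abs_le.1 (hW i hi.1)).2⟩
  have hq1 : ∀ i ∈ q, 1 ≤ - φ i ∧ - φ i ≤ W := fun i hi => by
    rw [hq, Finset.mem_filter] at hi
    have := h0 i hi.1
    have := (abs_le.1 (hW i hi.1)).1
    omega
  have hpl : (p.card : ℤ) ≤ ∑ i ∈ p, φ i := by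
    simpa using Finset.card_nsmul_le_sum p φ 1 fun i hi => (hp1 i hi).1
  have hpu : ∑ i ∈ p, φ i ≤ p.card * W := by
    simpa using Finset.sum_le_card_nsmul p φ W fun i hi => (hp1 i hi).2
  have hql : (q.card : ℤ) ≤ - ∑ i ∈ q, φ i := by
    rw [← Finset.sum_neg_distrib]
    simpa using Finset.card_nsmul_le_sum q (fun i => - φ i) 1 fun i hi => (hq1 i hi).1
  have hqu : - ∑ i ∈ q, φ i ≤ q.card * W := by
    rw [← Finset.sum_neg_distrib]
    simpa using Finset.sum_le_card_nsmul q (fun i => - φ i) W fun i hi => (hq1 i hi).2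
  rw [abs_le] at hS
  zify at hcard hpq
  by_cases hpc : p.card ≤ W * W
  · exfalso
    have : (p.card : ℤ) * W ≤ W * W * W := by
      have : (p.card : ℤ) ≤ W * W := by exact_mod_cast hpc
      gcongr
    have : (p.card : ℤ) ≤ W * W := by exact_mod_cast hpc
    nlinarith
  by_cases hqc : q.card ≤ W * W
  · exfalso
    have : (q.card : ℤ) * W ≤ W * W * W := by
      have : (q.card : ℤ) ≤ W * W := by exact_mod_cast hqc
      gcongr
    have : (q.card : ℤ) ≤ W * W := by exact_mod_cast hqc
    nlinarith
  obtain ⟨a, ha, haW, hac⟩ := exists_fiber (fun i hi => (hp1 i hi).1) (fun i hi => (hp1 i hi).2)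
    (not_le.1 hpc)
  obtain ⟨b, hb, hbW, hbc⟩ := exists_fiber (f := fun i => - φ i) (fun i hi => (hq1 i hi).1)
    (fun i hi => (hq1 i hi).2) (not_le.1 hqc)
  -- Taking `b` terms equal to `a` and `a` terms equal to `-b` gives the sum `b * a - a * b = 0`.
  obtain ⟨u, hu, huc⟩ := Finset.exists_subset_card_eq (hbW.trans hac.le)
  obtain ⟨v, hv, hvc⟩ := Finset.exists_subset_card_eq (haW.trans hbc.le)
  have hu' : ∀ i ∈ u, i ∈ p ∧ φ i = a := fun i hi => by simpa using Finset.mem_filter.1 (hu hi)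
  have hv' : ∀ i ∈ v, i ∈ q ∧ - φ i = b := fun i hi => by simpa using Finset.mem_filter.1 (hv hi)
  have hd : Disjoint u v := by
    rw [Finset.disjoint_left]
    intro i hi hi'
    have := (hu' i hi).2
    have := (hv' i hi').2
    omega
  refine ⟨u ∪ v, ?_, ?_, ?_, ?_⟩
  · exact Finset.union_subset (fun i hi => Finset.filter_subset _ _ (hu' i hi).1)
      fun i hi => Finset.filter_subset _ _ (hv' i hi).1
  · have : u.Nonempty := Finset.card_pos.1 (by omega)
    exact this.mono Finset.subset_union_left
  · rw [Finset.card_union_of_disjoint hd]; omega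
  · rw [Finset.sum_union hd, Finset.sum_congr rfl fun i hi => (hu' i hi).2,
      Finset.sum_congr rfl fun i hi => (show φ i = -(b : ℤ) by have := (hv' i hi).2; omega)]
    simp [huc, hvc]
    ring

/-- `P` consists of disjoint nonempty subsets of `s` of size at most `T` on which all `φ c`, for `c`
in `C`, have sum zero, and covers all but at most `T` elements of `s`. -/
structure Decomposes [DecidableEq ι] (φ : κ → ι → ℤ) (C : Finset κ) (T : ℕ) (s : Finset ι)
    (P : Finset (Finset ι)) : Prop where
  subset : ∀ g ∈ P, g ⊆ s
  nonempty : ∀ g ∈ P, g.Nonempty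
  card_le : ∀ g ∈ P, g.card ≤ T
  sum_eq : ∀ g ∈ P, ∀ c ∈ C, ∑ i ∈ g, φ c i = 0
  disj : (P : Set (Finset ι)).PairwiseDisjoint id
  rest : (s \ P.biUnion id).card ≤ T

/-- Zero-sum sets are removed one after another until few elements are left. Removal does not change
the sums of the remainder, so it suffices to find zero-sum sets in those `t` that have the same sums
as `s`. -/
theorem exists_decomposes [DecidableEq ι] (φ : κ → ι → ℤ) (C : Finset κ) (T : ℕ) (s : Finset ι)
    (h : ∀ t ⊆ s, (∀ c ∈ C, ∑ i ∈ t, φ c i = ∑ i ∈ s, φ c i) → T < t.card →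
      ∃ g ⊆ t, g.Nonempty ∧ g.card ≤ T ∧ ∀ c ∈ C, ∑ i ∈ g, φ c i = 0) :
    ∃ P, Decomposes φ C T s P := by
  have key : ∀ t ⊆ s, (∀ c ∈ C, ∑ i ∈ t, φ c i = ∑ i ∈ s, φ c i) → ∃ P, Decomposes φ C T t P := by
    intro t
    induction t using Finset.strongInduction with
    | H t ih =>
      intro hts hsum
      by_cases hT : T < t.card
      · obtain ⟨g, hg, hne, hcard, h0⟩ := h t hts hsum hT
        have hss : t \ g ⊂ t := by
          obtain ⟨i, hi⟩ := hne
          exact Finset.ssubset_iff_of_subset Finset.sdiff_subset |>.2 ⟨i, hg hi, by simp [hi]⟩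
        obtain ⟨P, hP⟩ := ih _ hss (hss.subset.trans hts) fun c hc => by
          rw [← hsum c hc, ← Finset.sum_sdiff hg, h0 c hc, add_zero]
        refine ⟨insert g P, ?_, ?_, ?_, ?_, ?_, ?_⟩
        · simpa [hg] using fun a ha => (hP.subset a ha).trans hss.subset
        · simpa [hne] using hP.nonempty
        · simpa [hcard] using hP.card_le
        · simpa using ⟨h0, hP.sum_eq⟩
        · rw [Finset.coe_insert]
          refine hP.disj.insert fun a ha _ => ?_
          rw [id, id]
          exact Finset.disjoint_of_subset_right (hP.subset a ha) Finset.disjoint_sdiff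
        · refine le_trans (Finset.card_le_card ?_) hP.rest
          intro i
          simp only [Finset.mem_sdiff, Finset.biUnion_insert, Finset.mem_union, id]
          tauto
      · exact ⟨∅, by simp, by simp, by simp, by simp, by simp, by simpa using hT⟩
  exact key s subset_rfl fun _ _ => rfl

theorem Decomposes.sum_rest [DecidableEq ι] {φ : κ → ι → ℤ} {C : Finset κ} {T : ℕ} {s : Finset ι}
    {P : Finset (Finset ι)} (h : Decomposes φ C T s P) (f : ι → ℤ) :
    ∑ g ∈ P, ∑ i ∈ g, f i = ∑ i ∈ s, f i - ∑ i ∈ s \ P.biUnion id, f i := by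
  have h1 : P.biUnion id ⊆ s := Finset.biUnion_subset.2 h.subset
  have h2 := Finset.sum_biUnion (f := f) h.disj
  rw [← Finset.sum_sdiff h1, h2]
  simp

theorem Decomposes.card_le_add [DecidableEq ι] {φ : κ → ι → ℤ} {C : Finset κ} {T : ℕ} {s : Finset ι}
    {P : Finset (Finset ι)} (h : Decomposes φ C T s P) : s.card ≤ T + P.card * T := by
  have h1 := h.rest
  have h2 : (P.biUnion id).card ≤ P.card * T := Finset.card_biUnion_le_card_mul _ _ _ h.card_le
  have h3 := Finset.card_sdiff_add_card_eq_card (Finset.biUnion_subset.2 h.subset :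
    P.biUnion id ⊆ s)
  omega

theorem abs_sum_le {f : ι → ℤ} {W : ℤ} {s : Finset ι} (h : ∀ i ∈ s, |f i| ≤ W) :
    |∑ i ∈ s, f i| ≤ s.card * W := by
  refine (Finset.abs_sum_le_sum_abs _ _).trans ?_
  simpa using Finset.sum_le_card_nsmul s (fun i => |f i|) W h

/-- A large family of integer vectors with small entries and small sum has a small nonempty
subfamily with sum zero. -/
theorem exists_zero_sum [DecidableEq ι] (φ : κ → ι → ℤ) {B : ℕ} (hB : 2 ≤ B) (C : Finset κ) {s : Finset ι}
    (hW : ∀ c ∈ C, ∀ i ∈ s, |φ c i| ≤ B) (hS : ∀ c ∈ C, |∑ i ∈ s, φ c i| ≤ B)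
    (hcard : B ^ 16 ^ C.card < s.card) :
    ∃ g ⊆ s, g.Nonempty ∧ g.card ≤ B ^ 16 ^ C.card ∧ ∀ c ∈ C, ∑ i ∈ g, φ c i = 0 := by
  classical
  induction C using Finset.induction_on generalizing s with
  | empty =>
    obtain ⟨i, hi⟩ := Finset.card_pos.1 (by omega : 0 < s.card)
    exact ⟨{i}, by simpa using hi, by simp, by simp; omega, by simp⟩
  | insert c C hc ih =>
    rw [Finset.card_insert_of_notMem hc] at hcard ⊢
    -- The blocks, on which the old rows already have sum zero, become the items of a one-row
    -- problem for the new row `c`. Any union of blocks keeps sum zero in the old rows.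
    obtain ⟨P, hP⟩ := exists_decomposes φ C (B ^ 16 ^ C.card) s fun t ht hsum htc =>
      ih (fun c' hc' i hi => hW c' (by simp [hc']) i (ht hi))
        (fun c' hc' => by rw [hsum c' hc']; exact hS c' (by simp [hc'])) htc
    have hBT : B ≤ B ^ 16 ^ C.card := Nat.le_self_pow (by positivity) B
    rw [pow_succ, pow_mul] at hcard ⊢
    generalize B ^ 16 ^ C.card = T at *
    have hT : 2 ≤ T := hB.trans hBT
    have hW' : ∀ g ∈ P, |∑ i ∈ g, φ c i| ≤ ((T * T : ℕ) : ℤ) := fun g hg => by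
      refine (abs_sum_le fun i hi => hW c (by simp) i (hP.subset g hg hi)).trans ?_
      exact_mod_cast Nat.mul_le_mul (hP.card_le g hg) hBT
    have hS' : |∑ g ∈ P, ∑ i ∈ g, φ c i| ≤ ((T + T * T : ℕ) : ℤ) := by
      rw [hP.sum_rest]
      refine (abs_sub _ _).trans ?_
      push_cast
      refine add_le_add ((hS c (by simp)).trans (by exact_mod_cast hBT)) ?_
      refine (abs_sum_le fun i hi => hW c (by simp) i (Finset.sdiff_subset hi)).trans ?_
      exact_mod_cast Nat.mul_le_mul hP.rest hBT
    have h4 : T ^ 16 = T ^ 8 * T ^ 8 := by ring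
    have hsc := hP.card_le_add
    -- The blocks have values at most `T ^ 2` in row `c` and total at most `T + T ^ 2`, whence this
    -- threshold. With fewer blocks `s` would have at most `5 * T ^ 7 ≤ T ^ 16` elements. The
    -- exponent `16` is generous; being a power of two, it leads to a bound that can be computed by
    -- repeated squaring.
    have hPc : T + T * T + (T * T) ^ 3 + (T * T) ^ 2 < P.card := by
      by_contra hcon
      rw [not_lt] at hcon
      have h1 : s.card ≤ T + (T + T * T + (T * T) ^ 3 + (T * T) ^ 2) * T :=
        hsc.trans (by gcongr)
      have e1 : ∀ d ≤ 7, T ^ d ≤ T ^ 7 := fun d hd => Nat.pow_le_pow_right (by omega) hd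
      have h2 : T + (T + T * T + (T * T) ^ 3 + (T * T) ^ 2) * T ≤ 5 * T ^ 7 := by
        have := e1 1 (by omega); have := e1 2 (by omega); have := e1 3 (by omega)
        have := e1 5 (by omega)
        calc T + (T + T * T + (T * T) ^ 3 + (T * T) ^ 2) * T
            = T ^ 1 + T ^ 2 + T ^ 3 + T ^ 7 + T ^ 5 := by ring
          _ ≤ _ := by omega
      have h3 : 5 * T ^ 7 ≤ T ^ 16 := by
        calc 5 * T ^ 7 ≤ 2 ^ 9 * T ^ 7 := by omega
          _ ≤ T ^ 9 * T ^ 7 := by gcongr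
          _ = T ^ 16 := by ring
      omega
    obtain ⟨Q, hQP, hQne, hQc, hQ⟩ := exists_zero_sum_single (fun g => ∑ i ∈ g, φ c i) hW' hS' hPc
    have hQd : (Q : Set (Finset ι)).PairwiseDisjoint id := hP.disj.subset (by exact_mod_cast hQP)
    refine ⟨Q.biUnion id, Finset.biUnion_subset.2 fun g hg => hP.subset g (hQP hg), ?_, ?_, ?_⟩
    · obtain ⟨g, hg⟩ := hQne
      exact (hP.nonempty g (hQP hg)).mono (Finset.subset_biUnion_of_mem id hg)
    · refine (Finset.card_biUnion_le_card_mul _ _ T fun g hg => hP.card_le g (hQP hg)).trans ?_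
      calc Q.card * T ≤ (2 * (T * T) + 1) * T := by gcongr
        _ ≤ (T * (T * T) + T * (T * T)) * T := by
            gcongr; nlinarith
        _ = 2 * T ^ 4 := by ring
        _ ≤ T * T ^ 4 := by gcongr
        _ = T ^ 5 := by ring
        _ ≤ T ^ 16 := Nat.pow_le_pow_right (by omega) (by omega)
    · intro c' hc'
      rw [Finset.sum_biUnion hQd]
      rcases Finset.mem_insert.1 hc' with rfl | hc'
      · exact hQ
      · exact Finset.sum_eq_zero fun g hg => hP.sum_eq g (hQP hg) c' hc'

end ZeroSum

/-! ### Instances whose constraints outside a small set split into small classes -/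

open Classical in
/-- The constraints outside `Z` are grouped by a labelling of the variables: all variables of such a
constraint have the same label, and to every label belong at most `l` of these constraints. -/
structure SplitsInto {n m : ℕ} (A : Matrix (Fin m) (Fin n) ℤ) (l : ℕ) (lab : Fin n → ℕ)
    (Z : Finset (Fin m)) : Prop where
  lab_lt : ∀ v, lab v < n
  lab_eq : ∀ c ∉ Z, ∀ v v', A c v ≠ 0 → A c v' ≠ 0 → lab v = lab v'
  card_rows : ∀ L, (Finset.univ.filter fun c => c ∉ Z ∧ ∃ v, lab v = L ∧ A c v ≠ 0).card ≤ l

/-! ### Kernel vectors inside large integer vectors. -/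

namespace ZeroSum

/-- The vector `y`, written as a sum of unit vectors up to sign. -/
def units {n : ℕ} (y : Fin n → ℤ) : Finset ((_ : Fin n) × ℕ) :=
  Finset.univ.sigma fun v => Finset.range (y v).natAbs

/-- The value of a constraint on a unit vector. -/
def unitValue {n m : ℕ} (A : Matrix (Fin m) (Fin n) ℤ) (y : Fin n → ℤ) (c : Fin m)
    (i : (_ : Fin n) × ℕ) : ℤ := A c i.1 * (y i.1).sign

theorem card_units {n : ℕ} (y : Fin n → ℤ) : (units y).card = ∑ v, (y v).natAbs := by
  simp [units]

theorem sum_units {n m : ℕ} (A : Matrix (Fin m) (Fin n) ℤ) (y : Fin n → ℤ) (c : Fin m) :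
    ∑ i ∈ units y, unitValue A y c i = ∑ v, A c v * y v := by
  rw [units, Finset.sum_sigma]
  refine Finset.sum_congr rfl fun v _ => ?_
  simp only [unitValue, Finset.sum_const, Finset.card_range, nsmul_eq_mul]
  conv_rhs => rw [← Int.sign_mul_natAbs (y v)]
  ring

/-- The entry of `x` at `v` counts the chosen units over `v`, with the sign of `y v`. As there are
only `|y v|` units over `v`, it lies between `0` and `y v`. -/
theorem exists_vector {n m : ℕ} (A : Matrix (Fin m) (Fin n) ℤ) (y : Fin n → ℤ)
    {g : Finset ((_ : Fin n) × ℕ)} (hg : g ⊆ units y) (hne : g.Nonempty)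
    (h : ∀ c, ∑ i ∈ g, unitValue A y c i = 0) :
    ∃ x : Fin n → ℤ, x ≠ 0 ∧ (∀ c, ∑ v, A c v * x v = 0) ∧
      ∀ v, (0 ≤ x v ∧ x v ≤ y v) ∨ (y v ≤ x v ∧ x v ≤ 0) := by
  have hcard : ∀ v, (g.filter fun i => i.1 = v).card ≤ (y v).natAbs := by
    intro v
    have : (g.filter fun i => i.1 = v) ⊆ (Finset.range (y v).natAbs).image fun k => ⟨v, k⟩ := by
      rintro ⟨v', k⟩ hi
      rw [Finset.mem_filter] at hi
      obtain ⟨hi, rfl⟩ := hi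
      have := hg hi
      simp only [units, Finset.mem_sigma] at this
      exact Finset.mem_image.2 ⟨k, this.2, rfl⟩
    exact (Finset.card_le_card this).trans (Finset.card_image_le.trans (by simp))
  refine ⟨fun v => (y v).sign * (g.filter fun i => i.1 = v).card, ?_, fun c => ?_, fun v => ?_⟩
  · obtain ⟨i, hi⟩ := hne
    intro h0
    have h1 := congrFun h0 i.1
    have h2 : 0 < (g.filter fun j => j.1 = i.1).card := Finset.card_pos.2 ⟨i, by simp [hi]⟩
    have h3 : (y i.1).sign ≠ 0 := by
      have := hg hi
      simp only [units, Finset.mem_sigma, Finset.mem_range] at this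
      rw [Ne, Int.sign_eq_zero_iff_zero]
      intro h; simp [h] at this
    simp only [Pi.zero_apply, mul_eq_zero] at h1
    omega
  · rw [← h c, ← Finset.sum_fiberwise g (fun i => i.1)]
    refine Finset.sum_congr rfl fun v _ => ?_
    rw [Finset.sum_congr rfl fun i hi => (show unitValue A y c i = A c v * (y v).sign by
      rw [unitValue, (Finset.mem_filter.1 hi).2])]
    simp only [Finset.sum_const, nsmul_eq_mul]
    ring
  · have := hcard v
    dsimp only
    generalize (g.filter fun i => i.1 = v).card = k at *
    rcases lt_trichotomy (y v) 0 with h | h | h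
    · rw [Int.sign_eq_neg_one_of_neg h]; omega
    · rw [h, Int.sign_zero]; omega
    · rw [Int.sign_eq_one_of_pos h]; omega

theorem abs_sign_le (z : ℤ) : |z.sign| ≤ 1 := by
  rcases lt_trichotomy z 0 with h | h | h
  · rw [Int.sign_eq_neg_one_of_neg h]; simp
  · simp [h]
  · rw [Int.sign_eq_one_of_pos h]; simp

/-- A large integer vector with small image is the sign-compatible sum of two vectors one of which is
a nonzero kernel vector. -/
theorem exists_kernel_vector {n m : ℕ} {A : Matrix (Fin m) (Fin n) ℤ} {l z : ℕ} {lab : Fin n → ℕ}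
    {Z : Finset (Fin m)} (h : SplitsInto A l lab Z) (hZ : Z.card ≤ z) {B : ℕ} (hB : 2 ≤ B)
    (hn : n ≤ B) (hA : ∀ c v, |A c v| ≤ B) (y : Fin n → ℤ) (hy : ∀ c, |∑ v, A c v * y v| ≤ B)
    (hlarge : B ^ (8 * 16 ^ (l + z)) < ∑ v, (y v).natAbs) :
    ∃ x : Fin n → ℤ, x ≠ 0 ∧ (∀ c, ∑ v, A c v * x v = 0) ∧
      ∀ v, (0 ≤ x v ∧ x v ≤ y v) ∨ (y v ≤ x v ∧ x v ≤ 0) := by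
  classical
  rw [← card_units] at hlarge
  set s := units y with hs
  set φ := unitValue A y with hφ
  have hφB : ∀ c i, |φ c i| ≤ B := fun c i => by
    rw [hφ, unitValue, abs_mul]
    calc |A c i.1| * |(y i.1).sign| ≤ B * 1 :=
          mul_le_mul (hA _ _) (abs_sign_le _) (abs_nonneg _) (by positivity)
      _ = B := by ring
  have hφs : ∀ c, |∑ i ∈ s, φ c i| ≤ B := fun c => by rw [hs, hφ, sum_units]; exact hy c
  set T := B ^ 16 ^ l with hT
  have hBT : B ≤ T := Nat.le_self_pow (by positivity) B
  have hT2 : 2 ≤ T := hB.trans hBT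
  set sL : ℕ → Finset ((_ : Fin n) × ℕ) := fun L => s.filter fun i => lab i.1 = L with hsL
  set CL : ℕ → Finset (Fin m) := fun L =>
    Finset.univ.filter fun c => c ∉ Z ∧ ∃ v, lab v = L ∧ A c v ≠ 0 with hCL
  -- A local row of another class involves no variable with label `L`, hence vanishes on every unit
  -- of this class. So only the rows in `CL L` matter for its blocks.
  have hzero : ∀ c ∉ Z, ∀ L, c ∉ CL L → ∀ i ∈ sL L, φ c i = 0 := by
    intro c hc L hcL i hi
    rw [hsL, Finset.mem_filter] at hi
    by_contra hne
    refine hcL (Finset.mem_filter.2 ⟨Finset.mem_univ _, hc, i.1, hi.2, fun h0 => hne ?_⟩)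
    simp [hφ, unitValue, h0]
  have hsum : ∀ L, ∀ c ∈ CL L, ∑ i ∈ sL L, φ c i = ∑ i ∈ s, φ c i := by
    intro L c hc
    refine Finset.sum_subset (Finset.filter_subset _ _) fun i hi hi' => ?_
    obtain ⟨-, hcZ, v, hv, hcv⟩ := Finset.mem_filter.1 hc
    by_contra hne
    refine hi' (Finset.mem_filter.2 ⟨hi, ?_⟩)
    rw [← hv]
    exact h.lab_eq c hcZ _ _ (fun h0 => hne (by simp [hφ, unitValue, h0])) hcv
  -- First stage: each class is cut into blocks of size at most `T` on which all its local rows have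
  -- sum zero. All local rows then have sum zero on every block, and only the global rows remain for
  -- the second stage.
  have hdec : ∀ L, ∃ P, Decomposes φ (CL L) T (sL L) P := by
    intro L
    have hpow : B ^ 16 ^ (CL L).card ≤ T :=
      Nat.pow_le_pow_right (by omega) (Nat.pow_le_pow_right (by omega) (h.card_rows L))
    refine exists_decomposes φ (CL L) T (sL L) fun t ht hts htc => ?_
    obtain ⟨g, h1, h2, h3, h4⟩ := exists_zero_sum φ hB (CL L) (s := t) (fun c _ i _ => hφB c i)
      (fun c hc => by rw [hts c hc, hsum L c hc]; exact hφs c) (hpow.trans_lt htc)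
    exact ⟨g, h1, h2, h3.trans hpow, h4⟩
  choose PL hPL using hdec
  have hlab : ∀ L, ∀ g ∈ PL L, ∀ i ∈ g, lab i.1 = L := fun L g hg i hi =>
    (Finset.mem_filter.1 ((hPL L).subset g hg hi)).2
  have hPd : ((Finset.range n : Finset ℕ) : Set ℕ).PairwiseDisjoint PL := by
    intro L _ L' _ hne
    refine Finset.disjoint_left.2 fun g hg hg' => hne ?_
    obtain ⟨i, hi⟩ := (hPL L).nonempty g hg
    rw [← hlab L g hg i hi, hlab L' g hg' i hi]
  have hsd : ((Finset.range n : Finset ℕ) : Set ℕ).PairwiseDisjoint sL := by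
    intro L _ L' _ hne
    refine Finset.disjoint_left.2 fun i hi hi' => hne ?_
    rw [← (Finset.mem_filter.1 hi).2, (Finset.mem_filter.1 hi').2]
  have hsU : (Finset.range n).biUnion sL = s := by
    ext i
    simp only [Finset.mem_biUnion, Finset.mem_range, hsL, Finset.mem_filter]
    exact ⟨fun ⟨_, _, h, _⟩ => h, fun hi => ⟨_, h.lab_lt i.1, hi, rfl⟩⟩
  set P := (Finset.range n).biUnion PL with hP
  have hmemP : ∀ g, g ∈ P ↔ ∃ L < n, g ∈ PL L := fun g => by
    simp [hP]
  have hcardP : ∀ g ∈ P, g.card ≤ T := fun g hg => by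
    obtain ⟨L, _, hg⟩ := (hmemP g).1 hg
    exact (hPL L).card_le g hg
  have hdisj : (P : Set (Finset ((_ : Fin n) × ℕ))).PairwiseDisjoint id := by
    intro g hg g' hg' hne
    obtain ⟨L, _, hgL⟩ := (hmemP g).1 hg
    obtain ⟨L', _, hgL'⟩ := (hmemP g').1 hg'
    by_cases hLL : L = L'
    · subst hLL
      exact (hPL L).disj hgL hgL' hne
    · refine Finset.disjoint_left.2 fun i hi hi' => hLL ?_
      rw [← hlab L g hgL i hi, hlab L' g' hgL' i hi']
  have hTT : T * T ≤ T ^ 4 := by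
    calc T * T = T ^ 2 := by ring
      _ ≤ T ^ 4 := Nat.pow_le_pow_right (by omega) (by omega)
  -- Second stage: `T ^ 4` bounds the values of the blocks in the global rows as well as their
  -- total, and `U` is the resulting threshold for the number of blocks. The assumed size `U ^ 2`
  -- leaves room for the block size `T` and for the leftovers of the `n` classes.
  set U := (T ^ 4) ^ 16 ^ z with hU
  have hTU : T ^ 4 ≤ U := Nat.le_self_pow (by positivity) _
  have hpowZ : (T ^ 4) ^ 16 ^ Z.card ≤ U :=
    Nat.pow_le_pow_right (by positivity) (Nat.pow_le_pow_right (by omega) hZ)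
  have hbig : B ^ (8 * 16 ^ (l + z)) = U ^ 2 := by
    rw [hU, hT, ← pow_mul, ← pow_mul, ← pow_mul]
    congr 1
    ring
  have hscard : s.card ≤ n * T + P.card * T := by
    rw [← hsU, Finset.card_biUnion hsd, hP, Finset.card_biUnion hPd, Finset.sum_mul]
    calc ∑ L ∈ Finset.range n, (sL L).card ≤ ∑ L ∈ Finset.range n, (T + (PL L).card * T) :=
          Finset.sum_le_sum fun L _ => (hPL L).card_le_add
      _ = _ := by rw [Finset.sum_add_distrib]; simp
  have hPU : U < P.card := by
    by_contra hcon
    rw [not_lt] at hcon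
    have h1 : s.card ≤ T * T + U * T := hscard.trans (by
      gcongr
      exact hn.trans hBT)
    have h2 : U * (T + 1) ≤ U * U := by
      refine Nat.mul_le_mul_left _ (le_trans ?_ (hTT.trans hTU))
      nlinarith
    nlinarith
  have hW' : ∀ c ∈ Z, ∀ g ∈ P, |∑ i ∈ g, φ c i| ≤ ((T ^ 4 : ℕ) : ℤ) := fun c _ g hg => by
    refine (abs_sum_le fun i _ => hφB c i).trans ?_
    exact_mod_cast (Nat.mul_le_mul (hcardP g hg) hBT).trans hTT
  -- The blocks miss at most `T` units in each of the `n` classes, so their total differs from the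
  -- total over all units by at most `n * (T * B)`.
  have hS' : ∀ c ∈ Z, |∑ g ∈ P, ∑ i ∈ g, φ c i| ≤ ((T ^ 4 : ℕ) : ℤ) := fun c _ => by
    rw [hP, Finset.sum_biUnion hPd, Finset.sum_congr rfl fun L _ => (hPL L).sum_rest (φ c),
      Finset.sum_sub_distrib, ← Finset.sum_biUnion hsd, hsU]
    refine (abs_sub _ _).trans ?_
    have h1 : |∑ L ∈ Finset.range n, ∑ i ∈ sL L \ (PL L).biUnion id, φ c i| ≤ n * (T * B) := by
      have := abs_sum_le (f := fun L => ∑ i ∈ sL L \ (PL L).biUnion id, φ c i)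
        (s := Finset.range n) (W := T * B) fun L _ => (abs_sum_le fun i _ => hφB c i).trans (by
          gcongr
          exact_mod_cast (hPL L).rest)
      simpa using this
    have h2 : B + n * (T * B) ≤ T ^ 4 := by
      calc B + n * (T * B) ≤ T + T * (T * T) := by gcongr; exact hn.trans hBT
        _ ≤ T * (T * T) + T * (T * T) := by gcongr; nlinarith
        _ = 2 * T ^ 3 := by ring
        _ ≤ T * T ^ 3 := by gcongr
        _ = T ^ 4 := by ring
    calc |∑ i ∈ s, φ c i| + _ ≤ (B : ℤ) + n * (T * B) := add_le_add (hφs c) h1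
      _ ≤ _ := by exact_mod_cast h2
  obtain ⟨Q, hQP, hQne, -, hQ⟩ := exists_zero_sum (fun c g => ∑ i ∈ g, φ c i)
    (le_trans hT2 (Nat.le_self_pow (by omega) T)) Z hW' hS' (hpowZ.trans_lt hPU)
  have hQd : (Q : Set (Finset ((_ : Fin n) × ℕ))).PairwiseDisjoint id :=
    hdisj.subset (by exact_mod_cast hQP)
  refine exists_vector A y (g := Q.biUnion id) ?_ ?_ fun c => ?_
  · refine Finset.biUnion_subset.2 fun g hg => ?_
    obtain ⟨L, _, hgL⟩ := (hmemP g).1 (hQP hg)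
    exact ((hPL L).subset g hgL).trans (Finset.filter_subset _ _)
  · obtain ⟨g, hg⟩ := hQne
    obtain ⟨L, _, hgL⟩ := (hmemP g).1 (hQP hg)
    exact ((hPL L).nonempty g hgL).mono (Finset.subset_biUnion_of_mem id hg)
  · rw [Finset.sum_biUnion hQd]
    by_cases hc : c ∈ Z
    · exact hQ c hc
    · refine Finset.sum_eq_zero fun g hg => ?_
      obtain ⟨L, _, hgL⟩ := (hmemP g).1 (hQP hg)
      by_cases hcL : c ∈ CL L
      · exact (hPL L).sum_eq g hgL c hcL
      · exact Finset.sum_eq_zero fun i hi => hzero c hc L hcL i ((hPL L).subset g hgL hi)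

end ZeroSum

/-! ### A bound on the variables -/

namespace ExtInt

theorem cases (e : ExtInt) : e = ⊥ ∨ e = ((⊤ : WithTop ℤ) : WithBot (WithTop ℤ)) ∨
    ∃ z, e = ofInt z :=
  match e with
  | ⊥ => Or.inl rfl
  | ((⊤ : WithTop ℤ) : WithBot (WithTop ℤ)) => Or.inr (Or.inl rfl)
  | ((z : ℤ) : WithTop ℤ) => Or.inr (Or.inr ⟨z, rfl⟩)

@[simp] theorem ofInt_le_ofInt {z w : ℤ} : ofInt z ≤ ofInt w ↔ z ≤ w := by
  simp [ofInt]

@[simp] theorem not_top_le_ofInt {z : ℤ} :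
    ¬ ((⊤ : WithTop ℤ) : WithBot (WithTop ℤ)) ≤ ofInt z := by
  simp [ofInt]

@[simp] theorem ofInt_le_top {z : ℤ} : ofInt z ≤ ((⊤ : WithTop ℤ) : WithBot (WithTop ℤ)) := by
  simp [ofInt]

@[simp] theorem not_ofInt_le_bot {z : ℤ} : ¬ ofInt z ≤ (⊥ : ExtInt) := by
  simp [ofInt]

@[simp] theorem bot_le_ofInt {z : ℤ} : (⊥ : ExtInt) ≤ ofInt z := bot_le

end ExtInt

namespace ILP

variable {n m : ℕ}

/-- The sum of the absolute values of the entries. -/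
def norm (x : Fin n → ℤ) : ℕ := ∑ v, (x v).natAbs

/-- The vector `g` is a part of `y`: its entries have the same sign as those of `y` and are not larger
in absolute value. -/
def IsPart (g y : Fin n → ℤ) : Prop :=
  ∀ v, (0 ≤ g v ∧ g v ≤ y v) ∨ (y v ≤ g v ∧ g v ≤ 0)

theorem norm_sub_lt {g y : Fin n → ℤ} (h : IsPart g y) (h0 : g ≠ 0) : norm (y - g) < norm y := by
  obtain ⟨v, hv⟩ := Function.ne_iff.1 h0
  refine Finset.sum_lt_sum (fun w _ => ?_) ⟨v, Finset.mem_univ _, ?_⟩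
  · have := h w
    simp only [Pi.sub_apply]
    omega
  · have := h v
    simp only [Pi.zero_apply] at hv
    simp only [Pi.sub_apply]
    omega

theorem norm_lt {g y : Fin n → ℤ} (h : IsPart g y) (h0 : g ≠ y) : norm g < norm y := by
  obtain ⟨v, hv⟩ := Function.ne_iff.1 h0
  refine Finset.sum_lt_sum (fun w _ => ?_) ⟨v, Finset.mem_univ _, ?_⟩
  · have := h w
    omega
  · have := h v
    omega

theorem sum_mul_sub (a x y : Fin n → ℤ) :
    ∑ v, a v * (x - y) v = ∑ v, a v * x v - ∑ v, a v * y v := by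
  simp [mul_sub]

theorem sum_mul_add (a x y : Fin n → ℤ) :
    ∑ v, a v * (x + y) v = ∑ v, a v * x v + ∑ v, a v * y v := by
  simp [mul_add, Finset.sum_add_distrib]

theorem abs_sum_mul_le {a x : Fin n → ℤ} {N : ℤ} (hN : 0 ≤ N) (ha : ∀ v, |a v| ≤ N)
    (hx : ∀ v, |x v| ≤ N) : |∑ v, a v * x v| ≤ n * (N * N) := by
  have := ZeroSum.abs_sum_le (f := fun v => a v * x v) (s := Finset.univ) (W := N * N) fun v _ => by
    rw [abs_mul]
    exact mul_le_mul (ha v) (hx v) (abs_nonneg _) hN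
  simpa using this

/-- A direction in which every feasible assignment can be moved. -/
structure IsRecession (I : ILP (Fin n) (Fin m)) (g : Fin n → ℤ) : Prop where
  kernel : ∀ c, ∑ v, I.A c v * g v = 0
  lower : ∀ v, g v < 0 → I.lower v = ⊥
  upper : ∀ v, 0 < g v → I.upper v = ((⊤ : WithTop ℤ) : WithBot (WithTop ℤ))

theorem IsRecession.add {I : ILP (Fin n) (Fin m)} {g x : Fin n → ℤ} (h : I.IsRecession g)
    (hx : I.IsFeasible x) : I.IsFeasible (x + g) := by
  refine ⟨fun c => by rw [sum_mul_add, h.kernel c, hx.1 c, add_zero], fun v => ⟨?_, ?_⟩⟩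
  · by_cases hg : g v < 0
    · rw [h.lower v hg]; simp
    · refine (hx.2 v).1.trans ?_
      simp only [ExtInt.ofInt_le_ofInt, Pi.add_apply]
      omega
  · by_cases hg : 0 < g v
    · rw [h.upper v hg]; simp
    · refine le_trans ?_ (hx.2 v).2
      simp only [ExtInt.ofInt_le_ofInt, Pi.add_apply]
      omega

/-- All numbers of the instance, except possibly those of the objective, are at most `N`. -/
structure BoundedBy (I : ILP (Fin n) (Fin m)) (N : ℕ) : Prop where
  size : n + m + 2 ≤ N
  entry : ∀ c v, |I.A c v| ≤ N
  rhs : ∀ c, |I.rhs c| ≤ N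
  lower : ∀ v z, I.lower v = ExtInt.ofInt z → |z| ≤ N
  upper : ∀ v z, I.upper v = ExtInt.ofInt z → |z| ≤ N

/-- The bound on the variables computed by the program. -/
def variableBound (N q : ℕ) : ℕ := N ^ 2 ^ (6 + 4 * q)

/-- Since `2 ^ (6 + 4 * q) = 2 * (4 * 8 * 16 ^ q)`, the bound is the square of the threshold in
`exists_kernel_vector` for `B = N ^ 4`; one of the two factors absorbs the summand `N`. -/
theorem le_variableBound {N : ℕ} (hN : 2 ≤ N) (q : ℕ) :
    (N ^ 4) ^ (8 * 16 ^ q) + N ≤ variableBound N q := by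
  have h1 : variableBound N q = (N ^ 4) ^ (8 * 16 ^ q) * (N ^ 4) ^ (8 * 16 ^ q) := by
    rw [variableBound, ← pow_mul, ← pow_add]
    congr 1
    rw [pow_add, pow_mul]
    norm_num
    ring
  have h2 : N ≤ (N ^ 4) ^ (8 * 16 ^ q) := by
    rw [← pow_mul]
    exact Nat.le_self_pow (by positivity) N
  rw [h1]
  nlinarith

variable {I : ILP (Fin n) (Fin m)} {l z N : ℕ} {lab : Fin n → ℕ} {Z : Finset (Fin m)}

/-- Let `t` be `x` clamped to the interval from `-N` to `N`. The image of `x - t` is `rhs - A t`,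
hence small, while `x - t` is large, so it contains a kernel vector `g`. Now `g` acts only on
entries of `x` beyond `±N`. A finite bound on that side would have been violated by `x`, so `g` is a
recession direction; and `x - g` does not come closer to zero than `±N` in these entries, so it
respects the bounds on the other side. -/
theorem exists_recession_of_large (h : SplitsInto I.A l lab Z) (hZ : Z.card ≤ z)
    (hN : I.BoundedBy N) {x : Fin n → ℤ} (hx : I.IsFeasible x) {v₀ : Fin n}
    (hlarge : (variableBound N (l + z) : ℤ) < |x v₀|) :
    ∃ g, g ≠ 0 ∧ I.IsRecession g ∧ IsPart g x ∧ I.IsFeasible (x - g) := by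
  have hsz := hN.size
  have hN2 : 2 ≤ N := by omega
  have hM := le_variableBound hN2 (l + z)
  set t : Fin n → ℤ := fun v => max (-N) (min N (x v)) with ht
  have htN : ∀ v, |t v| ≤ N := fun v => by rw [abs_le, ht]; dsimp only; omega
  have hy : ∀ c, |∑ v, I.A c v * (x - t) v| ≤ ((N ^ 4 : ℕ) : ℤ) := fun c => by
    rw [sum_mul_sub, hx.1 c]
    refine (abs_sub _ _).trans ?_
    have h1 := abs_sum_mul_le (a := I.A c) (x := t) (N := N) (by positivity) (hN.entry c) htN
    have h2 : N + n * (N * N) ≤ N ^ 4 := by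
      calc N + n * (N * N) ≤ N * (N * N) + N * (N * N) := by
            gcongr
            · nlinarith
            · omega
        _ = 2 * N ^ 3 := by ring
        _ ≤ N * N ^ 3 := by gcongr
        _ = N ^ 4 := by ring
    calc |I.rhs c| + _ ≤ (N : ℤ) + n * (N * N) := add_le_add (hN.rhs c) h1
      _ ≤ _ := by exact_mod_cast h2
  have hNB : N ≤ N ^ 4 := Nat.le_self_pow (by omega) N
  obtain ⟨g, hg0, hgA, hgy⟩ := ZeroSum.exists_kernel_vector h hZ (B := N ^ 4) (by omega) (by omega)
    (fun c v => (hN.entry c v).trans (by exact_mod_cast hNB)) (x - t) hy (by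
      have h1 : ((x - t) v₀).natAbs ≤ ∑ v, ((x - t) v).natAbs :=
        Finset.single_le_sum (f := fun v => ((x - t) v).natAbs) (fun _ _ => Nat.zero_le _)
          (Finset.mem_univ _)
      refine lt_of_lt_of_le ?_ h1
      have h2 := htN v₀
      zify at hM ⊢
      simp only [Pi.sub_apply]
      have := abs_sub_abs_le_abs_sub (x v₀) (t v₀)
      linarith)
  have hgv : ∀ v, g v = 0 ∨ (0 < g v ∧ g v ≤ x v - N) ∨ (g v < 0 ∧ x v + N ≤ g v) := fun v => by
    have := hgy v
    simp only [Pi.sub_apply, ht] at this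
    omega
  have hup : ∀ v, 0 < g v → I.upper v = ((⊤ : WithTop ℤ) : WithBot (WithTop ℤ)) := fun v hv => by
    rcases ExtInt.cases (I.upper v) with h | h | ⟨u, h⟩
    · exact absurd (h ▸ (hx.2 v).2) ExtInt.not_ofInt_le_bot
    · exact h
    · have h1 := (hx.2 v).2
      have h2 := abs_le.1 (hN.upper v u h)
      rw [h, ExtInt.ofInt_le_ofInt] at h1
      have := hgv v
      omega
  have hlo : ∀ v, g v < 0 → I.lower v = ⊥ := fun v hv => by
    rcases ExtInt.cases (I.lower v) with h | h | ⟨u, h⟩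
    · exact h
    · exact absurd (h ▸ (hx.2 v).1) ExtInt.not_top_le_ofInt
    · have h1 := (hx.2 v).1
      have h2 := abs_le.1 (hN.lower v u h)
      rw [h, ExtInt.ofInt_le_ofInt] at h1
      have := hgv v
      omega
  refine ⟨g, hg0, ⟨hgA, hlo, hup⟩, fun v => by have := hgv v; omega,
    fun c => by rw [sum_mul_sub, hgA c, hx.1 c, sub_zero], fun v => ⟨?_, ?_⟩⟩
  · rcases hgv v with h | h | h
    · simpa [h] using (hx.2 v).1
    · rcases ExtInt.cases (I.lower v) with h' | h' | ⟨u, h'⟩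
      · rw [h']; simp
      · exact absurd (h' ▸ (hx.2 v).1) ExtInt.not_top_le_ofInt
      · have h2 := abs_le.1 (hN.lower v u h')
        rw [h', ExtInt.ofInt_le_ofInt, Pi.sub_apply]
        omega
    · rw [hlo v h.1]; simp
  · rcases hgv v with h | h | h
    · simpa [h] using (hx.2 v).2
    · rw [hup v h.1]; simp
    · rcases ExtInt.cases (I.upper v) with h' | h' | ⟨u, h'⟩
      · exact absurd (h' ▸ (hx.2 v).2) ExtInt.not_ofInt_le_bot
      · rw [h']; simp
      · have h2 := abs_le.1 (hN.upper v u h')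
        rw [h', ExtInt.ofInt_le_ofInt, Pi.sub_apply]
        omega

/-- If there is a solution, then there is one with small entries. -/
theorem exists_small_solution (h : SplitsInto I.A l lab Z) (hZ : Z.card ≤ z) (hN : I.BoundedBy N)
    (hsol : ∃ x, I.IsSolution x) :
    ∃ x, I.IsSolution x ∧ ∀ v, |x v| ≤ variableBound N (l + z) := by
  obtain ⟨x, hx, hmin⟩ := exists_minimalFor_of_wellFoundedLT I.IsSolution norm hsol
  refine ⟨x, hx, fun v => ?_⟩
  by_contra hv
  obtain ⟨g, hg0, hrec, hpart, hfeas⟩ := exists_recession_of_large h hZ hN hx.1 (not_le.1 hv)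
  -- Optimality against `x + g` gives a nonpositive objective for `g`, so `x - g` is at least as
  -- good as `x` and has smaller norm.
  have h1 := hx.2 _ (hrec.add hx.1)
  rw [sum_mul_add] at h1
  have h2 : I.IsSolution (x - g) := ⟨hfeas, fun y hy => by
    rw [sum_mul_sub]
    have := hx.2 y hy
    linarith⟩
  have h3 := norm_sub_lt hpart hg0
  have := hmin h2 h3.le
  omega

/-- If some direction improves the objective, then there is one with small entries. -/
theorem exists_small_recession (h : SplitsInto I.A l lab Z) (hZ : Z.card ≤ z)
    (hN : I.BoundedBy N) (hex : ∃ g, I.IsRecession g ∧ 0 < ∑ v, I.obj v * g v) :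
    ∃ g, I.IsRecession g ∧ 0 < ∑ v, I.obj v * g v ∧ ∀ v, |g v| ≤ variableBound N (l + z) := by
  obtain ⟨g, ⟨hg, hpos⟩, hmin⟩ := exists_minimalFor_of_wellFoundedLT
    (fun g => I.IsRecession g ∧ 0 < ∑ v, I.obj v * g v) norm hex
  refine ⟨g, hg, hpos, fun v₀ => ?_⟩
  by_contra hv
  rw [not_le] at hv
  have hsz := hN.size
  have hN2 : 2 ≤ N := by omega
  have hM := le_variableBound hN2 (l + z)
  have hNB : N ≤ N ^ 4 := Nat.le_self_pow (by omega) N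
  -- One unit at `v₀` is taken away from `g`. The image of `g - e` is a single column up to sign,
  -- hence small, and a kernel vector that is a part of `g - e` cannot be all of `g`.
  set e : Fin n → ℤ := Pi.single v₀ (g v₀).sign with he
  have hev : ∀ v, v ≠ v₀ → e v = 0 := fun v hv => by simp [he, hv]
  have hev₀ : e v₀ = (g v₀).sign := by simp [he]
  have hsum : ∀ c, ∑ v, I.A c v * (g - e) v = - (I.A c v₀ * (g v₀).sign) := fun c => by
    rw [sum_mul_sub, hg.kernel c, Finset.sum_eq_single v₀ (fun v _ hv => by simp [hev v hv])
      (by simp), hev₀, zero_sub]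
  obtain ⟨x, hx0, hxA, hxy⟩ := ZeroSum.exists_kernel_vector h hZ (B := N ^ 4) (by omega) (by omega)
    (fun c v => (hN.entry c v).trans (by exact_mod_cast hNB)) (g - e) (fun c => by
      rw [hsum, abs_neg, abs_mul]
      calc |I.A c v₀| * |(g v₀).sign| ≤ (N : ℤ) * 1 :=
            mul_le_mul (hN.entry _ _) (ZeroSum.abs_sign_le _) (abs_nonneg _) (by positivity)
        _ ≤ _ := by rw [mul_one]; exact_mod_cast hNB) (by
      have h1 : ((g - e) v₀).natAbs ≤ ∑ v, ((g - e) v).natAbs :=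
        Finset.single_le_sum (f := fun v => ((g - e) v).natAbs) (fun _ _ => Nat.zero_le _)
          (Finset.mem_univ _)
      refine lt_of_lt_of_le ?_ h1
      have h2 := ZeroSum.abs_sign_le (g v₀)
      zify at hM ⊢
      simp only [Pi.sub_apply, hev₀]
      have := abs_sub_abs_le_abs_sub (g v₀) (g v₀).sign
      linarith)
  have hsgn : ∀ v, (0 ≤ e v ∧ (0 < e v → 0 < g v) ∧ e v ≤ 1 ∨
      e v ≤ 0 ∧ (e v < 0 → g v < 0) ∧ -1 ≤ e v) := fun v => by
    by_cases hvv : v = v₀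
    · rw [hvv, hev₀]
      rcases lt_trichotomy (g v₀) 0 with h | h | h
      · rw [Int.sign_eq_neg_one_of_neg h]; omega
      · rw [h, Int.sign_zero]; omega
      · rw [Int.sign_eq_one_of_pos h]; omega
    · rw [hev v hvv]; omega
  have hpart : IsPart x g := fun v => by
    have h1 := hxy v
    have h2 := hsgn v
    simp only [Pi.sub_apply] at h1
    omega
  have hne : x ≠ g := by
    intro hxg
    have h1 := hxy v₀
    rw [hxg, Pi.sub_apply, hev₀] at h1
    have hg0 : g v₀ ≠ 0 := by
      intro h0
      rw [h0] at hv
      simp only [abs_zero] at hv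
      omega
    rcases lt_or_gt_of_ne hg0 with h | h
    · rw [Int.sign_eq_neg_one_of_neg h] at h1; omega
    · rw [Int.sign_eq_one_of_pos h] at h1; omega
  have hrx : I.IsRecession x := ⟨hxA, fun v hv => hg.lower v (by have := hpart v; omega),
    fun v hv => hg.upper v (by have := hpart v; omega)⟩
  have hrgx : I.IsRecession (g - x) := ⟨fun c => by rw [sum_mul_sub, hg.kernel c, hxA c, sub_zero],
    fun v hv => hg.lower v (by have := hpart v; rw [Pi.sub_apply] at hv; omega),
    fun v hv => hg.upper v (by have := hpart v; rw [Pi.sub_apply] at hv; omega)⟩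
  -- Both `x` and `g - x` are recession directions of smaller norm than `g`, and at least one of
  -- them improves the objective.
  by_cases hxp : 0 < ∑ v, I.obj v * x v
  · have h1 := norm_lt hpart hne
    have := hmin ⟨hrx, hxp⟩ h1.le
    omega
  · have h1 := norm_sub_lt hpart hx0
    have := hmin ⟨hrgx, by rw [sum_mul_sub]; linarith⟩ h1.le
    omega

/-- A best assignment among those with small entries is a solution if it cannot be improved by
doubling the bound on the entries. -/
theorem isSolution_of_double (h : SplitsInto I.A l lab Z) (hZ : Z.card ≤ z) (hN : I.BoundedBy N)
    {x : Fin n → ℤ} (hx : I.IsFeasible x) (hxM : ∀ v, |x v| ≤ variableBound N (l + z))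
    (hbest : ∀ y, I.IsFeasible y → (∀ v, |y v| ≤ 2 * variableBound N (l + z)) →
      ∑ v, I.obj v * y v ≤ ∑ v, I.obj v * x v) : I.IsSolution x := by
  refine ⟨hx, ?_⟩
  by_contra hcon
  push Not at hcon
  obtain ⟨y, ⟨hy, hyx⟩, hmin⟩ := exists_minimalFor_of_wellFoundedLT
    (fun y => I.IsFeasible y ∧ ∑ v, I.obj v * x v < ∑ v, I.obj v * y v) norm hcon
  have hlarge : ∃ v, (variableBound N (l + z) : ℤ) < |y v| := by
    by_contra hsmall
    push Not at hsmall
    have := hbest y hy fun v => (hsmall v).trans (by linarith [hsmall v, abs_nonneg (y v)])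
    linarith
  obtain ⟨v, hv⟩ := hlarge
  obtain ⟨g, hg0, hrec, hpart, hfeas⟩ := exists_recession_of_large h hZ hN hy hv
  -- Otherwise `y - g` would be feasible, at least as good as `y`, and of smaller norm.
  have hpos : 0 < ∑ v, I.obj v * g v := by
    by_contra hneg
    have h1 := norm_sub_lt hpart hg0
    have := hmin ⟨hfeas, by rw [sum_mul_sub]; linarith⟩ h1.le
    omega
  obtain ⟨g', hrec', hpos', hsmall⟩ := exists_small_recession h hZ hN ⟨g, hrec, hpos⟩
  -- Both `x` and `g'` have entries at most `M`, so `x + g'` lies in the box of size `2 * M` and is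
  -- better than `x`.
  have := hbest _ (hrec'.add hx) fun v => (abs_add_le _ _).trans (by linarith [hxM v, hsmall v])
  rw [sum_mul_add] at this
  linarith

theorem boundedBy_encode (I : ILP (Fin n) (Fin m)) : I.BoundedBy (Unary.encode I).length := by
  obtain ⟨hsz, hA, hb, hl, hu, -⟩ := RAM.le_length_encode I
  have hext : ∀ z : ℤ, z.natAbs ≤ (Unary.encodeExtInt (ExtInt.ofInt z)).length := fun z => by
    change _ ≤ (false :: Unary.encodeInt z).length
    simp [Unary.encodeInt, Unary.encodeNat]
    omega
  refine ⟨hsz, fun c v => ?_, fun c => ?_, fun v z h => ?_, fun v z h => ?_⟩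
  · have := hA c v; rw [Int.abs_eq_natAbs]; omega
  · have := hb c; rw [Int.abs_eq_natAbs]; omega
  · have h1 := hl v; rw [h] at h1; have := hext z; rw [Int.abs_eq_natAbs]; omega
  · have h1 := hu v; rw [h] at h1; have := hext z; rw [Int.abs_eq_natAbs]; omega

end ILP

/-! ### Computing the classes greedily -/

/-- The components after the removal of the constraints in `S`: the vertices are numbered such that
the variables come first, and `comp` assigns their components to them. -/
structure IsComponents {ι : Type} (E : ℕ → ℕ → ℤ) (n m k : ℕ) (S : Finset ℕ) (comp : ℕ → ι) :
    Prop where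
  card_le : S.card ≤ k
  comp_eq : ∀ c < m, c ∉ S → ∀ v < n, E v c ≠ 0 → comp v = comp (n + c)
  size_le : ∀ T : Finset ℕ, (∀ u ∈ T, u < n + m ∧ ∀ c ∈ S, u ≠ n + c) →
    (∃ i, ∀ u ∈ T, comp u = i) → T.card ≤ k

/-- The infimum over `l` is attained, and any `l` attaining it, with a suitable backdoor, satisfies
both bounds by `k`. Graph components are replaced by a function on natural numbers, which is all
that the comparison with the greedy procedure needs. -/
theorem exists_components {n m k : ℕ} (I : ILP (Fin n) (Fin m))
    (hk : I.constraintFractureNumber = (k : ℕ∞)) :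
    ∃ (ι : Type) (S : Finset ℕ) (comp : ℕ → ι), IsComponents I.extended n m k S comp := by
  classical
  obtain ⟨l, hl⟩ := ciInf_mem fun l : ℕ => max (l : ℕ∞) (I.constraintBackdoorNumber l)
  rw [← ILP.constraintFractureNumber, hk] at hl
  dsimp only at hl
  have hlk : l ≤ k := by
    have := le_max_left (l : ℕ∞) (I.constraintBackdoorNumber l)
    rw [hl] at this
    exact_mod_cast this
  have hb : I.constraintBackdoorNumber l < ((k + 1 : ℕ) : ℕ∞) :=
    lt_of_le_of_lt (hl ▸ le_max_right _ _) (by exact_mod_cast Nat.lt_succ_self k)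
  simp only [ILP.constraintBackdoorNumber, iInf_lt_iff] at hb
  obtain ⟨Z, ⟨hZv, hZ⟩, hZk⟩ := hb
  let S : Finset ℕ := (Finset.univ.filter fun c : Fin m => Sum.inr c ∈ Z).image Fin.val
  have hS : ∀ c : Fin m, (c : ℕ) ∈ S ↔ Sum.inr c ∈ Z := fun c => by
    simp only [S, Finset.mem_image, Finset.mem_filter, Finset.mem_univ, true_and]
    exact ⟨fun ⟨c', h, e⟩ => Fin.ext e ▸ h, fun h => ⟨c, h, rfl⟩⟩
  -- The value `none` stands for removed constraints and for numbers out of range; the size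
  -- condition speaks of neither.
  let vert : ℕ → Option ({v : Fin n // Sum.inl v ∉ Z} ⊕ {c : Fin m // Sum.inr c ∉ Z}) := fun u =>
    if hu : u < n then some (Sum.inl ⟨⟨u, hu⟩, hZv _⟩)
    else if hc : u - n < m then
      if hcZ : Sum.inr ⟨u - n, hc⟩ ∉ Z then some (Sum.inr ⟨⟨u - n, hc⟩, hcZ⟩) else none
    else none
  refine ⟨Option (I.delete Z).incidenceGraph.ConnectedComponent, S,
    fun u => (vert u).map (I.delete Z).incidenceGraph.connectedComponentMk, ?_, ?_, ?_⟩
  · have h1 : (S.card : ℕ∞) ≤ Z.encard := by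
      rw [Finset.card_image_of_injective _ Fin.val_injective, ← Set.encard_coe_eq_coe_finsetCard,
        ← Sum.inr_injective.encard_image]
      refine Set.encard_le_encard ?_
      rintro _ ⟨c, hc, rfl⟩
      simpa using hc
    have h2 := lt_of_le_of_lt h1 hZk
    have h3 : S.card < k + 1 := by exact_mod_cast h2
    omega
  · intro c hc hcS v hv hne
    have hcZ : Sum.inr ⟨c, hc⟩ ∉ Z := fun h => hcS ((hS ⟨c, hc⟩).2 h)
    have h1 : vert v = some (Sum.inl ⟨⟨v, hv⟩, hZv _⟩) := by simp [vert, hv]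
    have h2 : vert (n + c) = some (Sum.inr ⟨⟨c, hc⟩, hcZ⟩) := by simp [vert, hc, hcZ]
    have h3 : I.A ⟨c, hc⟩ ⟨v, hv⟩ ≠ 0 := by simpa [ILP.extended, hc, hv] using hne
    have h4 : (I.delete Z).incidenceGraph.Adj (Sum.inl ⟨⟨v, hv⟩, hZv _⟩)
        (Sum.inr ⟨⟨c, hc⟩, hcZ⟩) := h3
    simp only [h1, h2, Option.map_some]
    exact congrArg some (SimpleGraph.ConnectedComponent.sound h4.reachable)
  · rintro T hT ⟨i, hi⟩
    have hdef : ∀ u ∈ T, ∃ x, vert u = some x := by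
      intro u hu
      obtain ⟨h1, h2⟩ := hT u hu
      by_cases hun : u < n
      · exact ⟨Sum.inl ⟨⟨u, hun⟩, hZv _⟩, by simp only [vert, hun, dif_pos]⟩
      · have hc : u - n < m := by omega
        have hcZ : Sum.inr ⟨u - n, hc⟩ ∉ Z := fun h =>
          h2 (u - n) ((hS ⟨u - n, hc⟩).2 h) (by omega)
        exact ⟨Sum.inr ⟨⟨u - n, hc⟩, hcZ⟩, by simp only [vert, hun, hc, hcZ]; simp⟩
    have hinj : ∀ u u' x, vert u = some x → vert u' = some x → u = u' := by
      intro u u' x h1 h2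
      simp only [vert] at h1 h2
      split_ifs at h1 h2 <;> simp only [Option.some.injEq] at h1 h2 <;>
        subst h1 <;> simp at h2 <;> omega
    rcases T.eq_empty_or_nonempty with rfl | ⟨u₀, hu₀⟩
    · simp
    obtain ⟨x₀, hx₀⟩ := hdef u₀ hu₀
    let K := (I.delete Z).incidenceGraph.connectedComponentMk x₀
    have hK := hZ K
    have hiK : i = some K := by rw [← hi u₀ hu₀]; simp [hx₀, K]
    choose f hf using hdef
    have hcard : (T.card : ℕ∞) ≤ K.supp.encard := by
      rw [← Set.encard_coe_eq_coe_finsetCard]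
      let g : ℕ → {v : Fin n // Sum.inl v ∉ Z} ⊕ {c : Fin m // Sum.inr c ∉ Z} := fun u =>
        if hu : u ∈ T then f u hu else x₀
      have hg : ∀ u ∈ T, vert u = some (g u) := fun u hu => by simp only [g, hu, dif_pos, hf u hu]
      have hginj : Set.InjOn g T := fun u hu u' hu' he =>
        hinj u u' (g u) (hg u hu) (he ▸ hg u' hu')
      rw [← hginj.encard_image]
      refine Set.encard_le_encard ?_
      rintro _ ⟨u, hu, rfl⟩
      have := hi u hu
      rw [hg u hu, hiK, Option.map_some, Option.some.injEq] at this
      exact this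
    have h1 : T.card ≤ l := by exact_mod_cast hcard.trans hK
    exact h1.trans hlk

/-- A labelling of the variables and of the constraints `0, …, r - 1`, except for those in `Z`, such
that every constraint has the same label as its variables, and no label occurs more than `l` times.
The other constraints have the label `-1`. -/
structure IsLabelling (E : ℕ → ℕ → ℤ) (n m l r : ℕ) (lab : ℕ → ℤ) (Z : Finset ℕ) : Prop where
  lt : ∀ c ∈ Z, c < r
  var : ∀ v < n, 0 ≤ lab v ∧ lab v < n
  row : ∀ c < m, lab (n + c) = -1 ∨ 0 ≤ lab (n + c) ∧ lab (n + c) < n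
  rest : ∀ c < m, r ≤ c ∨ c ∈ Z → lab (n + c) = -1
  eq : ∀ c < r, c ∉ Z → ∀ v < n, E v c ≠ 0 → lab v = lab (n + c)
  size : ∀ L, 0 ≤ L → ((Finset.range (n + m)).filter fun u => lab u = L).card ≤ l

/-- The label of some constraint in `S`. -/
def IsPolluted (n m : ℕ) (S : Finset ℕ) (lab : ℕ → ℤ) (L : ℤ) : Prop :=
  ∃ c < m, c ∈ S ∧ lab (n + c) = L

/-- The labelling does not deviate much from the components that remain after the removal of `S`. -/
structure IsTight {ι : Type} (E : ℕ → ℕ → ℤ) (n m : ℕ) (S : Finset ℕ) (comp : ℕ → ι)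
    (lab : ℕ → ℤ) (Z : Finset ℕ) : Prop where
  comp_eq : ∀ L, 0 ≤ L → ¬ IsPolluted n m S lab L → ∃ i, ∀ u < n + m, lab u = L → comp u = i
  polluted : ∀ c ∈ Z, c ∉ S → ∃ v < n, E v c ≠ 0 ∧ IsPolluted n m S lab (lab v)

/-- The label `L` occurs at a variable of the constraint `c`. -/
def IsTouched (E : ℕ → ℕ → ℤ) (n : ℕ) (lab : ℕ → ℤ) (c : ℕ) (L : ℤ) : Prop :=
  ∃ v < n, E v c ≠ 0 ∧ lab v = L

/-- The label of a constraint after the merging of its classes: a touched label, or `-1` if there is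
none. -/
def IsRepresentative (E : ℕ → ℕ → ℤ) (n : ℕ) (lab : ℕ → ℤ) (c : ℕ) (L : ℤ) : Prop :=
  IsTouched E n lab c L ∨ L = -1 ∧ ∀ L', ¬ IsTouched E n lab c L'

section

variable {ι : Type} {E : ℕ → ℕ → ℤ} {n m k l r : ℕ} {lab : ℕ → ℤ} {Z S : Finset ℕ} {comp : ℕ → ι}

theorem isLabelling_init (hl : 1 ≤ l) (h1 : ∀ v < n, lab v = v) (h2 : ∀ c < m, lab (n + c) = -1) :
    IsLabelling E n m l 0 lab ∅ := by
  refine ⟨by simp, fun v hv => by rw [h1 v hv]; omega, fun c hc => Or.inl (h2 c hc),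
    fun c hc _ => h2 c hc, by omega, fun L hL => le_trans ?_ hl⟩
  rw [Finset.card_le_one]
  have key : ∀ u ∈ (Finset.range (n + m)).filter fun u => lab u = L, (u : ℤ) = L := by
    intro u hu
    rw [Finset.mem_filter, Finset.mem_range] at hu
    by_cases hun : u < n
    · rw [← hu.2, h1 u hun]
    · have := h2 (u - n) (by omega)
      rw [Nat.add_sub_cancel' (by omega)] at this
      omega
  intro u hu u' hu'
  have := key u hu
  have := key u' hu'
  omega

theorem isTight_init (h1 : ∀ v < n, lab v = v) (h2 : ∀ c < m, lab (n + c) = -1) :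
    IsTight E n m S comp lab ∅ := by
  refine ⟨fun L hL _ => ⟨comp L.toNat, fun u hu hul => ?_⟩, by simp⟩
  by_cases hun : u < n
  · rw [h1 u hun] at hul
    rw [← hul, Int.toNat_natCast]
  · have := h2 (u - n) (by omega)
    rw [Nat.add_sub_cancel' (by omega)] at this
    omega

theorem IsLabelling.step_global (h : IsLabelling E n m l r lab Z) (hr : r < m) :
    IsLabelling E n m l (r + 1) lab (insert r Z) := by
  refine ⟨fun c hc => ?_, h.var, h.row, fun c hc h' => ?_, fun c hc hcZ => ?_, h.size⟩
  · rcases Finset.mem_insert.1 hc with rfl | hc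
    · omega
    · have := h.lt c hc; omega
  · rcases h' with h' | h'
    · exact h.rest c hc (Or.inl (by omega))
    · rcases Finset.mem_insert.1 h' with rfl | h'
      · exact h.rest c hc (Or.inl le_rfl)
      · exact h.rest c hc (Or.inr h')
  · rw [Finset.mem_insert, not_or] at hcZ
    exact h.eq c (by omega) hcZ.2

open Classical in
-- If `r`, not in `S`, touched no polluted class, every touched class would lie in the component of
-- `r`. Together with `r`, which still has the label `-1` and so is not yet counted, these would be
-- more than `l ≥ k` vertices of one component.
theorem IsTight.step_global (h : IsTight E n m S comp lab Z) (hl : IsLabelling E n m l r lab Z)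
    (hc : IsComponents E n m k S comp) (hkl : k ≤ l) (hr : r < m)
    (hsize : l < ((Finset.range (n + m)).filter fun u => IsTouched E n lab r (lab u)).card + 1) :
    IsTight E n m S comp lab (insert r Z) := by
  refine ⟨h.comp_eq, fun c hcZ hcS => ?_⟩
  rcases Finset.mem_insert.1 hcZ with rfl | hcZ
  · by_contra hcon
    push Not at hcon
    set T := (Finset.range (n + m)).filter fun u => IsTouched E n lab c (lab u) with hT
    have hcT : n + c ∉ T := by
      intro hmem
      obtain ⟨v, hv, -, h2⟩ := (Finset.mem_filter.1 hmem).2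
      rw [hl.rest c hr (Or.inl le_rfl)] at h2
      have := (hl.var v hv).1
      omega
    have := hc.size_le (insert (n + c) T) (fun u hu => ?_) ⟨comp (n + c), fun u hu => ?_⟩
    · rw [Finset.card_insert_of_notMem hcT] at this
      omega
    · rcases Finset.mem_insert.1 hu with rfl | hu
      · exact ⟨by omega, fun c' hc' he => hcS (by rwa [show c = c' by omega])⟩
      · rw [hT, Finset.mem_filter, Finset.mem_range] at hu
        obtain ⟨hu, v, hv, hne, hlab⟩ := hu
        refine ⟨hu, fun c' hc' he => hcon v hv hne ⟨c', by omega, hc', ?_⟩⟩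
        rw [hlab, he]
    · rcases Finset.mem_insert.1 hu with rfl | hu
      · rfl
      · rw [hT, Finset.mem_filter, Finset.mem_range] at hu
        obtain ⟨hu, v, hv, hne, hlab⟩ := hu
        obtain ⟨i, hi⟩ := h.comp_eq (lab v) (hl.var v hv).1 (hcon v hv hne)
        rw [hi u hu hlab.symm, ← hi v (by omega) rfl]
        exact hc.comp_eq c hr hcS v hv hne
  · exact h.polluted c hcZ hcS

open Classical in
-- The class of `rep` becomes the union of the touched classes and `r`, whose size is bounded by
-- `hsize`; the other classes do not grow. Variables have nonnegative labels, so `-1` is never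
-- touched and the unlabelled constraints keep this label.
theorem IsLabelling.step_merge (h : IsLabelling E n m l r lab Z) (hr : r < m)
    (hsize : ((Finset.range (n + m)).filter fun u => IsTouched E n lab r (lab u)).card + 1 ≤ l)
    {rep : ℤ} (hrep : IsRepresentative E n lab r rep) {lab' : ℕ → ℤ}
    (h1 : ∀ u < n + m, u ≠ n + r → IsTouched E n lab r (lab u) → lab' u = rep)
    (h2 : ∀ u < n + m, u ≠ n + r → ¬ IsTouched E n lab r (lab u) → lab' u = lab u)
    (h3 : lab' (n + r) = rep) :
    IsLabelling E n m l (r + 1) lab' Z := by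
  have hnt : ¬ IsTouched E n lab r (-1) := fun ⟨v, hv, _, h'⟩ => by
    have := (h.var v hv).1
    omega
  have hrepn : rep = -1 ∨ 0 ≤ rep ∧ rep < n := by
    rcases hrep with ⟨v, hv, _, h'⟩ | h'
    · right; rw [← h']; exact h.var v hv
    · exact Or.inl h'.1
  refine ⟨fun c hc => by have := h.lt c hc; omega, fun v hv => ?_, fun c hc => ?_,
    fun c hc h' => ?_, fun c hc hcZ v hv hne => ?_, fun L hL => ?_⟩
  · by_cases ht : IsTouched E n lab r (lab v)
    · rw [h1 v (by omega) (by omega) ht]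
      rcases hrep with ⟨w, hw, _, h'⟩ | h'
      · rw [← h']; exact h.var w hw
      · exact absurd ht (h'.2 _)
    · rw [h2 v (by omega) (by omega) ht]
      exact h.var v hv
  · by_cases hcr : c = r
    · rw [hcr, h3]; exact hrepn
    · by_cases ht : IsTouched E n lab r (lab (n + c))
      · rw [h1 (n + c) (by omega) (by omega) ht]; exact hrepn
      · rw [h2 (n + c) (by omega) (by omega) ht]; exact h.row c hc
  · have hcr : c ≠ r := by
      rintro rfl
      rcases h' with h' | h'
      · omega
      · exact absurd (h.lt c h') (lt_irrefl _)
    have h4 : lab (n + c) = -1 := h.rest c hc (h'.imp (fun h => by omega) id)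
    rw [h2 (n + c) (by omega) (by omega) (by rwa [h4]), h4]
  · by_cases hcr : c = r
    · rw [hcr, h3]
      exact h1 v (by omega) (by omega) ⟨v, hv, hcr ▸ hne, rfl⟩
    · have h4 := h.eq c (by omega) hcZ v hv hne
      by_cases ht : IsTouched E n lab r (lab v)
      · rw [h1 v (by omega) (by omega) ht, h1 (n + c) (by omega) (by omega) (h4 ▸ ht)]
      · rw [h2 v (by omega) (by omega) ht, h2 (n + c) (by omega) (by omega) (h4 ▸ ht), h4]
  · by_cases hLr : L = rep
    · have hrept : IsTouched E n lab r rep := by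
        rcases hrep with h' | h'
        · exact h'
        · omega
      refine le_trans (Finset.card_le_card (t := insert (n + r)
        ((Finset.range (n + m)).filter fun u => IsTouched E n lab r (lab u))) fun u hu => ?_)
        ((Finset.card_insert_le _ _).trans hsize)
      rw [Finset.mem_filter, Finset.mem_range] at hu
      rw [Finset.mem_insert, Finset.mem_filter, Finset.mem_range]
      by_cases hur : u = n + r
      · exact Or.inl hur
      · right
        refine ⟨hu.1, ?_⟩
        by_contra ht
        rw [h2 u hu.1 hur ht, hLr] at hu
        exact ht (hu.2 ▸ hrept)
    · refine le_trans (Finset.card_le_card fun u hu => ?_) (h.size L hL)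
      rw [Finset.mem_filter, Finset.mem_range] at hu ⊢
      refine ⟨hu.1, ?_⟩
      by_cases hur : u = n + r
      · rw [hur, h3] at hu; exact absurd hu.2.symm hLr
      · by_cases ht : IsTouched E n lab r (lab u)
        · rw [h1 u hu.1 hur ht] at hu; exact absurd hu.2.symm hLr
        · rw [← h2 u hu.1 hur ht, hu.2]

/-- If the merged class is not polluted, then `r` is not in `S` and none of its parts was polluted,
so all parts lie in the component of `r`. Pollution is never lost, because classes only grow. -/
theorem IsTight.step_merge (h : IsTight E n m S comp lab Z) (hl : IsLabelling E n m l r lab Z)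
    (hc : IsComponents E n m k S comp) (hr : r < m)
    {rep : ℤ} (hrep : IsRepresentative E n lab r rep) {lab' : ℕ → ℤ}
    (h1 : ∀ u < n + m, u ≠ n + r → IsTouched E n lab r (lab u) → lab' u = rep)
    (h2 : ∀ u < n + m, u ≠ n + r → ¬ IsTouched E n lab r (lab u) → lab' u = lab u)
    (h3 : lab' (n + r) = rep) :
    IsTight E n m S comp lab' Z := by
  have hlr := hl.rest r hr (Or.inl le_rfl)
  refine ⟨fun L hL hnp => ?_, fun c hcZ hcS => ?_⟩
  · by_cases hLr : L = rep
    · have hrept : IsTouched E n lab r rep := by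
        rcases hrep with h' | h'
        · exact h'
        · omega
      have hrS : r ∉ S := fun hrS => hnp ⟨r, hr, hrS, by rw [h3, hLr]⟩
      refine ⟨comp (n + r), fun u hu hul => ?_⟩
      by_cases hur : u = n + r
      · rw [hur]
      · have ht : IsTouched E n lab r (lab u) := by
          by_contra ht
          rw [h2 u hu hur ht, hLr] at hul
          exact ht (hul ▸ hrept)
        obtain ⟨v, hv, hne, hvu⟩ := ht
        have hnp' : ¬ IsPolluted n m S lab (lab v) := by
          rintro ⟨c, hcm, hcS, hcl⟩
          have hcr : c ≠ r := fun h => hrS (h ▸ hcS)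
          refine hnp ⟨c, hcm, hcS, ?_⟩
          rw [h1 (n + c) (by omega) (by omega) ⟨v, hv, hne, hcl.symm⟩, hLr]
        obtain ⟨i, hi⟩ := h.comp_eq (lab v) (hl.var v hv).1 hnp'
        rw [hi u hu hvu.symm, ← hi v (by omega) rfl]
        exact hc.comp_eq r hr hrS v hv hne
    · have h4 : ∀ u < n + m, lab' u = L → u ≠ n + r ∧ lab u = L := fun u hu hul => by
        have hur : u ≠ n + r := fun h => hLr (by rw [← hul, h, h3])
        refine ⟨hur, ?_⟩
        by_cases ht : IsTouched E n lab r (lab u)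
        · rw [h1 u hu hur ht] at hul; exact absurd hul.symm hLr
        · rw [← h2 u hu hur ht, hul]
      by_cases ht : IsTouched E n lab r L
      · refine ⟨comp 0, fun u hu hul => ?_⟩
        obtain ⟨hur, h5⟩ := h4 u hu hul
        rw [h1 u hu hur (h5 ▸ ht)] at hul
        exact absurd hul.symm hLr
      · obtain ⟨i, hi⟩ := h.comp_eq L hL fun ⟨c, hcm, hcS, hcl⟩ => hnp ⟨c, hcm, hcS, by
          have hcr : c ≠ r := by
            rintro rfl
            omega
          rw [h2 (n + c) (by omega) (by omega) (hcl ▸ ht), hcl]⟩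
        exact ⟨i, fun u hu hul => hi u hu (h4 u hu hul).2⟩
  · obtain ⟨v, hv, hne, c', hc', hcS', hcl⟩ := h.polluted c hcZ hcS
    refine ⟨v, hv, hne, c', hc', hcS', ?_⟩
    have hcr : c' ≠ r := by
      rintro rfl
      have := (hl.var v hv).1
      omega
    by_cases ht : IsTouched E n lab r (lab v)
    · rw [h1 v (by omega) (by omega) ht, h1 (n + c') (by omega) (by omega) (hcl ▸ ht)]
    · rw [h2 v (by omega) (by omega) ht, h2 (n + c') (by omega) (by omega) (hcl ▸ ht), hcl]

/-- The greedy procedure makes few constraints global. -/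
theorem IsTight.card_le (h : IsTight E n m S comp lab Z) (hl : IsLabelling E n m l m lab Z)
    (hc : IsComponents E n m k S comp) : Z.card ≤ k + k * l * k := by
  classical
  -- `V` collects the vertices of the polluted classes, and `W` the constraints outside `S` that
  -- contain a variable in `V`.
  let V := S.biUnion fun c => (Finset.range (n + m)).filter fun u => 0 ≤ lab (n + c) ∧
    lab u = lab (n + c)
  let W := V.biUnion fun v => (Finset.range m).filter fun c => c ∉ S ∧ v < n ∧ E v c ≠ 0
  have h1 : Z ⊆ S ∪ W := by
    intro c hcZ
    by_cases hcS : c ∈ S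
    · exact Finset.mem_union_left _ hcS
    · refine Finset.mem_union_right _ ?_
      obtain ⟨v, hv, hne, c', hc', hcS', hcl⟩ := h.polluted c hcZ hcS
      have := (hl.var v hv).1
      refine Finset.mem_biUnion.2 ⟨v, Finset.mem_biUnion.2 ⟨c', hcS', ?_⟩, ?_⟩
      · simp only [Finset.mem_filter, Finset.mem_range]
        omega
      · simp only [Finset.mem_filter, Finset.mem_range]
        exact ⟨hl.lt c hcZ, hcS, hv, hne⟩
  have h2 : V.card ≤ k * l := by
    refine (Finset.card_biUnion_le_card_mul _ _ l fun c _ => ?_).trans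
      (Nat.mul_le_mul_right _ hc.card_le)
    by_cases h0 : 0 ≤ lab (n + c)
    · simpa [h0] using hl.size _ h0
    · simp [h0]
  -- The constraints outside `S` that contain a given variable all belong to its component, so there
  -- are at most `k` of them.
  have h3 : W.card ≤ V.card * k := by
    refine Finset.card_biUnion_le_card_mul _ _ k fun v _ => ?_
    rw [← Finset.card_image_of_injective _ (add_right_injective n)]
    refine hc.size_le _ (fun u hu => ?_) ⟨comp v, fun u hu => ?_⟩
    · simp only [Finset.mem_image, Finset.mem_filter, Finset.mem_range] at hu
      obtain ⟨c, ⟨hcm, hcS, -⟩, rfl⟩ := hu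
      exact ⟨by omega, fun c' hc' he => hcS (by rwa [show c = c' by omega])⟩
    · simp only [Finset.mem_image, Finset.mem_filter, Finset.mem_range] at hu
      obtain ⟨c, ⟨hcm, hcS, hv, hne⟩, rfl⟩ := hu
      exact (hc.comp_eq c hcm hcS v hv hne).symm
  calc Z.card ≤ (S ∪ W).card := Finset.card_le_card h1
    _ ≤ S.card + W.card := Finset.card_union_le _ _
    _ ≤ k + k * l * k := add_le_add hc.card_le (h3.trans (Nat.mul_le_mul_right _ h2))

end

theorem pow_three_le_four_pow (x : ℕ) : x ^ 3 ≤ 4 ^ x := by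
  induction x with
  | zero => simp
  | succ x ih =>
    rcases Nat.lt_or_ge x 2 with h | h
    · interval_cases x <;> norm_num
    · rw [pow_succ 4]
      nlinarith [mul_le_mul h h (by norm_num) (by omega : 0 ≤ x)]

/-- For `l = k + 1` the count `k + k * l * k` is at most `(k + 1) ^ 3`. The threshold `4 ^ l`
dominates this cube and needs only additions to compute; `l = k + 1` also avoids `l = 0`, for which
a single variable is already too large. -/
theorem IsTight.card_le_four_pow {ι : Type} {E : ℕ → ℕ → ℤ} {n m k : ℕ} {lab : ℕ → ℤ}
    {Z S : Finset ℕ} {comp : ℕ → ι} (h : IsTight E n m S comp lab Z)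
    (hl : IsLabelling E n m (k + 1) m lab Z) (hc : IsComponents E n m k S comp) :
    Z.card ≤ 4 ^ (k + 1) := by
  have h1 := h.card_le hl hc
  have h2 := pow_three_le_four_pow (k + 1)
  nlinarith

theorem IsLabelling.splitsInto {n m l : ℕ} {I : ILP (Fin n) (Fin m)} {lab : ℕ → ℤ} {Z : Finset ℕ}
    (h : IsLabelling I.extended n m l m lab Z) :
    SplitsInto I.A l (fun v => (lab v).toNat) (Finset.univ.filter fun c => (c : ℕ) ∈ Z) ∧
      (Finset.univ.filter fun c : Fin m => (c : ℕ) ∈ Z).card ≤ Z.card := by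
  classical
  have hE : ∀ (c : Fin m) (v : Fin n), I.A c v ≠ 0 → I.extended v c ≠ 0 := fun c v hne => by
    simpa [ILP.extended] using hne
  have hlab : ∀ (v : Fin n) (L : ℕ), (lab v).toNat = L → lab v = L := fun v L hL => by
    have := (h.var v v.2).1
    omega
  refine ⟨⟨fun v => ?_, fun c hc v v' hv hv' => ?_, fun L => ?_⟩, ?_⟩
  · have := h.var v v.2
    omega
  · have hc' : (c : ℕ) ∉ Z := by simpa using hc
    rw [h.eq c c.2 hc' v v.2 (hE c v hv), h.eq c c.2 hc' v' v'.2 (hE c v' hv')]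
  · refine le_trans ?_ (h.size L (by positivity))
    refine Finset.card_le_card_of_injOn (fun c : Fin m => n + c) ?_ ?_
    · intro c hc
      simp only [Finset.coe_filter, Finset.mem_filter, Finset.mem_univ, true_and,
        Set.mem_ofPred_eq] at hc
      obtain ⟨hcZ, v, hvL, hne⟩ := hc
      simp only [Finset.coe_filter, Finset.mem_range, Set.mem_ofPred_eq]
      exact ⟨by omega, by rw [← h.eq c c.2 hcZ v v.2 (hE c v hne), hlab v L hvL]⟩
    · intro c _ c' _ he
      exact Fin.ext (by simpa using he)
  · refine Finset.card_le_card_of_injOn (fun c : Fin m => (c : ℕ)) (fun c hc => ?_)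
      fun c _ c' _ he => Fin.ext he
    simpa using hc

namespace RAM

open Program

/-! ### The labelling program -/

section

variable {n m : ℕ} {I : ILP (Fin n) (Fin m)} {X l r : ℕ} {s : State}

/-- The first `r` constraints have been labelled, and `Z` is the set of global constraints. -/
structure LabelState (I : ILP (Fin n) (Fin m)) (l r : ℕ) (s : State) (Z : Finset ℕ) : Prop where
  labelling : IsLabelling I.extended n m l r (fun u => s.arr 7 u) Z
  card : s.reg 13 = Z.card
  -- The program knows no components, so tightness is kept for all possible choices of them; one
  -- choice is used at the end, to show that the search stops.
  tight : ∀ (ι : Type) (k : ℕ) (S : Finset ℕ) (comp : ℕ → ι),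
    IsComponents I.extended n m k S comp → k ≤ l →
      IsTight I.extended n m S comp (fun u => s.arr 7 u) Z
  -- Marks are looked up through the label. For a constraint with label `-1` this reads the cell
  -- `-1`, which must say that the label is untouched.
  untouched : s.arr 8 (-1) = 0

theorem initLabels_spec (hI : Loaded I s) (hX : n + m ≤ X) (hl : 1 ≤ l) (h8 : s.arr 8 (-1) = 0) :
    wp X initLabels (fun s' => LabelState I l 0 s' ∅) s := by
  simp only [initLabels, wp_seq, wp_assign, Expr.eval_const]
  refine wp_for (n + m) [13, 17] [7] (by decide) (by decide) (by decide) (by decide)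
    (by simp [hI.sizes.verts]) hX (fun a s' => s'.reg 13 = 0 ∧ ∀ u < a, s'.arr 7 (u : ℕ) =
      if u < n then (u : ℤ) else -1) (by simp) ?_ ?_
  · rintro a ha s1 hs1 h17 ⟨h13, h7⟩
    have h4 : s1.reg 4 = n := by rw [hs1.reg 4 (by decide)]; simp [hI.sizes.vars]
    simp only [wp_ite, wp_write, Expr.eval_sub', Expr.eval_reg, Expr.eval_const, h4, h17]
    refine ⟨fun hlt => ⟨by simp [h13], fun u hu => ?_⟩, fun hlt => ⟨by simp [h13], fun u hu => ?_⟩⟩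
    all_goals
      simp only [State.setReg_arr, State.setArr_arr, if_true, Function.update_apply, Nat.cast_inj]
      split_ifs
    all_goals first | omega | (rw [h7 u (by omega)]; split_ifs; omega)
  · rintro s1 hs1 ⟨h13, h7⟩
    have h1 : ∀ v < n, s1.arr 7 (v : ℕ) = v := fun v hv => by rw [h7 v (by omega), if_pos hv]
    have h2 : ∀ c < m, s1.arr 7 ((n + c : ℕ) : ℤ) = -1 := fun c hc => by
      rw [h7 _ (by omega), if_neg (by omega)]
    refine ⟨isLabelling_init hl h1 h2, by simp [h13], fun ι k S comp _ _ => isTight_init h1 h2, ?_⟩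
    rw [hs1.arr 8 (by decide)]
    exact h8

/-- The cell of array `8` at the label of the vertex `u` tells whether this label is touched. -/
def MarksTouched (I : ILP (Fin n) (Fin m)) (r : ℕ) (s : State) : Prop :=
  ∀ u < n + m, (IsTouched I.extended n (fun u => s.arr 7 u) r (s.arr 7 (u : ℕ)) →
      s.arr 8 (s.arr 7 (u : ℕ)) = 1) ∧
    (¬ IsTouched I.extended n (fun u => s.arr 7 u) r (s.arr 7 (u : ℕ)) →
      s.arr 8 (s.arr 7 (u : ℕ)) = 0)

theorem touch_spec (hI : Loaded I s) (hX : n + m ≤ X) {Z : Finset ℕ}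
    (h : IsLabelling I.extended n m l r (fun u => s.arr 7 u) Z) (hr : r < m) (h14 : s.reg 14 = r)
    (h8 : s.arr 8 (-1) = 0) :
    wp X touch (fun s' => s'.arr 8 (-1) = 0 ∧ MarksTouched I r s' ∧
      IsRepresentative I.extended n (fun u => s.arr 7 u) r (s'.reg 15)) s := by
  simp only [touch, wp_seq, wp_assign, Expr.eval_const, Expr.eval_reg]
  refine wp_for n [17] [8] (by decide) (by decide) (by decide) (by decide) hI.sizes.vars (by omega)
    (fun a s' => s'.arr 8 (-1) = 0 ∧ ∀ L < a, s'.arr 8 (L : ℕ) = 0) ⟨h8, by simp⟩ ?_ ?_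
  · rintro a ha s1 hs1 h17 ⟨h8, hz⟩
    simp only [wp_write, Expr.eval_const, Expr.eval_reg, h17]
    refine ⟨?_, fun L hL => ?_⟩
    · simp only [State.setReg_arr, State.setArr_arr, if_true, Function.update_apply, h8]
      simp
    · simp only [State.setReg_arr, State.setArr_arr, if_true, Function.update_apply, Nat.cast_inj]
      split_ifs
      · rfl
      · exact hz L (by omega)
  rintro s1 hs1 ⟨h8, hz⟩
  have e7 := hs1.arr 7 (by decide)
  refine wp_for n [10, 15, 17] [8] (by decide) (by decide) (by decide) (by decide)
    (by simp [hs1.reg 4 (by decide), hI.sizes.vars]) (by omega)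
    (fun a s' => s'.reg 10 = ((a * (n + m + 1) + r : ℕ) : ℤ) ∧ s'.arr 8 (-1) = 0 ∧
      (∀ L < n, ((∃ v < a, I.extended v r ≠ 0 ∧ s.arr 7 (v : ℕ) = L) → s'.arr 8 (L : ℕ) = 1) ∧
        ((¬ ∃ v < a, I.extended v r ≠ 0 ∧ s.arr 7 (v : ℕ) = L) → s'.arr 8 (L : ℕ) = 0)) ∧
      ((∃ v < a, I.extended v r ≠ 0 ∧ s.arr 7 (v : ℕ) = s'.reg 15) ∨
        s'.reg 15 = -1 ∧ ∀ v < a, I.extended v r = 0)) ?_ ?_ ?_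
  · refine ⟨by simp [hs1.reg 14 (by decide), h14], h8, fun L hL => ⟨?_, fun _ => hz L hL⟩,
      Or.inr ⟨by simp, by simp⟩⟩
    rintro ⟨v, hv, -⟩
    omega
  · rintro a ha s2 hs2 h17 ⟨h10, h8, hmark, hrep⟩
    have hE : s2.arr 1 ((a * (n + m + 1) + r : ℕ) : ℤ) = I.extended a r := by
      rw [hs2.arr 1 (by decide), State.setReg_arr, State.setReg_arr, hs1.arr 1 (by decide),
        hI.cols a ha r (by omega)]
    have e7' : s2.arr 7 = s.arr 7 := by
      rw [hs2.arr 7 (by decide), State.setReg_arr, State.setReg_arr, e7]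
    have h6 : s2.reg 6 = ((n + m + 1 : ℕ) : ℤ) := by
      rw [hs2.reg 6 (by decide)]; simp [hs1.reg 6 (by decide), hI.sizes.len]
    simp only [wp_seq, wp_ite, wp_write, wp_assign, wp_skip, Expr.eval_read, Expr.eval_reg,
      Expr.eval_sub', Expr.eval_const, Expr.eval_add', hE, h17, e7', h6, h10, State.setArr_reg,
      State.setArr_arr, State.setReg_arr, State.setReg_reg]
    have hv0 : 0 ≤ s.arr 7 (a : ℕ) := (h.var a ha).1
    have hpos : I.extended a r ≠ 0 →
        (∀ L : ℕ, L < n → ((∃ v < a + 1, I.extended v r ≠ 0 ∧ s.arr 7 (v : ℕ) = L) →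
            Function.update (s2.arr 8) (s.arr 7 a) 1 (L : ℕ) = 1) ∧
          ((¬ ∃ v < a + 1, I.extended v r ≠ 0 ∧ s.arr 7 (v : ℕ) = L) →
            Function.update (s2.arr 8) (s.arr 7 a) 1 (L : ℕ) = 0)) := by
      intro hne L hL
      rw [Function.update_apply]
      by_cases hLa : (L : ℤ) = s.arr 7 a
      · refine ⟨fun _ => by rw [if_pos hLa], fun hcon => absurd ⟨a, by omega, hne, hLa.symm⟩ hcon⟩
      · rw [if_neg hLa]
        refine ⟨fun ⟨v, hv, h1, h2⟩ => (hmark L hL).1 ⟨v, ?_, h1, h2⟩, fun hcon =>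
          (hmark L hL).2 fun ⟨v, hv, h1, h2⟩ => hcon ⟨v, by omega, h1, h2⟩⟩
        have : v ≠ a := by rintro rfl; exact hLa h2.symm
        omega
    have hm1 : Function.update (s2.arr 8) (s.arr 7 a) 1 (-1) = 0 := by
      rw [Function.update_apply, if_neg (by omega), h8]
    have hptr : ((a * (n + m + 1) + r : ℕ) : ℤ) + ((n + m + 1 : ℕ) : ℤ) =
        (((a + 1) * (n + m + 1) + r : ℕ) : ℤ) := by push_cast; ring
    have hrep' : I.extended a r ≠ 0 →
        ∃ v < a + 1, I.extended v r ≠ 0 ∧ s.arr 7 (v : ℕ) = s.arr 7 a :=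
      fun hne => ⟨a, by omega, hne, rfl⟩
    refine ⟨fun hp => ?_, fun hp => ⟨fun hq => ?_, fun hq => ?_⟩⟩
    · have hne : I.extended a r ≠ 0 := by omega
      exact ⟨by simpa using hptr, by simpa using hm1, by simpa using hpos hne,
        Or.inl (by simpa using hrep' hne)⟩
    · have hne : I.extended a r ≠ 0 := by omega
      exact ⟨by simpa using hptr, by simpa using hm1, by simpa using hpos hne,
        Or.inl (by simpa using hrep' hne)⟩
    · have h0 : I.extended a r = 0 := by omega
      have hex : ∀ L : ℤ, (∃ v < a + 1, I.extended v r ≠ 0 ∧ s.arr 7 (v : ℕ) = L) ↔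
          ∃ v < a, I.extended v r ≠ 0 ∧ s.arr 7 (v : ℕ) = L := fun L => by
        constructor
        · rintro ⟨v, hv, h1, h2⟩
          have : v ≠ a := by rintro rfl; exact h1 h0
          exact ⟨v, by omega, h1, h2⟩
        · rintro ⟨v, hv, h1, h2⟩
          exact ⟨v, by omega, h1, h2⟩
      refine ⟨by simpa using hptr, by simpa using h8, fun L hL => ?_, ?_⟩
      · rw [hex]
        simpa using hmark L hL
      · rw [hex]
        refine hrep.imp (by simp) fun h' => ⟨by simpa using h'.1, fun v hv => ?_⟩
        by_cases hva : v = a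
        · rw [hva, h0]
        · exact h'.2 v (by omega)
  · rintro s2 hs2 ⟨-, h8, hmark, hrep⟩
    have e7' : s2.arr 7 = s.arr 7 := by
      rw [hs2.arr 7 (by decide), State.setReg_arr, State.setReg_arr, e7]
    refine ⟨h8, fun u hu => ?_, hrep.imp id fun h' => ⟨h'.1, ?_⟩⟩
    · rw [e7']
      have hlab : s.arr 7 (u : ℕ) = -1 ∨ 0 ≤ s.arr 7 (u : ℕ) ∧ s.arr 7 (u : ℕ) < n := by
        by_cases hun : u < n
        · exact Or.inr (h.var u hun)
        · have := h.row (u - n) (by omega)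
          rwa [Nat.add_sub_cancel' (by omega)] at this
      rcases hlab with h' | ⟨h', h''⟩
      · refine ⟨?_, fun _ => by rw [h', h8]⟩
        rintro ⟨v, hv, -, he⟩
        have := (h.var v hv).1
        dsimp only at he this
        omega
      · obtain ⟨L, hL⟩ := Int.eq_ofNat_of_zero_le h'
        rw [hL]
        exact hmark L (by omega)
    · rintro L ⟨v, hv, hne, -⟩
      exact hne (h'.2 v hv)

open Classical in
theorem touchedSize_spec (hI : Loaded I s) (hX : n + m ≤ X) (h : MarksTouched I r s) :
    wp X touchedSize (fun s' => s'.reg 16 = (((Finset.range (n + m)).filter fun u =>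
      IsTouched I.extended n (fun u => s.arr 7 u) r (s.arr 7 (u : ℕ))).card + 1 : ℕ)) s := by
  simp only [touchedSize, wp_seq, wp_assign, Expr.eval_const]
  refine wp_for (n + m) [16, 17] [] (by decide) (by decide) (by decide) (by decide)
    (by simp [hI.sizes.verts]) hX (fun a s' => s'.reg 16 = (((Finset.range a).filter fun u =>
      IsTouched I.extended n (fun u => s.arr 7 u) r (s.arr 7 (u : ℕ))).card + 1 : ℕ))
    (by simp) ?_ fun _ _ h => h
  rintro a ha s1 hs1 h17 h16
  simp only [wp_assign, Expr.eval_add', Expr.eval_reg, Expr.eval_read, h17, h16,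
    hs1.arr 7 (by decide), hs1.arr 8 (by decide), State.setReg_arr]
  rw [Finset.range_add_one, Finset.filter_insert]
  split_ifs with ht
  · rw [(h a ha).1 ht, Finset.card_insert_of_notMem (by simp)]
    simp
  · rw [(h a ha).2 ht]
    simp

theorem labelRow_spec (hI : Loaded I s) (hX : n + m ≤ X) {Z : Finset ℕ}
    (h : LabelState I l r s Z) (hr : r < m) (h14 : s.reg 14 = r) (h11 : s.reg 11 = l) :
    wp X labelRow (fun s' => ∃ Z, LabelState I l (r + 1) s' Z) s := by
  classical
  simp only [labelRow, wp_seq]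
  refine wp_conseq (touch_spec hI hX h.labelling hr h14 h.untouched) [10, 15, 17] [8] (by decide)
    (by decide) ?_
  rintro s1 ⟨h8, hmark, hrep⟩ hs1
  have hI1 : Loaded I s1 := hI.of_agree hs1 (by decide) (by decide)
  refine wp_conseq (touchedSize_spec hI1 hX hmark) [16, 17] [] (by decide) (by decide) ?_
  rintro s2 h16 hs2
  have e7 : s2.arr 7 = s.arr 7 := by rw [hs2.arr 7 (by decide), hs1.arr 7 (by decide)]
  have e8 : s2.arr 8 = s1.arr 8 := hs2.arr 8 (by decide)
  have h11' : s2.reg 11 = l := by rw [hs2.reg 11 (by decide), hs1.reg 11 (by decide), h11]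
  have h13' : s2.reg 13 = Z.card := by
    rw [hs2.reg 13 (by decide), hs1.reg 13 (by decide), h.card]
  have h15' : s2.reg 15 = s1.reg 15 := hs2.reg 15 (by decide)
  have h14' : s2.reg 14 = r := by rw [hs2.reg 14 (by decide), hs1.reg 14 (by decide), h14]
  rw [hs1.arr 7 (by decide)] at h16
  have hI2 : Loaded I s2 := hI1.of_agree hs2 (by decide) (by decide)
  simp only [wp_ite, wp_assign, Expr.eval_sub', Expr.eval_add', Expr.eval_reg, Expr.eval_const, h16,
    h11', h13']
  refine ⟨fun hsz => ⟨insert r Z, ?_, ?_, ?_, ?_⟩, fun hsz => ?_⟩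
  · simpa only [State.setReg_arr, e7] using h.labelling.step_global hr
  · rw [Finset.card_insert_of_notMem fun hrZ => lt_irrefl _ (h.labelling.lt r hrZ)]
    simp
  · intro ι k S comp hc hkl
    simpa only [State.setReg_arr, e7] using (h.tight ι k S comp hc hkl).step_global h.labelling hc
      hkl hr (by omega)
  · rw [State.setReg_arr, e8, h8]
  simp only [merge, wp_seq]
  refine wp_for (n + m) [17] [7] (by decide) (by decide) (by decide) (by decide)
    hI2.sizes.verts hX
    -- The labels are overwritten in place, but the invariant refers to the labels in `s`, from
    -- which the marks were computed: the vertices from `a` on still carry them.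
    (fun a s' => ∀ u < n + m,
      (u < a ∧ IsTouched I.extended n (fun u => s.arr 7 u) r (s.arr 7 (u : ℕ)) →
        s'.arr 7 (u : ℕ) = s1.reg 15) ∧
      (¬ (u < a ∧ IsTouched I.extended n (fun u => s.arr 7 u) r (s.arr 7 (u : ℕ))) →
        s'.arr 7 (u : ℕ) = s.arr 7 (u : ℕ))) (by simp [e7]) ?_ ?_
  · rintro a ha s3 hs3 h17 hlab
    have h7a := (hlab a ha).2 (by simp)
    have hm := hmark a ha
    rw [hs1.arr 7 (by decide)] at hm
    simp only [wp_ite, wp_write, wp_skip, Expr.eval_read, Expr.eval_reg, h17, h7a,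
      hs3.arr 8 (by decide), e8, hs3.reg 15 (by decide), h15', State.setReg_arr, State.setArr_arr,
      if_true]
    refine ⟨fun hpos u hu => ?_, fun hpos u hu => ?_⟩
    · have ht : IsTouched I.extended n (fun u => s.arr 7 u) r (s.arr 7 (a : ℕ)) := by
        by_contra hnt
        rw [hm.2 hnt] at hpos
        exact lt_irrefl _ hpos
      rw [Function.update_apply]
      by_cases hua : u = a
      · subst hua
        simp [ht]
      · rw [if_neg (by exact_mod_cast hua)]
        have : u < a + 1 ↔ u < a := by omega
        rw [this]
        exact hlab u hu
    · have hnt : ¬ IsTouched I.extended n (fun u => s.arr 7 u) r (s.arr 7 (a : ℕ)) := by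
        intro ht
        rw [hm.1 ht] at hpos
        exact hpos one_pos
      by_cases hua : u = a
      · subst hua
        simp [hnt, h7a]
      · have : u < a + 1 ↔ u < a := by omega
        rw [this]
        exact hlab u hu
  · rintro s3 hs3 hlab
    have e15 : s3.reg 15 = s1.reg 15 := by rw [hs3.reg 15 (by decide), h15']
    simp only [wp_write, Expr.eval_add', Expr.eval_reg, hs3.reg 4 (by decide),
      hs3.reg 14 (by decide), h14', hI2.sizes.vars, e15]
    have e : (n : ℤ) + (r : ℤ) = ((n + r : ℕ) : ℤ) := by push_cast; ring
    have g1 : ∀ u < n + m, u ≠ n + r →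
        IsTouched I.extended n (fun u => s.arr 7 u) r (s.arr 7 (u : ℕ)) →
        Function.update (s3.arr 7) ((n : ℤ) + r) (s1.reg 15) (u : ℕ) = s1.reg 15 :=
      fun u hu hur ht => by
        rw [e, Function.update_apply, if_neg (by exact_mod_cast hur)]
        exact (hlab u hu).1 ⟨hu, ht⟩
    have g2 : ∀ u < n + m, u ≠ n + r →
        ¬ IsTouched I.extended n (fun u => s.arr 7 u) r (s.arr 7 (u : ℕ)) →
        Function.update (s3.arr 7) ((n : ℤ) + r) (s1.reg 15) (u : ℕ) = s.arr 7 (u : ℕ) :=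
      fun u hu hur ht => by
        rw [e, Function.update_apply, if_neg (by exact_mod_cast hur)]
        exact (hlab u hu).2 fun h' => ht h'.2
    have g3 : Function.update (s3.arr 7) ((n : ℤ) + r) (s1.reg 15) ((n + r : ℕ) : ℤ) =
        s1.reg 15 := by rw [e]; simp
    refine ⟨Z, ?_, ?_, fun ι k S comp hc hkl => ?_, ?_⟩
    · simp only [State.setArr_arr, if_true]
      exact h.labelling.step_merge hr (by omega) hrep g1 g2 g3
    · rw [State.setArr_reg, hs3.reg 13 (by decide), h13']
    · simp only [State.setArr_arr, if_true]
      exact (h.tight ι k S comp hc hkl).step_merge h.labelling hc hr hrep g1 g2 g3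
    · rw [State.setArr_arr, if_neg (by decide), hs3.arr 8 (by decide), e8, h8]

theorem label_spec (hI : Loaded I s) (hX : n + m ≤ X) (hl : 1 ≤ l) (h8 : s.arr 8 (-1) = 0)
    (h11 : s.reg 11 = l) : wp X label (fun s' => ∃ Z, LabelState I l m s' Z) s := by
  simp only [label, wp_seq]
  refine wp_conseq (initLabels_spec hI hX hl h8) [13, 17] [7] (by decide) (by decide) ?_
  rintro s1 h1 hs1
  refine wp_for m [10, 13, 14, 15, 16, 17] [7, 8] (by decide) (by decide) (by decide) (by decide)
    (by rw [hs1.reg 5 (by decide), hI.sizes.rows]) (by omega)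
    (fun a s' => ∃ Z, LabelState I l a s' Z) ⟨∅, ?_⟩ ?_ fun s' _ h' => h'
  · obtain ⟨a1, a2, a3, a4⟩ := h1
    exact ⟨by simpa using a1, by simpa using a2, by simpa using a3, by simpa using a4⟩
  · rintro a ha s2 hs2 h14 ⟨Z, hZ⟩
    have hI2 : Loaded I s2 :=
      (hI.of_agree hs1 (by decide) (by decide)).of_agree hs2 (by decide) (by decide)
    refine wp_conseq (labelRow_spec hI2 hX hZ ha h14
      (by rw [hs2.reg 11 (by decide), hs1.reg 11 (by decide), h11])) [10, 13, 15, 16, 17] [7, 8]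
      (by decide) (by decide) ?_
    rintro s3 ⟨Z', a1, a2, a3, a4⟩ hs3
    exact ⟨Z', by simpa using a1, by simpa using a2, by simpa using a3, by simpa using a4⟩

theorem search_spec (hI : Loaded I s) (hX : n + m ≤ X) (h8 : s.arr 8 (-1) = 0) {ι : Type} {k : ℕ}
    {S : Finset ℕ} {comp : ℕ → ι} (hc : IsComponents I.extended n m k S comp) (hk : k < X) :
    wp X search (fun s' => ∃ l Z, s'.reg 11 = (l : ℕ) ∧ s'.reg 13 = (Z.card : ℕ) ∧ l ≤ k + 1 ∧
      Z.card ≤ 4 ^ l ∧ IsLabelling I.extended n m l m (fun u => s'.arr 7 u) Z) s := by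
  simp only [search, wp_seq, wp_assign, Expr.eval_const]
  refine wp_loop [10, 11, 12, 13, 14, 15, 16, 17] [7, 8] (by decide) (by decide)
    (fun a s' => s'.reg 11 = a ∧ s'.reg 12 = 4 ^ a ∧ a ≤ k + 1 ∧ s'.arr 8 (-1) = 0 ∧
      ((a = 0 ∧ s'.reg 13 = 2) ∨ ∃ Z, LabelState I a m s' Z)) ?_ ?_ ?_
  · simp [h8]
  · rintro a s1 hs1 ⟨h11, h12, hak, h8, hor⟩ hpos
    simp only [Expr.eval_sub', Expr.eval_reg, h12] at hpos
    -- In the round `k + 1` the number of global constraints is at most the threshold, so the loop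
    -- test fails.
    have hak' : a ≤ k := by
      by_contra hcon
      have : a = k + 1 := by omega
      subst this
      rcases hor with h' | ⟨Z, hZ⟩
      · omega
      · have h1 := (hZ.tight ι k S comp hc (by omega)).card_le_four_pow hZ.labelling hc
        rw [hZ.card] at hpos
        have h2 : (Z.card : ℤ) ≤ 4 ^ (k + 1) := by exact_mod_cast h1
        linarith
    refine ⟨by omega, ?_⟩
    simp only [wp_seq, wp_assign, Expr.eval_add', Expr.eval_reg, Expr.eval_const, h11]
    have hI1 : Loaded I s1 := hI.of_agree ((((agree_setReg (by decide)).trans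
      (agree_setReg (by decide))).trans (agree_setReg (by decide))).trans hs1)
      (by decide) (by decide)
    refine wp_conseq (label_spec (l := a + 1) (hI1.of_agree (R := [11, 12]) (A := [])
      ((agree_setReg (by decide)).trans (agree_setReg (by decide))) (by decide) (by decide)) hX (by omega)
      (by simpa using h8) (by simp)) [10, 13, 14, 15, 16, 17] [7, 8] (by decide) (by decide) ?_
    rintro s2 ⟨Z, hZ⟩ hs2
    refine ⟨by rw [hs2.reg 11 (by decide)]; simp, ?_, by omega, hZ.untouched, Or.inr ⟨Z, hZ⟩⟩
    rw [hs2.reg 12 (by decide)]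
    simp only [State.setReg_reg, if_true]
    norm_num [pow_succ, h12]
    ring
  · rintro a s1 hs1 ⟨h11, h12, hak, h8, hor⟩ hpos
    simp only [Expr.eval_sub', Expr.eval_reg, h12] at hpos
    rcases hor with ⟨rfl, h13⟩ | ⟨Z, hZ⟩
    · rw [h13] at hpos; norm_num at hpos
    · refine ⟨a, Z, h11, hZ.card, hak, ?_, hZ.labelling⟩
      rw [hZ.card] at hpos
      have : (Z.card : ℤ) ≤ ((4 ^ a : ℕ) : ℤ) := by push_cast; linarith
      exact_mod_cast this

/-- A value is squared by adding it to `0` as many times as it says. The inner loops therefore run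
at most as often as the final value indicates, which is why that value must be at most `X`. -/
theorem computeBound_spec {N z : ℕ} (hN : 2 ≤ N) (h0 : s.reg 0 = N) (h11 : s.reg 11 = l)
    (h13 : s.reg 13 = z) (hX : ILP.variableBound N (l + z) ≤ X) (hX' : 6 + 4 * (l + z) ≤ X) :
    wp X computeBound (fun s' => s'.reg 18 = ILP.variableBound N (l + z)) s := by
  simp only [computeBound, wp_seq, wp_assign, Expr.eval_add', Expr.eval_reg, Expr.eval_const]
  refine wp_for (6 + 4 * (l + z)) [18, 20, 21, 22] [] (by decide) (by decide) (by decide)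
    (by decide) (by simp [h11, h13]; ring) hX'
    (fun a s' => s'.reg 18 = ((N ^ 2 ^ a : ℕ) : ℤ)) (by simp [h0]) ?_ fun s' _ h' => h'
  rintro a ha s1 hs1 h20 h18
  simp only [wp_seq, wp_assign, Expr.eval_reg, Expr.eval_const]
  refine wp_for (N ^ 2 ^ a) [21, 22] [] (by decide) (by decide) (by decide)
    (by decide) (by simp [h18]) (le_trans (Nat.pow_le_pow_right (by omega)
      (Nat.pow_le_pow_right (by omega) ha.le)) hX)
    (fun b s' => s'.reg 21 = ((b * N ^ 2 ^ a : ℕ) : ℤ)) (by simp) ?_ ?_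
  · rintro b hb s2 hs2 h22 h21
    simp only [wp_assign, Expr.eval_add', Expr.eval_reg, h21, hs2.reg 18 (by decide)]
    simp [h18]
    ring
  · rintro s2 hs2 h21
    simp only [h21]
    simp [pow_succ, pow_mul]

end

end RAM

/-! ### Dynamic programming over tables of records -/

namespace DP

/-- The combination of the first `n` columns of `E` with coefficients `x`. -/
def combine (E : ℕ → ℕ → ℤ) (n : ℕ) (x : ℕ → ℤ) (i : ℕ) : ℤ := ∑ j ∈ Finset.range n, x j * E j i

/-- All variables of the constraint `c` have been processed. -/
def IsClosed (E : ℕ → ℕ → ℤ) (n : ℕ) (D : ℕ → Prop) (c : ℕ) : Prop := ∀ j < n, ¬ D j → E j c = 0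

/-- A partial assignment to the processed variables, given by the predicate `D`, that respects the
bounds, described by `ok`, and satisfies all constraints whose variables have been processed. -/
structure IsPartial (E : ℕ → ℕ → ℤ) (n m B : ℕ) (b : ℕ → ℤ) (ok : ℕ → ℤ → Prop) (D : ℕ → Prop)
    (x : ℕ → ℤ) : Prop where
  bound : ∀ j < n, D j → |x j| ≤ B ∧ ok j (x j)
  zero : ∀ j < n, ¬ D j → x j = 0
  closed : ∀ c < m, IsClosed E n D c → combine E n x c = b c

/-- The `cnt` records `get 0, get 1, …` of length `w` represent the set `K` of vectors: they belong to
`K` and have distinct keys, consisting of the first `m` entries, and for every vector in `K` there is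
a record with the same key that is at least as good. -/
structure Represents (m w : ℕ) (get : ℕ → ℕ → ℤ) (cnt : ℕ) (K : Set (ℕ → ℤ)) : Prop where
  sound : ∀ r < cnt, ∃ v ∈ K, ∀ i < w, get r i = v i
  complete : ∀ v ∈ K, ∃ r < cnt, (∀ c < m, get r c = v c) ∧ v m ≤ get r m
  distinct : ∀ r < cnt, ∀ r' < cnt, (∀ c < m, get r c = get r' c) → r = r'

/-! ### Insertion of a vector into a table that keeps a best record for each key. -/

section

variable {m w cnt : ℕ} {get get' : ℕ → ℕ → ℤ} {K : Set (ℕ → ℤ)} {v : ℕ → ℤ}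

theorem represents_empty : Represents m w get 0 ∅ := ⟨by simp, by simp, by simp⟩

theorem Represents.congr (h : Represents m w get cnt K) (hm : m < w)
    (hg : ∀ r < cnt, ∀ i < w, get' r i = get r i) : Represents m w get' cnt K := by
  refine ⟨fun r hr => ?_, fun v hv => ?_, fun r hr r' hr' he => ?_⟩
  · obtain ⟨v, hv, h1⟩ := h.sound r hr
    exact ⟨v, hv, fun i hi => by rw [hg r hr i hi, h1 i hi]⟩
  · obtain ⟨r, hr, h1, h2⟩ := h.complete v hv
    exact ⟨r, hr, fun c hc => by rw [hg r hr c (by omega), h1 c hc], by rwa [hg r hr m hm]⟩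
  · refine h.distinct r hr r' hr' fun c hc => ?_
    rw [← hg r hr c (by omega), ← hg r' hr' c (by omega), he c hc]

theorem Represents.insert_new (h : Represents m w get cnt K) (hm : m < w)
    (hne : ∀ r < cnt, ¬ ∀ c < m, get r c = v c) (h1 : ∀ r < cnt, ∀ i < w, get' r i = get r i)
    (h2 : ∀ i < w, get' cnt i = v i) : Represents m w get' (cnt + 1) (insert v K) := by
  refine ⟨fun r hr => ?_, fun u hu => ?_, fun r hr r' hr' he => ?_⟩
  · by_cases hrc : r = cnt
    · subst hrc
      exact ⟨v, Set.mem_insert _ _, h2⟩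
    · obtain ⟨u, hu, h3⟩ := h.sound r (by omega)
      exact ⟨u, Set.mem_insert_of_mem _ hu, fun i hi => by rw [h1 r (by omega) i hi, h3 i hi]⟩
  · rcases Set.mem_insert_iff.1 hu with rfl | hu
    · exact ⟨cnt, by omega, fun c hc => h2 c (by omega), (h2 m hm).ge⟩
    · obtain ⟨r, hr, h3, h4⟩ := h.complete u hu
      exact ⟨r, by omega, fun c hc => by rw [h1 r hr c (by omega), h3 c hc], by rwa [h1 r hr m hm]⟩
  · by_cases hrc : r = cnt <;> by_cases hrc' : r' = cnt
    · omega
    · subst hrc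
      refine absurd (fun c hc => ?_) (hne r' (by omega))
      rw [← h1 r' (by omega) c (by omega), ← he c hc, h2 c (by omega)]
    · subst hrc'
      refine absurd (fun c hc => ?_) (hne r (by omega))
      rw [← h1 r (by omega) c (by omega), he c hc, h2 c (by omega)]
    · refine h.distinct r (by omega) r' (by omega) fun c hc => ?_
      rw [← h1 r (by omega) c (by omega), ← h1 r' (by omega) c (by omega), he c hc]

theorem Represents.insert_skip (h : Represents m w get cnt K) {r : ℕ} (hr : r < cnt)
    (hkey : ∀ c < m, get r c = v c) (hle : v m ≤ get r m) :
    Represents m w get cnt (insert v K) := by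
  refine ⟨fun r hr => ?_, fun u hu => ?_, h.distinct⟩
  · obtain ⟨u, hu, h1⟩ := h.sound r hr
    exact ⟨u, Set.mem_insert_of_mem _ hu, h1⟩
  · rcases Set.mem_insert_iff.1 hu with rfl | hu
    · exact ⟨r, hr, hkey, hle⟩
    · exact h.complete u hu

theorem Represents.insert_replace (h : Represents m w get cnt K) (hm : m < w) {r : ℕ} (hr : r < cnt)
    (hkey : ∀ c < m, get r c = v c) (hle : get r m ≤ v m)
    (h1 : ∀ r' < cnt, r' ≠ r → ∀ i < w, get' r' i = get r' i) (h2 : ∀ i < w, get' r i = v i) :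
    Represents m w get' cnt (insert v K) := by
  have hk : ∀ r' < cnt, ∀ c < m, get' r' c = get r' c := fun r' hr' c hc => by
    by_cases hrr : r' = r
    · subst hrr; rw [h2 c (by omega), hkey c hc]
    · exact h1 r' hr' hrr c (by omega)
  have hmm : ∀ r' < cnt, get r' m ≤ get' r' m := fun r' hr' => by
    by_cases hrr : r' = r
    · subst hrr; rwa [h2 m hm]
    · exact (h1 r' hr' hrr m hm).ge
  refine ⟨fun r' hr' => ?_, fun u hu => ?_, fun r' hr' r'' hr'' he => ?_⟩
  · by_cases hrr : r' = r
    · subst hrr; exact ⟨v, Set.mem_insert _ _, h2⟩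
    · obtain ⟨u, hu, h3⟩ := h.sound r' hr'
      exact ⟨u, Set.mem_insert_of_mem _ hu, fun i hi => by rw [h1 r' hr' hrr i hi, h3 i hi]⟩
  · rcases Set.mem_insert_iff.1 hu with rfl | hu
    · exact ⟨r, hr, fun c hc => by rw [hk r hr c hc, hkey c hc], (h2 m hm).ge⟩
    · obtain ⟨r', hr', h3, h4⟩ := h.complete u hu
      exact ⟨r', hr', fun c hc => by rw [hk r' hr' c hc, h3 c hc], h4.trans (hmm r' hr')⟩
  · refine h.distinct r' hr' r'' hr'' fun c hc => ?_
    rw [← hk r' hr' c hc, ← hk r'' hr'' c hc, he c hc]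

end

/-! ### Extension by one variable, and the number of records. -/

section

variable {E : ℕ → ℕ → ℤ} {n m w B : ℕ} {b : ℕ → ℤ} {ok : ℕ → ℤ → Prop} {D D' : ℕ → Prop}
  {x : ℕ → ℤ} {j : ℕ}

theorem combine_update (hj : j < n) (hx : x j = 0) (a : ℤ) (i : ℕ) :
    combine E n (Function.update x j a) i = combine E n x i + a * E j i := by
  have hj' := Finset.mem_range.2 hj
  rw [combine, combine, ← Finset.add_sum_erase _ _ hj', ← Finset.add_sum_erase _ _ hj']
  rw [Finset.sum_congr rfl fun i' hi' => (show Function.update x j a i' * E i' i = x i' * E i' i by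
    rw [Function.update_of_ne (Finset.ne_of_mem_erase hi')])]
  simp [hx]
  ring

theorem IsPartial.extend (h : IsPartial E n m B b ok D x) (hj : j < n) (hDj : ¬ D j)
    (hD : ∀ i < n, D' i ↔ D i ∨ i = j) {a : ℤ} (ha : |a| ≤ B) (hok : ok j a)
    (hcl : ∀ c < m, IsClosed E n D' c → combine E n x c + a * E j c = b c) :
    IsPartial E n m B b ok D' (Function.update x j a) := by
  refine ⟨fun i hi hDi => ?_, fun i hi hDi => ?_, fun c hc hcc => ?_⟩
  · by_cases hij : i = j
    · subst hij; simp [ha, hok]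
    · rw [Function.update_of_ne hij]
      exact h.bound i hi (((hD i hi).1 hDi).resolve_right hij)
  · rw [hD i hi, not_or] at hDi
    rw [Function.update_of_ne hDi.2]
    exact h.zero i hi hDi.1
  · rw [combine_update hj (h.zero j hj hDj)]
    exact hcl c hc hcc

/-- A constraint that is closed before `j` is processed has coefficient zero at `j`, so resetting
this variable to `0` does not affect it. -/
theorem IsPartial.restrict (h : IsPartial E n m B b ok D' x) (hj : j < n) (hDj : ¬ D j)
    (hD : ∀ i < n, D' i ↔ D i ∨ i = j) :
    IsPartial E n m B b ok D (Function.update x j 0) ∧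
      ∀ i, combine E n x i = combine E n (Function.update x j 0) i + x j * E j i := by
  have key : ∀ i, combine E n x i = combine E n (Function.update x j 0) i + x j * E j i :=
    fun i => by
    have := combine_update (E := E) (x := Function.update x j 0) hj (by simp) (x j) i
    rwa [Function.update_idem, Function.update_eq_self] at this
  refine ⟨⟨fun i hi hDi => ?_, fun i hi hDi => ?_, fun c hc hcc => ?_⟩, key⟩
  · have hij : i ≠ j := by rintro rfl; exact hDj hDi
    rw [Function.update_of_ne hij]
    exact h.bound i hi ((hD i hi).2 (Or.inl hDi))
  · by_cases hij : i = j
    · subst hij; simp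
    · rw [Function.update_of_ne hij]
      exact h.zero i hi fun hh => hDi (((hD i hi).1 hh).resolve_right hij)
  · have h1 := h.closed c hc fun i hi hDi => hcc i hi fun hh => hDi ((hD i hi).2 (Or.inl hh))
    rw [key, hcc j hj hDj] at h1
    simpa using h1

/-- The vectors of partial assignments. -/
def partials (E : ℕ → ℕ → ℤ) (n m B : ℕ) (b : ℕ → ℤ) (ok : ℕ → ℤ → Prop) (D : ℕ → Prop) :
    Set (ℕ → ℤ) := combine E n '' {x | IsPartial E n m B b ok D x}

/-- The admissible extensions of the records by a value of the variable `j`, where the values are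
restricted by `A`. -/
def extensions (E : ℕ → ℕ → ℤ) (n m B : ℕ) (b : ℕ → ℤ) (ok : ℕ → ℤ → Prop) (D : ℕ → Prop)
    (j : ℕ) (get : ℕ → ℕ → ℤ) (A : ℕ → ℤ → Prop) : Set (ℕ → ℤ) :=
  {v | ∃ r a, A r a ∧ |a| ≤ B ∧ ok j a ∧ v = (fun i => get r i + a * E j i) ∧
    ∀ c < m, IsClosed E n D c → v c = b c}

theorem Represents.exists_partial {get : ℕ → ℕ → ℤ} {cnt : ℕ} (hm : m < w)
    (h : Represents m w get cnt (partials E n m B b ok D)) (hj : j < n) (hDj : ¬ D j)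
    (hD : ∀ i < n, D' i ↔ D i ∨ i = j) {A : ℕ → ℤ → Prop} (hA : ∀ r a, A r a → r < cnt)
    {v : ℕ → ℤ} (hv : v ∈ extensions E n m B b ok D' j get A) :
    ∃ x, IsPartial E n m B b ok D' x ∧ ∀ i < w, v i = combine E n x i := by
  obtain ⟨r, a, hAr, ha, hok, rfl, hcl⟩ := hv
  obtain ⟨_, ⟨x, hx, rfl⟩, hg⟩ := h.sound r (hA r a hAr)
  refine ⟨_, IsPartial.extend hx hj hDj hD ha hok fun c hc hcc => ?_, fun i hi => ?_⟩
  · rw [← hg c (by omega)]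
    exact hcl c hc hcc
  · rw [combine_update hj (hx.zero j hj hDj), ← hg i hi]

/-- The principle of optimality: let a record have the same key as the restriction of `x`, and an
objective at least as large. Extended by the value `x j`, it has the same key as `x`, hence passes
the same tests, and is still at least as good. -/
theorem Represents.extend {get get' : ℕ → ℕ → ℤ} {cnt cnt' : ℕ} (hm : m < w)
    (h : Represents m w get cnt (partials E n m B b ok D)) (hj : j < n) (hDj : ¬ D j)
    (hD : ∀ i < n, D' i ↔ D i ∨ i = j)
    (h' : Represents m w get' cnt' (extensions E n m B b ok D' j get fun r _ => r < cnt)) :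
    Represents m w get' cnt' (partials E n m B b ok D') := by
  refine ⟨fun r hr => ?_, fun v hv => ?_, h'.distinct⟩
  · obtain ⟨v, hv, hg⟩ := h'.sound r hr
    obtain ⟨x, hx, hvx⟩ := h.exists_partial hm hj hDj hD (fun _ _ h => h) hv
    exact ⟨_, ⟨x, hx, rfl⟩, fun i hi => by rw [hg i hi, hvx i hi]⟩
  · obtain ⟨x, hx, rfl⟩ := hv
    obtain ⟨hy, hxy⟩ := IsPartial.restrict hx hj hDj hD
    obtain ⟨r, hr, hk, ho⟩ := h.complete _ ⟨_, hy, rfl⟩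
    have hkx : ∀ c < m, get r c + x j * E j c = combine E n x c := fun c hc => by
      rw [hk c hc, hxy c]
    obtain ⟨ha, hok⟩ := hx.bound j hj ((hD j hj).2 (Or.inr rfl))
    obtain ⟨r', hr', hk', ho'⟩ := h'.complete (fun i => get r i + x j * E j i)
      ⟨r, x j, hr, ha, hok, rfl, fun c hc hcc => (hkx c hc).trans (hx.closed c hc hcc)⟩
    refine ⟨r', hr', fun c hc => (hk' c hc).trans (hkx c hc), le_trans ?_ ho'⟩
    rw [hxy m]
    exact add_le_add_left ho _

theorem represents_init {get : ℕ → ℕ → ℤ} {cnt : ℕ} (hD : ∀ i < n, ¬ D i)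
    (h : Represents m w get cnt {v | v = (fun _ => 0) ∧ ∀ c < m, IsClosed E n D c → v c = b c}) :
    Represents m w get cnt (partials E n m B b ok D) := by
  convert h using 1
  ext v
  constructor
  · rintro ⟨x, hx, rfl⟩
    have h0 : combine E n x = fun _ => 0 := by
      funext i
      exact Finset.sum_eq_zero fun j hj => by
        rw [hx.zero j (Finset.mem_range.1 hj) (hD j (Finset.mem_range.1 hj)), zero_mul]
    exact ⟨h0, hx.closed⟩
  · rintro ⟨rfl, h'⟩
    have h0 : combine E n (fun _ => 0) = fun _ => 0 := by
      funext i; simp [combine]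
    exact ⟨fun _ => 0, ⟨fun i hi hDi => absurd hDi (hD i hi), fun _ _ _ => rfl,
      fun c hc hcc => by rw [h0]; exact h' c hc hcc⟩, h0⟩

/-- The index `0` is a placeholder: the lemma is applied to `fun j _ => E j c` for a single
constraint `c`. -/
theorem abs_combine_le {N : ℕ} (hE : ∀ j < n, |E j 0| ≤ N) (hx : ∀ j < n, |x j| ≤ B) :
    |combine E n x 0| ≤ ((n * (N * B) : ℕ) : ℤ) := by
  have := ZeroSum.abs_sum_le (f := fun j => x j * E j 0) (s := Finset.range n) (W := B * N)
    fun j hj => by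
      rw [abs_mul]
      exact mul_le_mul (hx j (Finset.mem_range.1 hj)) (hE j (Finset.mem_range.1 hj)) (abs_nonneg _)
        (by positivity)
  rw [Finset.card_range] at this
  refine this.trans (le_of_eq ?_)
  push_cast
  ring

/-- The number of records after the variables with label less than `L` and some variables with label
`L` have been processed. -/
theorem Represents.card_le {l N : ℕ} {lab : ℕ → ℤ} {Z : Finset ℕ}
    (hl : IsLabelling E n m l m lab Z) (hE : ∀ j < n, ∀ c < m, |E j c| ≤ N) {get : ℕ → ℕ → ℤ}
    {cnt : ℕ} {K : Set (ℕ → ℤ)} (h : Represents m w get cnt K) (hm : m < w) {L : ℤ} (hL : 0 ≤ L)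
    (hlt : ∀ j < n, lab j < L → D j) (hgt : ∀ j < n, L < lab j → ¬ D j)
    (hK : ∀ v ∈ K, ∃ x, IsPartial E n m B b ok D x ∧ ∀ i < w, v i = combine E n x i) :
    cnt ≤ (2 * (n * (N * B)) + 1) ^ Z.card * (2 * B + 1) ^ l := by
  classical
  have hx : ∀ r : ℕ, ∃ x, r < cnt → IsPartial E n m B b ok D x ∧ ∀ i < w, get r i = combine E n x i := by
    intro r
    by_cases hr : r < cnt
    · obtain ⟨v, hv, h1⟩ := h.sound r hr
      obtain ⟨x, hx, h2⟩ := hK v hv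
      exact ⟨x, fun _ => ⟨hx, fun i hi => by rw [h1 i hi, h2 i hi]⟩⟩
    · exact ⟨fun _ => 0, fun h => absurd h hr⟩
  choose x hx using hx
  set W := (Finset.range (n + m)).filter fun u => lab u = L with hW
  have hbox : ∀ r < cnt, ∀ j < n, |x r j| ≤ B := fun r hr j hj => by
    by_cases hDj : D j
    · exact ((hx r hr).1.bound j hj hDj).1
    · rw [(hx r hr).1.zero j hj hDj]; simp
  set S := n * (N * B) with hS
  let P := (Fintype.piFinset fun _ : Z => Finset.Icc (-(S : ℤ)) S) ×ˢ
    (Fintype.piFinset fun _ : W => Finset.Icc (-(B : ℤ)) B)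
  have hP : P.card = (2 * S + 1) ^ Z.card * (2 * B + 1) ^ W.card := by
    simp only [P, Finset.card_product, Fintype.card_piFinset, Int.card_Icc, Finset.prod_const,
      Finset.card_univ, Fintype.card_coe]
    congr 2 <;> omega
  have hcard : (Finset.range cnt).card ≤ P.card := by
    -- A record is encoded by its sums in the global constraints and by the values of the variables
    -- labelled `L`. The set `W` may also contain constraints; these receive the value `0`.
    refine Finset.card_le_card_of_injOn
      (fun r => (fun c : Z => combine E n (x r) c,
        fun v : W => if (v : ℕ) < n then x r (v : ℕ) else 0)) ?_ ?_
    · intro r hr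
      have hr' : r < cnt := Finset.mem_range.1 hr
      simp only [P, Finset.coe_product, Set.mem_prod, Finset.mem_coe, Fintype.mem_piFinset,
        Finset.mem_Icc, ← abs_le]
      refine ⟨fun c => ?_, fun v => ?_⟩
      · exact abs_combine_le (E := fun j _ => E j c) (fun j hj => hE j hj c (hl.lt c c.2))
          (hbox r hr')
      · split_ifs with hv
        · exact hbox r hr' v hv
        · simp
    · intro r hr r' hr' he
      have hr : r < cnt := Finset.mem_range.1 hr
      have hr' : r' < cnt := Finset.mem_range.1 hr'
      simp only [Prod.mk.injEq] at he
      obtain ⟨he1, he2⟩ := he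
      refine h.distinct r hr r' hr' fun c hc => ?_
      rw [(hx r hr).2 c (by omega), (hx r' hr').2 c (by omega)]
      by_cases hcZ : c ∈ Z
      · exact congrFun he1 ⟨c, hcZ⟩
      -- A constraint of an earlier class, or one with label `-1`, is closed, so its sum is forced.
      -- Otherwise all its variables share its label: those labelled `L` are part of the code, and
      -- those with a larger label still have the value `0`.
      by_cases hcL : lab (n + c) < L
      · have hcc : IsClosed E n D c := fun j hj hDj => by
          by_contra hne
          exact hDj (hlt j hj (by rwa [hl.eq c hc hcZ j hj hne]))
        rw [(hx r hr).1.closed c hc hcc, (hx r' hr').1.closed c hc hcc]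
      · refine Finset.sum_congr rfl fun j hj => ?_
        have hj := Finset.mem_range.1 hj
        by_cases hne : E j c = 0
        · simp [hne]
        · congr 1
          have hlab := hl.eq c hc hcZ j hj hne
          by_cases hjL : lab j = L
          · have hjW : j ∈ W := Finset.mem_filter.2 ⟨Finset.mem_range.2 (by omega), hjL⟩
            have := congrFun he2 ⟨j, hjW⟩
            simpa [hj] using this
          · have hDj := hgt j hj (by omega)
            rw [(hx r hr).1.zero j hj hDj, (hx r' hr').1.zero j hj hDj]
  rw [Finset.card_range, hP] at hcard
  exact hcard.trans (Nat.mul_le_mul_left _ (Nat.pow_le_pow_right (by omega) (hl.size L hL)))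

end

end DP

/-- The right-hand side as a function on the natural numbers. -/
def ILP.rhsAt {n m : ℕ} (I : ILP (Fin n) (Fin m)) (c : ℕ) : ℤ :=
  if h : c < m then I.rhs ⟨c, h⟩ else 0

/-- The value `a` respects the bounds of the variable `j`. -/
def ILP.InBounds {n m : ℕ} (I : ILP (Fin n) (Fin m)) (j : ℕ) (a : ℤ) : Prop :=
  ∀ h : j < n, I.lower ⟨j, h⟩ ≤ ExtInt.ofInt a ∧ ExtInt.ofInt a ≤ I.upper ⟨j, h⟩

namespace RAM

open Program

section

variable {n m : ℕ} {I : ILP (Fin n) (Fin m)} {X B : ℕ} {s : State} {D : ℕ → Prop}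

/-! ### The table -/

/-- The array `f` holds the characteristic function of `D`. -/
def Marks (N : ℕ) (D : ℕ → Prop) (f : ℤ → ℤ) : Prop :=
  ∀ j < N, (D j → f (j : ℕ) = 1) ∧ (¬ D j → f (j : ℕ) = 0)

theorem openRows_spec (hI : Loaded I s) (hX : n + m ≤ X) (hD : Marks n D (s.arr 11)) :
    wp X openRows (fun s' => Marks m (fun c => ¬ DP.IsClosed I.extended n D c) (s'.arr 12)) s := by
  refine wp_for m [38, 39, 40] [12] (by decide) (by decide) (by decide) (by decide)
    hI.sizes.rows (by omega)
    (fun a s' => Marks a (fun c => ¬ DP.IsClosed I.extended n D c) (s'.arr 12))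
    (fun c hc => by omega) ?_ fun s' _ h => h
  rintro a ha s1 hs1 h38 hM
  simp only [wp_seq, wp_write, wp_assign, Expr.eval_reg, Expr.eval_const, h38]
  refine wp_for n [39, 40] [12] (by decide) (by decide) (by decide) (by decide)
    (by simp [hs1.reg 4 (by decide), hI.sizes.vars]) (by omega)
    (fun b s' => s'.reg 40 = ((b * (n + m + 1) + a : ℕ) : ℤ) ∧
      (∀ c : ℕ, c ≠ a → s'.arr 12 (c : ℕ) = s1.arr 12 (c : ℕ)) ∧
      ((∃ j < b, ¬ D j ∧ I.extended j a ≠ 0) → s'.arr 12 (a : ℕ) = 1) ∧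
      ((¬ ∃ j < b, ¬ D j ∧ I.extended j a ≠ 0) → s'.arr 12 (a : ℕ) = 0)) ?_ ?_ ?_
  · refine ⟨by simp [h38], fun c hc => ?_, ?_, fun _ => by simp⟩
    · simp only [State.setReg_arr, State.setArr_arr, if_true, Function.update_apply]
      rw [if_neg (by exact_mod_cast hc)]
    · rintro ⟨j, hj, -⟩; omega
  · rintro b hb s2 hs2 h39 ⟨h40, hoth, hex, hnex⟩
    have hE : s2.arr 1 ((b * (n + m + 1) + a : ℕ) : ℤ) = I.extended b a := by
      rw [hs2.arr 1 (by decide)]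
      simp only [State.setReg_arr, State.setArr_arr]
      rw [if_neg (by decide), hs1.arr 1 (by decide), hI.cols b hb a (by omega)]
    have h11 : s2.arr 11 = s.arr 11 := by
      rw [hs2.arr 11 (by decide)]
      simp [hs1.arr 11 (by decide)]
    have h6 : s2.reg 6 = ((n + m + 1 : ℕ) : ℤ) := by
      rw [hs2.reg 6 (by decide)]; simp [hs1.reg 6 (by decide), hI.sizes.len]
    have h38' : s2.reg 38 = a := by
      rw [hs2.reg 38 (by decide)]; simp [h38]
    have hptr : ((b * (n + m + 1) + a : ℕ) : ℤ) + ((n + m + 1 : ℕ) : ℤ) =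
        (((b + 1) * (n + m + 1) + a : ℕ) : ℤ) := by push_cast; ring
    have hsame : ¬ (¬ D b ∧ I.extended b a ≠ 0) → ((∃ j < b + 1, ¬ D j ∧ I.extended j a ≠ 0) ↔
        ∃ j < b, ¬ D j ∧ I.extended j a ≠ 0) := by
      intro hb
      constructor
      · rintro ⟨j, hj, h'⟩
        have : j ≠ b := by rintro rfl; exact hb h'
        exact ⟨j, by omega, h'⟩
      · rintro ⟨j, hj, h'⟩
        exact ⟨j, by omega, h'⟩
    have hoth' : ∀ c : ℕ, c ≠ a → Function.update (s2.arr 12) (a : ℤ) 1 (c : ℕ) =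
        s1.arr 12 (c : ℕ) := fun c hc => by
      rw [Function.update_of_ne (by exact_mod_cast hc), hoth c hc]
    simp only [wp_seq, wp_ite, wp_write, wp_assign, wp_skip, Expr.eval_read, Expr.eval_reg,
      Expr.eval_sub', Expr.eval_const, Expr.eval_add', hE, h39, h11, h6, h40, h38', State.setArr_reg,
      State.setArr_arr, State.setReg_arr, State.setReg_reg, if_true]
    have hskip : ¬ (¬ D b ∧ I.extended b a ≠ 0) →
        ((∃ j < b + 1, ¬ D j ∧ I.extended j a ≠ 0) → s2.arr 12 (a : ℕ) = 1) ∧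
        ((¬ ∃ j < b + 1, ¬ D j ∧ I.extended j a ≠ 0) → s2.arr 12 (a : ℕ) = 0) := fun hb => by
      rw [hsame hb]; exact ⟨hex, hnex⟩
    have hset : (¬ D b ∧ I.extended b a ≠ 0) →
        ((∃ j < b + 1, ¬ D j ∧ I.extended j a ≠ 0) →
          Function.update (s2.arr 12) (a : ℤ) 1 (a : ℕ) = 1) ∧
        ((¬ ∃ j < b + 1, ¬ D j ∧ I.extended j a ≠ 0) →
          Function.update (s2.arr 12) (a : ℤ) 1 (a : ℕ) = 0) := fun hb =>
      ⟨fun _ => by simp, fun hcon => absurd ⟨b, by omega, hb⟩ hcon⟩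
    refine ⟨fun hp => ⟨by simpa using hptr, hoth, hskip fun h' => ?_⟩, fun hp => ?_⟩
    · rw [(hD b hb).2 h'.1] at hp
      exact lt_irrefl _ hp
    have hDb : ¬ D b := fun h' => hp (by rw [(hD b hb).1 h']; exact one_pos)
    refine ⟨fun hp => ⟨by simpa using hptr, hoth', hset ⟨hDb, by omega⟩⟩, fun hq =>
      ⟨fun hp => ⟨by simpa using hptr, hoth', hset ⟨hDb, by omega⟩⟩, fun hp =>
        ⟨by simpa using hptr, hoth, hskip fun h' => h'.2 (by omega)⟩⟩⟩
  · rintro s2 hs2 ⟨h40, hoth, hex, hnex⟩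
    intro c hc
    have hcl : (∃ j < n, ¬ D j ∧ I.extended j a ≠ 0) ↔ ¬ DP.IsClosed I.extended n D a := by
      simp [DP.IsClosed]
    by_cases hca : c = a
    · subst hca
      rw [hcl] at hex hnex
      exact ⟨hex, hnex⟩
    · simp only [State.setReg_arr]
      rw [hoth c hca]
      exact hM c (by omega)

/-- The vector `v` satisfies all closed constraints. -/
def Passes (I : ILP (Fin n) (Fin m)) (D : ℕ → Prop) (v : ℕ → ℤ) : Prop :=
  ∀ c < m, DP.IsClosed I.extended n D c → v c = I.rhsAt c

theorem check_spec (hI : Loaded I s) (hX : n + m ≤ X)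
    (hO : Marks m (fun c => ¬ DP.IsClosed I.extended n D c) (s.arr 12)) :
    wp X check (fun s' => (Passes I D (fun i => s.arr 10 i) → s'.reg 37 = 1) ∧
      (¬ Passes I D (fun i => s.arr 10 i) → s'.reg 37 = 0)) s := by
  simp only [check, wp_seq, wp_assign, Expr.eval_const]
  let P : ℕ → Prop := fun a =>
    ∀ c < a, DP.IsClosed I.extended n D c → s.arr 10 (c : ℕ) = I.rhsAt c
  refine wp_for m [37, 38] [] (by decide) (by decide) (by decide) (by decide)
    (by simp [hI.sizes.rows]) (by omega)
    (fun a s' => (P a → s'.reg 37 = 1) ∧ (¬ P a → s'.reg 37 = 0)) ?_ ?_ fun s' _ h => h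
  · exact ⟨fun _ => by simp, fun h => absurd (fun c hc => by omega) h⟩
  · rintro a ha s1 hs1 h38 ⟨h1, h2⟩
    have hb : s1.arr 2 (a : ℕ) = I.rhsAt a := by
      rw [hs1.arr 2 (by decide), ILP.rhsAt, dif_pos ha]
      exact hI.rhs ⟨a, ha⟩
    have hP : P (a + 1) ↔ P a ∧ (DP.IsClosed I.extended n D a → s.arr 10 (a : ℕ) = I.rhsAt a) := by
      constructor
      · exact fun h => ⟨fun c hc => h c (by omega), h a (by omega)⟩
      · rintro ⟨h, h'⟩ c hc
        by_cases hca : c = a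
        · rw [hca]; exact h'
        · exact h c (by omega)
    have hO' := hO a ha
    simp only [wp_ite, wp_assign, wp_skip, Expr.eval_read, Expr.eval_reg, Expr.eval_sub',
      Expr.eval_const, h38, hb, hs1.arr 12 (by decide), hs1.arr 10 (by decide), State.setReg_arr,
      State.setReg_reg, if_true, hP]
    by_cases hc : DP.IsClosed I.extended n D a
    · rw [hO'.2 (by simpa using hc)]
      refine ⟨fun h => absurd h (lt_irrefl _), fun _ => ⟨fun hp => ⟨fun h => ?_, fun _ => by simp⟩,
        fun hp => ⟨fun hq => ⟨fun h => ?_, fun _ => by simp⟩, fun hq => ?_⟩⟩⟩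
      · have := h.2 hc; omega
      · have := h.2 hc; omega
      · have he : s.arr 10 (a : ℕ) = I.rhsAt a := by omega
        simpa [he] using ⟨h1, h2⟩
    · rw [hO'.1 hc]
      refine ⟨fun _ => ?_, fun h => absurd one_pos h⟩
      simpa [hc] using ⟨h1, h2⟩

/-- The `i`-th entry of the `p`-th record of the table. -/
def recordAt (n m : ℕ) (s : State) (p i : ℕ) : ℤ := s.arr 9 ((p * (n + m + 1) + i : ℕ) : ℤ)

theorem store_spec (hI : Loaded I s) (hX : n + m < X) {p : ℕ}
    (h36 : s.reg 36 = ((p * (n + m + 1) : ℕ) : ℤ)) :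
    wp X store (fun s' => (∀ i < n + m + 1, recordAt n m s' p i = s.arr 10 i) ∧
      ∀ q ≠ p, ∀ i < n + m + 1, recordAt n m s' q i = recordAt n m s q i) s := by
  refine wp_for (n + m + 1) [38] [9] (by decide) (by decide) (by decide) (by decide)
    hI.sizes.len (by omega)
    (fun a s' => (∀ i < a, recordAt n m s' p i = s.arr 10 i) ∧
      ∀ q ≠ p, ∀ i < n + m + 1, recordAt n m s' q i = recordAt n m s q i)
    ⟨by simp, fun q _ i _ => rfl⟩ ?_ fun s' _ h => h
  rintro a ha s1 hs1 h38 ⟨h1, h2⟩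
  have e : ((p * (n + m + 1) : ℕ) : ℤ) + (a : ℤ) = ((p * (n + m + 1) + a : ℕ) : ℤ) := by
    push_cast; ring
  simp only [wp_write, Expr.eval_add', Expr.eval_reg, Expr.eval_read, h38, hs1.reg 36 (by decide),
    h36, hs1.arr 10 (by decide), e]
  refine ⟨fun i hi => ?_, fun q hq i hi => ?_⟩
  · simp only [recordAt, State.setReg_arr, State.setArr_arr, if_true]
    rw [update_cell ha (by omega)]
    split_ifs with h
    · rw [h.2]
    · exact h1 i (by omega)
  · simp only [recordAt, State.setReg_arr, State.setArr_arr, if_true]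
    rw [update_cell ha hi, if_neg fun h => hq h.1]
    exact h2 q hq i hi

theorem compare_spec (hI : Loaded I s) (hX : n + m < X) {p : ℕ}
    (h34 : s.reg 34 = ((p * (n + m + 1) : ℕ) : ℤ)) :
    wp X Program.compare (fun s' => ((∀ c < m, recordAt n m s p c = s.arr 10 (c : ℕ)) → s'.reg 35 = 0) ∧
      ((¬ ∀ c < m, recordAt n m s p c = s.arr 10 (c : ℕ)) → s'.reg 35 = 1)) s := by
  simp only [Program.compare, wp_seq, wp_assign, Expr.eval_const]
  let P : ℕ → Prop := fun a => ∀ c < a, recordAt n m s p c = s.arr 10 (c : ℕ)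
  refine wp_for m [35, 38] [] (by decide) (by decide) (by decide) (by decide)
    (by simp [hI.sizes.rows]) (by omega)
    (fun a s' => (P a → s'.reg 35 = 0) ∧ (¬ P a → s'.reg 35 = 1)) ?_ ?_ fun s' _ h => h
  · exact ⟨fun _ => by simp, fun h => absurd (fun c hc => by omega) h⟩
  · rintro a ha s1 hs1 h38 ⟨h1, h2⟩
    have hP : P (a + 1) ↔ P a ∧ recordAt n m s p a = s.arr 10 (a : ℕ) := by
      constructor
      · exact fun h => ⟨fun c hc => h c (by omega), h a (by omega)⟩
      · rintro ⟨h, h'⟩ c hc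
        by_cases hca : c = a
        · rw [hca]; exact h'
        · exact h c (by omega)
    have e : s.arr 9 (((p * (n + m + 1) : ℕ) : ℤ) + (a : ℤ)) = recordAt n m s p a := by
      rw [recordAt]; congr 1
    have h34' : s1.reg 34 = ((p * (n + m + 1) : ℕ) : ℤ) := by
      rw [hs1.reg 34 (by decide)]; simpa using h34
    simp only [wp_ite, wp_assign, wp_skip, Expr.eval_read, Expr.eval_reg, Expr.eval_sub',
      Expr.eval_add', Expr.eval_const, h38, hs1.arr 9 (by decide), hs1.arr 10 (by decide),
      h34', State.setReg_arr, State.setReg_reg, if_true, hP, e]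
    refine ⟨fun hp => ⟨fun h => ?_, fun _ => by simp⟩,
      fun hp => ⟨fun hq => ⟨fun h => ?_, fun _ => by simp⟩, fun hq => ?_⟩⟩
    · have := h.2; omega
    · have := h.2; omega
    · have he : recordAt n m s p a = s.arr 10 (a : ℕ) := by omega
      simpa [he] using ⟨h1, h2⟩

/-- By `hkey` a copy of the candidate's key stands directly behind the layer, so the search ends
after at most `cnt + 1` comparisons. The outcome `r = cnt` means that the key is new. -/
theorem find_spec (hI : Loaded I s) (hX : n + m < X) {q cnt : ℕ}
    (h28 : s.reg 28 = ((q * (n + m + 1) : ℕ) : ℤ)) (hcnt : cnt < X)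
    (hkey : ∀ c < m, recordAt n m s (q + cnt) c = s.arr 10 (c : ℕ)) :
    wp X find (fun s' => ∃ r ≤ cnt, s'.reg 34 = (((q + r) * (n + m + 1) : ℕ) : ℤ) ∧
      (∀ c < m, recordAt n m s (q + r) c = s.arr 10 (c : ℕ)) ∧
      ∀ r' < r, ¬ ∀ c < m, recordAt n m s (q + r') c = s.arr 10 (c : ℕ)) s := by
  simp only [find, wp_seq, wp_assign, Expr.eval_const, Expr.eval_reg]
  let P : ℕ → Prop := fun r => ∀ c < m, recordAt n m s (q + r) c = s.arr 10 (c : ℕ)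
  refine wp_loop [34, 35, 38] [] (by decide) (by decide)
    (fun a s' => (s'.reg 35 = 1 ∧ s'.reg 34 = (((q + a) * (n + m + 1) : ℕ) : ℤ) ∧ a ≤ cnt ∧
        ∀ r' < a, ¬ P r') ∨
      (s'.reg 35 = 0 ∧ ∃ r ≤ cnt, s'.reg 34 = (((q + r) * (n + m + 1) : ℕ) : ℤ) ∧ P r ∧
        ∀ r' < r, ¬ P r')) ?_ ?_ ?_
  · exact Or.inl ⟨by simp, by simp [h28], by omega, by simp⟩
  · rintro a s1 hs1 (⟨h35, h34, ha, hne⟩ | ⟨h35, -⟩) hpos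
    · refine ⟨by omega, ?_⟩
      have hs : Agree [34, 35, 38] [] s s1 :=
        ((agree_setReg (by decide)).trans (agree_setReg (by decide))).trans hs1
      have hI1 : Loaded I s1 := hI.of_agree hs (by decide) (by decide)
      simp only [wp_seq]
      refine wp_conseq (compare_spec hI1 hX h34) [35, 38] [] (by decide) (by decide) ?_
      have hrec : ∀ p i, recordAt n m s1 p i = recordAt n m s p i := fun p i => by
        simp only [recordAt, hs.arr 9 (by decide)]
      rintro s2 ⟨h1, h2⟩ hs2
      simp only [hrec, hs.arr 10 (by decide)] at h1 h2
      have h34' : s2.reg 34 = (((q + a) * (n + m + 1) : ℕ) : ℤ) := by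
        rw [hs2.reg 34 (by decide), h34]
      have h6 : s2.reg 6 = ((n + m + 1 : ℕ) : ℤ) := by
        rw [hs2.reg 6 (by decide), hI1.sizes.len]
      simp only [wp_ite, wp_assign, wp_skip, Expr.eval_add', Expr.eval_reg, h34', h6]
      by_cases hP : P a
      · rw [h1 hP]
        exact ⟨fun h => absurd h (lt_irrefl _), fun _ => Or.inr ⟨rfl, a, ha, rfl, hP, hne⟩⟩
      · rw [h2 hP]
        refine ⟨fun _ => Or.inl ⟨by simp [h2 hP], ?_, ?_, fun r' hr' => ?_⟩,
          fun h => absurd one_pos h⟩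
        · simp only [State.setReg_reg, if_true]
          push_cast
          ring
        · have : a ≠ cnt := by rintro rfl; exact hP hkey
          omega
        · by_cases hra : r' = a
          · rw [hra]; exact hP
          · exact hne r' (by omega)
    · simp only [Expr.eval_reg, h35] at hpos
      exact absurd hpos (lt_irrefl _)
  · rintro a s1 hs1 (⟨h35, -⟩ | ⟨-, h⟩) hpos
    · simp only [Expr.eval_reg, h35] at hpos
      exact absurd one_pos hpos
    · exact h

/-- The new layer of the table, which starts with the record number `q` and consists of `cnt` records,
represents the set `K`. -/
structure NewLayer (n m : ℕ) (s : State) (q cnt : ℕ) (K : Set (ℕ → ℤ)) : Prop where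
  start : s.reg 28 = ((q * (n + m + 1) : ℕ) : ℤ)
  finish : s.reg 29 = (((q + cnt) * (n + m + 1) : ℕ) : ℤ)
  rep : DP.Represents m (n + m + 1) (fun r => recordAt n m s (q + r)) cnt K

/-- The first `q` records of the table are the same. -/
def SameRecords (n m q : ℕ) (s s' : State) : Prop :=
  ∀ p < q, ∀ i < n + m + 1, recordAt n m s' p i = recordAt n m s p i

theorem SameRecords.trans {q : ℕ} {s s' s'' : State} (h : SameRecords n m q s s')
    (h' : SameRecords n m q s' s'') : SameRecords n m q s s'' :=
  fun p hp i hi => (h' p hp i hi).trans (h p hp i hi)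

/-- If the key is found, the record is overwritten when the candidate is better and kept otherwise;
the copy behind the layer is then ignored. If the key is new, this copy joins the layer. -/
theorem insert_spec (hI : Loaded I s) (hX : n + m < X) {q cnt : ℕ} {K : Set (ℕ → ℤ)}
    (h : NewLayer n m s q cnt K) (hcnt : cnt < X) {v : ℕ → ℤ}
    (hv : ∀ i < n + m + 1, s.arr 10 i = v i) :
    wp X Program.insert (fun s' => SameRecords n m q s s' ∧
      ∃ cnt', NewLayer n m s' q cnt' (insert v K)) s := by
  simp only [Program.insert, wp_seq, wp_assign, Expr.eval_reg]
  have hI0 : Loaded I (s.setReg 36 (s.reg 29)) := hI.of_agree (R := [36]) (A := [])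
    (agree_setReg (by decide)) (by decide) (by decide)
  refine wp_conseq (store_spec (p := q + cnt) hI0 hX (by simpa using h.finish)) [38] [9]
    (by decide) (by decide) ?_
  rintro s1 ⟨hnew, hold⟩ hs1
  have hI1 := hI0.of_agree hs1 (by decide) (by decide)
  have h28 : s1.reg 28 = ((q * (n + m + 1) : ℕ) : ℤ) := by
    rw [hs1.reg 28 (by decide)]; simpa using h.start
  have h29 : s1.reg 29 = (((q + cnt) * (n + m + 1) : ℕ) : ℤ) := by
    rw [hs1.reg 29 (by decide)]; simpa using h.finish
  have h10 : s1.arr 10 = s.arr 10 := hs1.arr 10 (by decide)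
  have hnew : ∀ i < n + m + 1, recordAt n m s1 (q + cnt) i = v i := fun i hi =>
    (hnew i hi).trans (hv i hi)
  have hold : ∀ p ≠ q + cnt, ∀ i < n + m + 1, recordAt n m s1 p i = recordAt n m s p i := hold
  refine wp_conseq (find_spec hI1 hX h28 hcnt fun c hc => by
    rw [hnew c (by omega), h10, hv c (by omega)]) [34, 35, 38] [] (by decide) (by decide) ?_
  rintro s2 ⟨r, hr, h34, hkey, hne⟩ hs2
  have hI2 := hI1.of_agree hs2 (by decide) (by decide)
  have hrec2 : ∀ p i, recordAt n m s2 p i = recordAt n m s1 p i := fun p i => by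
    simp only [recordAt, hs2.arr 9 (by decide)]
  have h28' : s2.reg 28 = ((q * (n + m + 1) : ℕ) : ℤ) := (hs2.reg 28 (by decide)).trans h28
  have h29' := (hs2.reg 29 (by decide)).trans h29
  have h10' : s2.arr 10 = s.arr 10 := (hs2.arr 10 (by decide)).trans h10
  have e : s2.arr 9 (((((q + r) * (n + m + 1) : ℕ) : ℤ)) + m) = recordAt n m s1 (q + r) m := by
    rw [← hrec2, recordAt]; congr 1
  have hkey' : ∀ c < m, recordAt n m s1 (q + r) c = v c := fun c hc => by
    rw [hkey c hc, h10, hv c (by omega)]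
  have hle : ((q + r : ℕ) : ℤ) * ((n + m + 1 : ℕ) : ℤ) < ((q + cnt : ℕ) : ℤ) * ((n + m + 1 : ℕ) : ℤ)
      ↔ r < cnt := by
    rw [Int.mul_lt_mul_right (by positivity)]
    omega
  simp only [wp_ite, wp_seq, wp_skip, wp_assign, Expr.eval_sub', Expr.eval_add', Expr.eval_reg,
    Expr.eval_read, h29', h34, hI2.sizes.rows, h10', e, hv m (by omega), hI2.sizes.len]
  have hsame : SameRecords n m q s s2 := fun p hp i hi => by
    rw [hrec2, hold p (by omega) i hi]
  refine ⟨fun hlt => ⟨fun hgt => ?_, fun hgt => ⟨hsame, cnt, h28', h29', ?_⟩⟩, fun hlt => ?_⟩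
  · have hrc : r < cnt := by
      rw [← hle]; push_cast at hlt ⊢; linarith
    have hI3 : Loaded I (s2.setReg 36 (((q + r) * (n + m + 1) : ℕ) : ℤ)) :=
      hI2.of_agree (R := [36]) (A := []) (agree_setReg (by decide)) (by decide) (by decide)
    refine wp_conseq (store_spec (p := q + r) hI3 hX (by simp)) [38] [9]
      (by decide) (by decide) ?_
    rintro s3 ⟨hnew3, hold3⟩ hs3
    have hnew3 : ∀ i < n + m + 1, recordAt n m s3 (q + r) i = v i := fun i hi => by
      rw [hnew3 i hi, State.setReg_arr, h10', hv i hi]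
    have hold3 : ∀ p ≠ q + r, ∀ i < n + m + 1, recordAt n m s3 p i = recordAt n m s1 p i :=
      fun p hp i hi => (hold3 p hp i hi).trans (hrec2 p i)
    refine ⟨fun p hp i hi => by rw [hold3 p (by omega) i hi, hold p (by omega) i hi], cnt,
      by rw [hs3.reg 28 (by decide)]; simpa using h28',
      by rw [hs3.reg 29 (by decide)]; simpa using h29', ?_⟩
    have hm : recordAt n m s1 (q + r) m = recordAt n m s (q + r) m := hold _ (by omega) _ (by omega)
    refine h.rep.insert_replace (by omega) hrc (fun c hc => ?_) (by linarith)
      (fun r' hr' hne' i hi => ?_) hnew3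
    · rw [← hkey' c hc, hold (q + r) (by omega) c (by omega)]
    · rw [hold3 (q + r') (by omega) i hi, hold (q + r') (by omega) i hi]
  · have hrc : r < cnt := by
      rw [← hle]; push_cast at hlt ⊢; linarith
    have hrep := h.rep.congr (get' := fun r => recordAt n m s2 (q + r)) (by omega)
      fun r hr i hi => by rw [hrec2, hold (q + r) (by omega) i hi]
    exact hrep.insert_skip hrc (fun c hc => by rw [hrec2, hkey' c hc])
      (by rw [hrec2]; linarith)
  · have hrc : r = cnt := by
      have : ¬ r < cnt := by
        rw [← hle]; push_cast at hlt ⊢; linarith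
      omega
    subst hrc
    refine ⟨fun p hp i hi => hsame p hp i hi, r + 1, by simpa using h28', ?_, ?_⟩
    · simp only [State.setReg_reg, if_true]
      push_cast
      ring
    · refine h.rep.insert_new (by omega) (fun r' hr' hk => hne r' hr' fun c hc => ?_)
        (fun r' hr' i hi => ?_) fun i hi => ?_
      · rw [hold (q + r') (by omega) c (by omega), h10, hk c hc, hv c (by omega)]
      · exact (hrec2 _ _).trans (hold (q + r') (by omega) i hi)
      · exact (hrec2 _ _).trans (hnew i hi)

theorem tryInsert_spec (hI : Loaded I s) (hX : n + m < X) {q cnt : ℕ}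
    {K : Set (ℕ → ℤ)} (h : NewLayer n m s q cnt K) (hcnt : cnt < X) {v : ℕ → ℤ}
    (hv : ∀ i < n + m + 1, s.arr 10 i = v i)
    (hO : Marks m (fun c => ¬ DP.IsClosed I.extended n D c) (s.arr 12)) :
    wp X tryInsert (fun s' => SameRecords n m q s s' ∧
      ∃ cnt', NewLayer n m s' q cnt' (K ∪ {u | u = v ∧ Passes I D u})) s := by
  simp only [tryInsert, wp_seq]
  refine wp_conseq (check_spec hI (by omega) hO) [37, 38] [] (by decide) (by decide) ?_
  rintro s1 ⟨h1, h2⟩ hs1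
  have hpass : Passes I D (fun i => s.arr 10 i) ↔ Passes I D v :=
    forall₂_congr fun c hc => by rw [← hv c (by omega)]
  have hrec : ∀ p i, recordAt n m s1 p i = recordAt n m s p i := fun p i => by
    simp only [recordAt, hs1.arr 9 (by decide)]
  have hL : NewLayer n m s1 q cnt K := ⟨(hs1.reg 28 (by decide)).trans h.start,
    (hs1.reg 29 (by decide)).trans h.finish, h.rep.congr (by omega) fun r _ i _ => hrec _ i⟩
  have hsame : SameRecords n m q s s1 := fun p _ i _ => hrec p i
  simp only [wp_ite, wp_skip, Expr.eval_reg]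
  by_cases hp : Passes I D v
  · rw [h1 (hpass.2 hp)]
    refine ⟨fun _ => ?_, fun hh => absurd one_pos hh⟩
    refine wp_conseq (insert_spec (hI.of_agree hs1 (by decide) (by decide)) hX hL hcnt (v := v)
      fun i hi => by rw [hs1.arr 10 (by decide), hv i hi]) [29, 34, 35, 36, 38] [9] (by decide)
      (by decide) ?_
    rintro s2 ⟨hs, cnt', hL'⟩ -
    refine ⟨hsame.trans hs, cnt', ?_⟩
    have hK : K ∪ {u | u = v ∧ Passes I D u} = insert v K := by
      ext u
      simp only [Set.mem_union, Set.mem_ofPred_eq, Set.mem_insert_iff]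
      constructor
      · rintro (h | h)
        · exact Or.inr h
        · exact Or.inl h.1
      · rintro (rfl | h)
        · exact Or.inr ⟨rfl, hp⟩
        · exact Or.inl h
    rwa [hK]
  · rw [h2 (fun hh => hp (hpass.1 hh))]
    refine ⟨fun hh => absurd hh (lt_irrefl _), fun _ => ⟨hsame, cnt, ?_⟩⟩
    have hK : K ∪ {u | u = v ∧ Passes I D u} = K := by
      ext u
      simp only [Set.mem_union, Set.mem_ofPred_eq]
      constructor
      · rintro (h | ⟨rfl, h⟩)
        · exact h
        · exact absurd h hp
      · exact Or.inl
    rwa [hK]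

end

end RAM

namespace RAM

open Program

section

variable {n m : ℕ} {I : ILP (Fin n) (Fin m)} {X B : ℕ} {s : State} {D : ℕ → Prop}

/-! ### Extending the records -/

theorem load_spec (hI : Loaded I s) (hX : n + m < X) {p : ℕ}
    (h30 : s.reg 30 = ((p * (n + m + 1) : ℕ) : ℤ)) :
    wp X load (fun s' => ∀ i < n + m + 1, s'.arr 10 (i : ℕ) = recordAt n m s p i) s := by
  refine wp_for (n + m + 1) [38] [10] (by decide) (by decide) (by decide) (by decide)
    hI.sizes.len (by omega)
    (fun a s' => ∀ i < a, s'.arr 10 (i : ℕ) = recordAt n m s p i) (by simp) ?_ fun s' _ h => h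
  rintro a ha s1 hs1 h38 h
  have e : s.arr 9 (((p * (n + m + 1) : ℕ) : ℤ) + (a : ℤ)) = recordAt n m s p a := by
    rw [recordAt]; congr 1
  simp only [wp_write, Expr.eval_add', Expr.eval_reg, Expr.eval_read, h38, hs1.reg 30 (by decide),
    h30, hs1.arr 9 (by decide), e]
  intro i hi
  simp only [State.setReg_arr, State.setArr_arr, if_true, Function.update_apply, Nat.cast_inj]
  split_ifs with h'
  · rw [h']
  · exact h i (by omega)

theorem addColumn_spec (hI : Loaded I s) (hX : n + m < X) {j : ℕ} (hj : j < n)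
    (h26 : s.reg 26 = ((j * (n + m + 1) : ℕ) : ℤ)) :
    wp X addColumn (fun s' => ∀ i < n + m + 1,
      s'.arr 10 (i : ℕ) = s.arr 10 (i : ℕ) + I.extended j i) s := by
  refine wp_for (n + m + 1) [38] [10] (by decide) (by decide) (by decide) (by decide)
    hI.sizes.len (by omega)
    (fun a s' => ∀ i, (i < a → s'.arr 10 (i : ℕ) = s.arr 10 (i : ℕ) + I.extended j i) ∧
      (¬ i < a → s'.arr 10 (i : ℕ) = s.arr 10 (i : ℕ))) (by simp) ?_
    fun s' _ h i hi => (h i).1 hi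
  rintro a ha s1 hs1 h38 h
  have e : s.arr 1 (((j * (n + m + 1) : ℕ) : ℤ) + (a : ℤ)) = I.extended j a := by
    rw [← hI.cols j hj a ha]; congr 1
  simp only [wp_write, Expr.eval_add', Expr.eval_reg, Expr.eval_read, h38, hs1.reg 26 (by decide),
    h26, hs1.arr 1 (by decide), e, (h a).2 (lt_irrefl a)]
  intro i
  simp only [State.setReg_arr, State.setArr_arr, if_true, Function.update_apply, Nat.cast_inj]
  by_cases h' : i = a
  · subst h'; simp
  · rw [if_neg h']
    have : i < a + 1 ↔ i < a := by omega
    rw [this]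
    exact h i

theorem subColumn_spec (hI : Loaded I s) (hX : n + m < X) {j : ℕ} (hj : j < n)
    (h26 : s.reg 26 = ((j * (n + m + 1) : ℕ) : ℤ)) :
    wp X subColumn (fun s' => ∀ i < n + m + 1,
      s'.arr 10 (i : ℕ) = s.arr 10 (i : ℕ) - I.extended j i) s := by
  refine wp_for (n + m + 1) [38] [10] (by decide) (by decide) (by decide) (by decide)
    hI.sizes.len (by omega)
    (fun a s' => ∀ i, (i < a → s'.arr 10 (i : ℕ) = s.arr 10 (i : ℕ) - I.extended j i) ∧
      (¬ i < a → s'.arr 10 (i : ℕ) = s.arr 10 (i : ℕ))) (by simp) ?_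
    fun s' _ h i hi => (h i).1 hi
  rintro a ha s1 hs1 h38 h
  have e : s.arr 1 (((j * (n + m + 1) : ℕ) : ℤ) + (a : ℤ)) = I.extended j a := by
    rw [← hI.cols j hj a ha]; congr 1
  simp only [wp_write, Expr.eval_add', Expr.eval_sub', Expr.eval_reg, Expr.eval_read, h38,
    hs1.reg 26 (by decide), h26, hs1.arr 1 (by decide), e, (h a).2 (lt_irrefl a)]
  intro i
  simp only [State.setReg_arr, State.setArr_arr, if_true, Function.update_apply, Nat.cast_inj]
  by_cases h' : i = a
  · subst h'; simp
  · rw [if_neg h']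
    have : i < a + 1 ↔ i < a := by omega
    rw [this]
    exact h i

/-- The admissible extensions of the records `g` by a value of the variable `j`. -/
abbrev extensionsOf (I : ILP (Fin n) (Fin m)) (B : ℕ) (D : ℕ → Prop) (j : ℕ) (g : ℕ → ℕ → ℤ)
    (A : ℕ → ℤ → Prop) : Set (ℕ → ℤ) :=
  DP.extensions I.extended n m B I.rhsAt I.InBounds D j g A

theorem extensionsOf_mono {j : ℕ} {g : ℕ → ℕ → ℤ} {A A' : ℕ → ℤ → Prop}
    (h : ∀ r a, A r a → A' r a) : extensionsOf I B D j g A ⊆ extensionsOf I B D j g A' := by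
  rintro v ⟨r, a, hA, h'⟩
  exact ⟨r, a, h r a hA, h'⟩

/-- Sets of vectors represented by fewer than `X` records. -/
def FewRecords (n m X : ℕ) (U : Set (ℕ → ℤ)) : Prop :=
  ∀ (get : ℕ → ℕ → ℤ) (cnt : ℕ) (K : Set (ℕ → ℤ)), K ⊆ U →
    DP.Represents m (n + m + 1) get cnt K → cnt < X

theorem tryValue_spec (hI : Loaded I s) (hX : n + m < X) {j : ℕ} {a : ℤ} (ha : |a| ≤ B)
    (h31 : s.reg 31 = a)
    (hb : ∀ a : ℤ, |a| ≤ B → (s.reg 32 ≤ a ∧ a ≤ s.reg 33 ↔ I.InBounds j a))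
    (hO : Marks m (fun c => ¬ DP.IsClosed I.extended n D c) (s.arr 12)) {q cnt : ℕ}
    {K : Set (ℕ → ℤ)} {g : ℕ → ℕ → ℤ} {r : ℕ}
    (hL : NewLayer n m s q cnt (K ∪ extensionsOf I B D j g fun r' a' => r' = r ∧ a' < a))
    (hcnt : cnt < X) (hg : ∀ i < n + m + 1, s.arr 10 (i : ℕ) = g r i + a * I.extended j i) :
    wp X (ite (§31 - §32 + ¢1) (ite (§33 - §31 + ¢1) tryInsert skip) skip)
      (fun s' => SameRecords n m q s s' ∧ ∃ cnt', NewLayer n m s' q cnt'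
        (K ∪ extensionsOf I B D j g fun r' a' => r' = r ∧ a' < a + 1)) s := by
  simp only [wp_ite, wp_skip, Expr.eval_add', Expr.eval_sub', Expr.eval_reg, Expr.eval_const, h31]
  have hout : ¬ I.InBounds j a → (extensionsOf I B D j g fun r' a' => r' = r ∧ a' < a + 1) =
      extensionsOf I B D j g fun r' a' => r' = r ∧ a' < a := fun hnb => by
    refine Set.Subset.antisymm ?_ (extensionsOf_mono fun r' a' h => ⟨h.1, by omega⟩)
    rintro v ⟨r', a', ⟨hr, hlt⟩, h1, h2, h3⟩
    refine ⟨r', a', ⟨hr, ?_⟩, h1, h2, h3⟩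
    have : a' ≠ a := by rintro rfl; exact hnb h2
    omega
  have hskip : ¬ I.InBounds j a → SameRecords n m q s s ∧ ∃ cnt', NewLayer n m s q cnt'
      (K ∪ extensionsOf I B D j g fun r' a' => r' = r ∧ a' < a + 1) := fun hnb => by
    rw [hout hnb]
    exact ⟨fun _ _ _ _ => rfl, cnt, hL⟩
  refine ⟨fun h1 => ⟨fun h2 => ?_, fun h2 => hskip fun h => ?_⟩, fun h1 => hskip fun h => ?_⟩
  · have hin : I.InBounds j a := (hb a ha).1 ⟨by omega, by omega⟩
    refine wp_conseq (tryInsert_spec hI hX hL hcnt (v := fun i => g r i + a * I.extended j i)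
      hg hO) [29, 34, 35, 36, 37, 38] [9] (by decide) (by decide) ?_
    rintro s1 ⟨hs, cnt', hL'⟩ -
    refine ⟨hs, cnt', ?_⟩
    convert hL' using 1
    rw [Set.union_assoc]
    congr 1
    ext u
    simp only [Set.mem_union, Set.mem_ofPred_eq, DP.extensions]
    constructor
    · rintro ⟨r', a', ⟨rfl, hlt⟩, h1, h2, rfl, h4⟩
      by_cases haa : a' = a
      · subst haa
        exact Or.inr ⟨rfl, h4⟩
      · exact Or.inl ⟨r', a', ⟨rfl, by omega⟩, h1, h2, rfl, h4⟩
    · rintro (⟨r', a', ⟨rfl, hlt⟩, h1, h2, rfl, h4⟩ | ⟨rfl, h⟩)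
      · exact ⟨r', a', ⟨rfl, by omega⟩, h1, h2, rfl, h4⟩
      · exact ⟨r, a, ⟨rfl, by omega⟩, ha, hin, rfl, h⟩
  · have := (hb a ha).2 h; omega
  · have := (hb a ha).2 h; omega

/-- The set `U` contains all vectors that are inserted or already represented. It is needed at every
intermediate stage, since the search loop of each insertion runs over the records present at that
moment. -/
theorem extendRecord_spec (hI : Loaded I s) (hX : n + m < X) (hBX : 2 * B < X) {j : ℕ} (hj : j < n)
    (h23 : s.reg 23 = B) (h26 : s.reg 26 = ((j * (n + m + 1) : ℕ) : ℤ)) {p : ℕ}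
    (h30 : s.reg 30 = ((p * (n + m + 1) : ℕ) : ℤ))
    (hb : ∀ a : ℤ, |a| ≤ B → (s.reg 32 ≤ a ∧ a ≤ s.reg 33 ↔ I.InBounds j a))
    (hO : Marks m (fun c => ¬ DP.IsClosed I.extended n D c) (s.arr 12)) {q cnt : ℕ}
    {K U : Set (ℕ → ℤ)} {g : ℕ → ℕ → ℤ} {r : ℕ} (hL : NewLayer n m s q cnt K)
    (hg : ∀ i < n + m + 1, recordAt n m s p i = g r i) (hU : FewRecords n m X U) (hKU : K ⊆ U)
    (hEU : (extensionsOf I B D j g fun r' _ => r' = r) ⊆ U) :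
    wp X extendRecord (fun s' => SameRecords n m q s s' ∧ ∃ cnt', NewLayer n m s' q cnt'
      (K ∪ extensionsOf I B D j g fun r' _ => r' = r)) s := by
  simp only [extendRecord, wp_seq]
  refine wp_conseq (load_spec hI hX h30) [38] [10] (by decide) (by decide) ?_
  rintro s1 hc1 hs1
  refine wp_for B [38, 43] [10] (by decide) (by decide) (by decide) (by decide)
    (by rw [hs1.reg 23 (by decide), h23]) (by omega)
    (fun t s' => ∀ i < n + m + 1, s'.arr 10 (i : ℕ) = g r i - t * I.extended j i) ?_ ?_ ?_
  · intro i hi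
    rw [State.setReg_arr, hc1 i hi, hg i hi]
    simp
  · rintro t ht s2 hs2 h43 hc2
    have hs : Agree [38, 43] [10] s s2 := (hs1.mono (by decide) (by decide)).trans hs2
    refine wp_conseq (subColumn_spec (hI.of_agree hs (by decide) (by decide)) hX hj
      (by rw [hs.reg 26 (by decide), h26])) [38] [10] (by decide) (by decide) ?_
    rintro s3 hc3 -
    intro i hi
    rw [State.setReg_arr, hc3 i hi, hc2 i hi]
    push_cast
    ring
  rintro s2 hs2 hc2
  have hs : Agree [38, 43] [10] s s2 := (hs1.mono (by decide) (by decide)).trans hs2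
  simp only [wp_assign, Expr.eval_sub', Expr.eval_reg, Expr.eval_const, hs.reg 23 (by decide), h23]
  set s3 := s2.setReg 31 (0 - (B : ℤ)) with hs3
  have h3 : Agree [31, 38, 43] [10] s s3 := (hs.mono (by decide) (by decide)).trans
    (agree_setReg (by decide))
  refine wp_loop [29, 31, 34, 35, 36, 37, 38] [9, 10] (by decide) (by decide)
    (fun t s' => s'.reg 31 = -(B : ℤ) + t ∧
      (∀ i < n + m + 1, s'.arr 10 (i : ℕ) = g r i + (-(B : ℤ) + t) * I.extended j i) ∧
      SameRecords n m q s s' ∧ ∃ cnt', NewLayer n m s' q cnt'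
        (K ∪ extensionsOf I B D j g fun r' a' => r' = r ∧ a' < -(B : ℤ) + t)) ?_ ?_ ?_
  · refine ⟨by simp [hs3], fun i hi => ?_, fun p _ i _ => ?_, cnt, ?_, ?_, ?_⟩
    · rw [hs3, State.setReg_arr, hc2 i hi]
      push_cast
      ring
    · simp only [recordAt, h3.arr 9 (by decide)]
    · rw [h3.reg 28 (by decide), hL.start]
    · rw [h3.reg 29 (by decide), hL.finish]
    · have hemp : K ∪ (extensionsOf I B D j g fun r' a' => r' = r ∧ a' < -(B : ℤ) + (0 : ℕ)) = K := by
        refine Set.union_eq_left.2 ?_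
        rintro v ⟨r', a', ⟨-, h1⟩, h2, -⟩
        have := abs_le.1 h2
        push_cast at h1
        omega
      rw [hemp]
      refine hL.rep.congr (by omega) fun r' _ i _ => ?_
      simp only [recordAt, h3.arr 9 (by decide)]
  · rintro t s4 hs4 ⟨h31, hc4, hsame, cnt', hL'⟩ hpos
    have h4 : Agree [29, 31, 34, 35, 36, 37, 38, 43] [9, 10] s s4 :=
      (h3.mono (by decide) (by decide)).trans (hs4.mono (by decide) (by decide))
    have hI4 : Loaded I s4 := hI.of_agree h4 (by decide) (by decide)
    simp only [Expr.eval_sub', Expr.eval_add', Expr.eval_reg, Expr.eval_const, h31,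
      h4.reg 23 (by decide), h23] at hpos
    have ht : t ≤ 2 * B := by omega
    refine ⟨by omega, ?_⟩
    have ha : |-(B : ℤ) + t| ≤ B := by rw [abs_le]; omega
    have hcnt' : cnt' < X := hU _ _ _ (Set.union_subset hKU
      ((extensionsOf_mono fun r' a' h => h.1).trans hEU)) hL'.rep
    simp only [wp_seq]
    refine wp_conseq (tryValue_spec hI4 hX ha h31 (by
      rw [h4.reg 32 (by decide), h4.reg 33 (by decide)]; exact hb)
      (by rw [h4.arr 12 (by decide)]; exact hO) hL' hcnt' hc4) [29, 34, 35, 36, 37, 38] [9] (by decide)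
      (by decide) ?_
    rintro s5 ⟨hsame5, cnt5, hL5⟩ hs5
    have hI5 : Loaded I s5 := hI4.of_agree hs5 (by decide) (by decide)
    refine wp_conseq (addColumn_spec hI5 hX hj
      (by rw [hs5.reg 26 (by decide), h4.reg 26 (by decide), h26])) [38] [10] (by decide)
      (by decide) ?_
    rintro s6 hc6 hs6
    have hrec : ∀ p i, recordAt n m s6 p i = recordAt n m s5 p i := fun p i => by
      simp only [recordAt, hs6.arr 9 (by decide)]
    have h31' : s6.reg 31 = -(B : ℤ) + t := by
      rw [hs6.reg 31 (by decide), hs5.reg 31 (by decide), h31]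
    have hadd : -(B : ℤ) + ((t + 1 : ℕ) : ℤ) = -(B : ℤ) + t + 1 := by push_cast; ring
    simp only [wp_assign, Expr.eval_add', Expr.eval_reg, Expr.eval_const, h31', hadd]
    refine ⟨by simp, fun i hi => ?_, (hsame.trans hsame5).trans fun p _ i _ => hrec p i, cnt5,
      ?_, ?_, ?_⟩
    · rw [State.setReg_arr, hc6 i hi, hs5.arr 10 (by decide), hc4 i hi]
      ring
    · simp [hs6.reg 28 (by decide), hL5.start]
    · simpa [hs6.reg 29 (by decide)] using hL5.finish
    · exact hL5.rep.congr (by omega) fun r' _ i _ => hrec _ i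
  · rintro t s4 hs4 ⟨h31, hc4, hsame, cnt', hL'⟩ hpos
    have h4 : Agree [29, 31, 34, 35, 36, 37, 38, 43] [9, 10] s s4 :=
      (h3.mono (by decide) (by decide)).trans (hs4.mono (by decide) (by decide))
    simp only [Expr.eval_sub', Expr.eval_add', Expr.eval_reg, Expr.eval_const, h31,
      h4.reg 23 (by decide), h23] at hpos
    refine ⟨hsame, cnt', ?_⟩
    convert hL' using 1
    congr 1
    refine Set.Subset.antisymm ?_ (extensionsOf_mono fun r' a' h => h.1)
    rintro v ⟨r', a', h1, h2, h3⟩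
    refine ⟨r', a', ⟨h1, ?_⟩, h2, h3⟩
    have := abs_le.1 h2
    omega

theorem variableBounds_spec (hI : Loaded I s) {j : ℕ} (hj : j < n) (h25 : s.reg 25 = j)
    (h23 : s.reg 23 = B) :
    wp X variableBounds (fun s' => ∀ a : ℤ, |a| ≤ B →
      (s'.reg 32 ≤ a ∧ a ≤ s'.reg 33 ↔ I.InBounds j a)) s := by
  have hl := hI.lower ⟨j, hj⟩
  have hu := hI.upper ⟨j, hj⟩
  dsimp only at hl hu
  have hl' : wp X (ite (.read 3 §25) (assign 32 (§23 + ¢1))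
      (ite (¢0 - .read 3 §25) (assign 32 (¢0 - §23)) (assign 32 (.read 4 §25))))
      (fun s' => ∀ a : ℤ, |a| ≤ B → (s'.reg 32 ≤ a ↔ I.lower ⟨j, hj⟩ ≤ ExtInt.ofInt a)) s := by
    simp only [wp_ite, wp_assign, Expr.eval_add', Expr.eval_sub', Expr.eval_reg, Expr.eval_const,
      Expr.eval_read, h25, h23, State.setReg_reg, if_true]
    rcases hl with ⟨h1, h2⟩ | ⟨h1, h2⟩ | ⟨h1, h2⟩ <;> rw [h1, h2]
    · refine ⟨by norm_num, fun _ => ⟨fun _ a ha => ?_, by norm_num⟩⟩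
      have := abs_le.1 ha
      simp only [ExtInt.bot_le_ofInt, iff_true]
      omega
    · refine ⟨fun _ a ha => ?_, by norm_num⟩
      have := abs_le.1 ha
      simp only [ExtInt.not_top_le_ofInt, iff_false]
      omega
    · refine ⟨by norm_num, fun _ => ⟨by norm_num, fun _ a ha => ?_⟩⟩
      rw [ExtInt.ofInt_le_ofInt]
  simp only [variableBounds, wp_seq] at hl' ⊢
  refine wp_conseq hl' [32] [] (by decide) (by decide) ?_
  rintro s1 h32 hs1
  have h25' : s1.reg 25 = j := by rw [hs1.reg 25 (by decide), h25]
  have h23' : s1.reg 23 = B := by rw [hs1.reg 23 (by decide), h23]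
  rw [← hs1.arr 5 (by decide), ← hs1.arr 6 (by decide)] at hu
  have hu' : wp X (ite (.read 5 §25) (assign 33 §23)
      (ite (¢0 - .read 5 §25) (assign 33 (¢0 - §23 - ¢1)) (assign 33 (.read 6 §25))))
      (fun s' => ∀ a : ℤ, |a| ≤ B → (a ≤ s'.reg 33 ↔ ExtInt.ofInt a ≤ I.upper ⟨j, hj⟩)) s1 := by
    simp only [wp_ite, wp_assign, Expr.eval_sub', Expr.eval_reg, Expr.eval_const,
      Expr.eval_read, h25', h23', State.setReg_reg, if_true]
    rcases hu with ⟨h1, h2⟩ | ⟨h1, h2⟩ | ⟨h1, h2⟩ <;> rw [h1, h2]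
    · refine ⟨by norm_num, fun _ => ⟨fun _ a ha => ?_, by norm_num⟩⟩
      have := abs_le.1 ha
      simp only [ExtInt.not_ofInt_le_bot, iff_false]
      omega
    · refine ⟨fun _ a ha => ?_, by norm_num⟩
      have := abs_le.1 ha
      simp only [ExtInt.ofInt_le_top, iff_true]
      omega
    · refine ⟨by norm_num, fun _ => ⟨by norm_num, fun _ a ha => ?_⟩⟩
      rw [ExtInt.ofInt_le_ofInt]
  refine wp_conseq hu' [33] [] (by decide) (by decide) ?_
  rintro s2 h33 hs2 a ha
  rw [hs2.reg 32 (by decide), h32 a ha, h33 a ha]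
  exact ⟨fun h _ => h, fun h => h hj⟩

/-- The partial assignments to the variables in `D` with values between `-B` and `B`. -/
abbrev partialsOf (I : ILP (Fin n) (Fin m)) (B : ℕ) (D : ℕ → Prop) : Set (ℕ → ℤ) :=
  DP.partials I.extended n m B I.rhsAt I.InBounds D

/-- The current layer of the table represents the partial assignments to the variables in `D`. -/
def TableState (I : ILP (Fin n) (Fin m)) (B X : ℕ) (D : ℕ → Prop) (s : State) : Prop :=
  Marks n D (s.arr 11) ∧ ∃ p cnt, s.reg 27 = ((p * (n + m + 1) : ℕ) : ℤ) ∧ cnt < X ∧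
    -- An empty new layer starts directly behind the current one, ready for the next variable.
    NewLayer n m s (p + cnt) 0 ∅ ∧
    DP.Represents m (n + m + 1) (fun r => recordAt n m s (p + r)) cnt (partialsOf I B D)

/-- Vectors that agree with those of partial assignments in the relevant entries. -/
def partialVectors (I : ILP (Fin n) (Fin m)) (B : ℕ) (D : ℕ → Prop) : Set (ℕ → ℤ) :=
  {v | ∃ x, DP.IsPartial I.extended n m B I.rhsAt I.InBounds D x ∧
    ∀ i < n + m + 1, v i = DP.combine I.extended n x i}

/-- The old layer is read while the new one grows behind it, and `SameRecords` guarantees that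
reading is not disturbed. The new layer represents the extensions of the old records, which by
`DP.Represents.extend` suffices for all partial assignments to `D'`. -/
theorem processVariable_spec (hI : Loaded I s) (hX : n + m < X) (hBX : 2 * B < X) {j : ℕ}
    (hj : j < n) (h23 : s.reg 23 = B) (h25 : s.reg 25 = j)
    (h26 : s.reg 26 = ((j * (n + m + 1) : ℕ) : ℤ)) (hT : TableState I B X D s) (hDj : ¬ D j)
    {D' : ℕ → Prop} (hD : ∀ i < n, D' i ↔ D i ∨ i = j)
    (hU : FewRecords n m X (partialVectors I B D')) :
    wp X processVariable (TableState I B X D') s := by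
  obtain ⟨hM, p, cnt, h27, hcnt, hL, hrep⟩ := hT
  simp only [processVariable, wp_seq, wp_write, Expr.eval_reg, Expr.eval_const, h25]
  set s1 := s.setArr 11 (j : ℤ) 1 with hs1d
  have hs1 : Agree [] [11] s s1 := ⟨fun _ _ => rfl, fun a ha => by
    simp only [List.mem_singleton] at ha; simp [hs1d, ha]⟩
  have hI1 := hI.of_agree hs1 (by decide) (by decide)
  have hM1 : Marks n D' (s1.arr 11) := fun i hi => by
    simp only [hs1d, State.setArr_arr, if_true, Function.update_apply, Nat.cast_inj, hD i hi]
    by_cases hij : i = j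
    · simp [hij]
    · simpa [hij] using hM i hi
  refine wp_conseq (openRows_spec hI1 (by omega) hM1) [38, 39, 40] [12] (by decide) (by decide) ?_
  rintro s2 hO hs2
  have h2 : Agree [38, 39, 40] [11, 12] s s2 := (hs1.mono (by decide) (by decide)).trans
    (hs2.mono (by decide) (by decide))
  refine wp_conseq (variableBounds_spec (hI.of_agree h2 (by decide) (by decide)) hj
    (by rw [h2.reg 25 (by decide), h25]) (by rw [h2.reg 23 (by decide), h23])) [32, 33] []
    (by decide) (by decide) ?_
  rintro s3 hb hs3
  have h3 : Agree [32, 33, 38, 39, 40] [11, 12] s s3 := (h2.mono (by decide) (by decide)).trans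
    (hs3.mono (by decide) (by decide))
  have hO3 : Marks m (fun c => ¬ DP.IsClosed I.extended n D' c) (s3.arr 12) := by
    rw [hs3.arr 12 (by decide)]; exact hO
  simp only [wp_assign, Expr.eval_reg, h3.reg 27 (by decide), h27]
  set s4 := s3.setReg 30 ((p * (n + m + 1) : ℕ) : ℤ) with hs4d
  have hs4 : Agree [30] [] s3 s4 := agree_setReg (by decide)
  have h4 : Agree [30, 32, 33, 38, 39, 40] [11, 12] s s4 := (h3.mono (by decide) (by decide)).trans
    (hs4.mono (by decide) (by decide))
  have hM4 : Marks n D' (s4.arr 11) := by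
    rw [hs4.arr 11 (by decide), hs3.arr 11 (by decide), hs2.arr 11 (by decide)]; exact hM1
  set g : ℕ → ℕ → ℤ := fun r => recordAt n m s (p + r) with hgd
  have hrec4 : ∀ q i, recordAt n m s4 q i = recordAt n m s q i := fun q i => by
    simp only [recordAt, h4.arr 9 (by decide)]
  have hEU : ∀ A : ℕ → ℤ → Prop, (∀ r a, A r a → r < cnt) →
      extensionsOf I B D' j g A ⊆ partialVectors I B D' := fun A hA v hv =>
    hrep.exists_partial (by omega) hj hDj hD hA hv
  refine wp_loop [29, 30, 31, 34, 35, 36, 37, 38, 43] [9, 10] (by decide) (by decide)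
    (fun t s' => t ≤ cnt ∧ s'.reg 30 = (((p + t) * (n + m + 1) : ℕ) : ℤ) ∧
      SameRecords n m (p + cnt) s s' ∧ ∃ cnt', NewLayer n m s' (p + cnt) cnt'
        (extensionsOf I B D' j g fun r _ => r < t)) ?_ ?_ ?_
  · refine ⟨by omega, by simp [hs4d], fun q _ i _ => hrec4 q i, 0, ?_, ?_, ?_⟩
    · rw [h4.reg 28 (by decide), hL.start]
    · rw [h4.reg 29 (by decide), hL.finish]
    · have hemp : (extensionsOf I B D' j g fun r _ => r < 0) = ∅ := by
        refine Set.eq_empty_iff_forall_notMem.2 ?_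
        rintro v ⟨r, a, h, -⟩
        omega
      rw [hemp]
      exact DP.represents_empty
  · rintro t s5 hs5 ⟨ht, h30, hsame, cnt', hL'⟩ hpos
    have h5 : Agree [29, 30, 31, 32, 33, 34, 35, 36, 37, 38, 39, 40, 43] [9, 10, 11, 12] s s5 :=
      (h4.mono (by decide) (by decide)).trans (hs5.mono (by decide) (by decide))
    have h45 : Agree [29, 30, 31, 34, 35, 36, 37, 38, 43] [9, 10] s3 s5 :=
      (hs4.mono (by decide) (by decide)).trans hs5
    have hI5 : Loaded I s5 := hI.of_agree h5 (by decide) (by decide)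
    have htc : t < cnt := by
      simp only [Expr.eval_sub', Expr.eval_reg, h30, h5.reg 28 (by decide), hL.start] at hpos
      have h1 : (((p + t) * (n + m + 1) : ℕ) : ℤ) < (((p + cnt) * (n + m + 1) : ℕ) : ℤ) := by
        linarith
      have h2 : (p + t) * (n + m + 1) < (p + cnt) * (n + m + 1) := by exact_mod_cast h1
      have := lt_of_mul_lt_mul_right h2 (by omega)
      omega
    refine ⟨by omega, ?_⟩
    simp only [wp_seq]
    refine wp_conseq (extendRecord_spec (D := D') (p := p + t) (g := g) (r := t) hI5 hX hBX hj
      (by rw [h5.reg 23 (by decide), h23]) (by rw [h5.reg 26 (by decide), h26]) h30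
      (by rw [h45.reg 32 (by decide), h45.reg 33 (by decide)]; exact hb)
      (by rw [h45.arr 12 (by decide)]; exact hO3) hL'
      (fun i hi => hsame (p + t) (by omega) i hi) hU (hEU _ fun r _ h => by omega)
      (hEU _ fun r _ h => by omega))
      [29, 31, 34, 35, 36, 37, 38, 43] [9, 10] (by decide) (by decide) ?_
    rintro s6 ⟨hsame6, cnt6, hL6⟩ hs6
    have h30' : s6.reg 30 = (((p + t) * (n + m + 1) : ℕ) : ℤ) := by
      rw [hs6.reg 30 (by decide), h30]
    have hlen : s6.reg 6 = ((n + m + 1 : ℕ) : ℤ) := by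
      rw [hs6.reg 6 (by decide), hI5.sizes.len]
    simp only [wp_assign, Expr.eval_add', Expr.eval_reg, h30', hlen]
    refine ⟨by omega, ?_, hsame.trans hsame6, cnt6, ?_, ?_, ?_⟩
    · simp only [State.setReg_reg, if_true]
      push_cast
      ring
    · simpa using hL6.start
    · simpa using hL6.finish
    · have hK : (extensionsOf I B D' j g fun r _ => r < t + 1) =
          (extensionsOf I B D' j g fun r _ => r < t) ∪
            extensionsOf I B D' j g fun r _ => r = t := by
        refine Set.Subset.antisymm ?_ (Set.union_subset (extensionsOf_mono fun r a h => by omega)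
          (extensionsOf_mono fun r a h => by omega))
        rintro v ⟨r, a, hr, h⟩
        rcases Nat.lt_succ_iff_lt_or_eq.1 hr with hr | hr
        · exact Or.inl ⟨r, a, hr, h⟩
        · exact Or.inr ⟨r, a, hr, h⟩
      rw [hK]
      exact hL6.rep
  · rintro t s5 hs5 ⟨ht, h30, hsame, cnt', hL'⟩ hpos
    have h28 : s5.reg 28 = (((p + cnt) * (n + m + 1) : ℕ) : ℤ) := hL'.start
    have htc : t = cnt := by
      simp only [Expr.eval_sub', Expr.eval_reg, h30, h28] at hpos
      have h1 : (((p + cnt) * (n + m + 1) : ℕ) : ℤ) ≤ (((p + t) * (n + m + 1) : ℕ) : ℤ) := by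
        linarith
      have h2 : (p + cnt) * (n + m + 1) ≤ (p + t) * (n + m + 1) := by exact_mod_cast h1
      have := le_of_mul_le_mul_right h2 (by omega)
      omega
    subst htc
    have hrep' := hrep.extend (by omega) hj hDj hD hL'.rep
    refine ⟨?_, p + t, cnt', by simp [h28], hU _ _ _ (hEU _ fun r _ h => h) hL'.rep, ⟨?_, ?_, ?_⟩, ?_⟩
    · simp only [State.setReg_arr, hs5.arr 11 (by decide)]
      exact hM4
    · simpa using hL'.finish
    · simpa using hL'.finish
    · exact DP.represents_empty
    · exact hrep'

end

end RAM

/-! ### Full assignments: row sums, objective and values as entries of a record. -/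

theorem ILP.combine_extended {n m : ℕ} (I : ILP (Fin n) (Fin m)) (x : ℕ → ℤ) :
    (∀ c : Fin m, DP.combine I.extended n x c = ∑ v, I.A c v * x v) ∧
      DP.combine I.extended n x m = ∑ v, I.obj v * x v ∧
      ∀ j : Fin n, DP.combine I.extended n x (m + 1 + j) = x j := by
  refine ⟨fun c => ?_, ?_, fun j => ?_⟩
  · rw [DP.combine, ← Fin.sum_univ_eq_sum_range (fun j => x j * I.extended j c)]
    refine Finset.sum_congr rfl fun v _ => ?_
    simp [extended, mul_comm]
  · rw [DP.combine, ← Fin.sum_univ_eq_sum_range (fun j => x j * I.extended j m)]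
    refine Finset.sum_congr rfl fun v _ => ?_
    simp [extended, mul_comm]
  · rw [DP.combine, Finset.sum_eq_single_of_mem (j : ℕ) (Finset.mem_range.2 j.2)]
    · have h1 : ¬ m + 1 + (j : ℕ) < m := by omega
      have h2 : ¬ m + 1 + (j : ℕ) = m := by omega
      simp [extended, h1, h2]
    · intro i hi hij
      have h1 : ¬ m + 1 + (j : ℕ) < m := by omega
      have h2 : ¬ m + 1 + (j : ℕ) = m := by omega
      have h3 : ¬ (j : ℕ) = i := fun h => hij h.symm
      simp [extended, h1, h2, h3]

theorem ILP.isPartial_iff {n m B : ℕ} {I : ILP (Fin n) (Fin m)} {x : ℕ → ℤ} :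
    DP.IsPartial I.extended n m B I.rhsAt I.InBounds (fun _ => True) x ↔
      I.IsFeasible (fun v => x v) ∧ ∀ v : Fin n, |x v| ≤ B := by
  have hb : ∀ c : Fin m, I.rhsAt c = I.rhs c := fun c => by simp [rhsAt]
  constructor
  · intro h
    refine ⟨⟨fun c => ?_, fun v => (h.bound v v.2 trivial).2 v.2⟩,
      fun v => (h.bound v v.2 trivial).1⟩
    rw [← (I.combine_extended x).1 c, ← hb]
    exact h.closed c c.2 fun _ _ h => absurd trivial h
  · rintro ⟨⟨h1, h2⟩, h3⟩
    refine ⟨fun j hj _ => ⟨h3 ⟨j, hj⟩, fun hj' => h2 ⟨j, hj'⟩⟩, fun _ _ h => absurd trivial h,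
      fun c hc _ => ?_⟩
    have := (I.combine_extended x).1 ⟨c, hc⟩
    rw [h1, ← hb] at this
    exact this

theorem DP.partials_congr {E : ℕ → ℕ → ℤ} {n m B : ℕ} {b : ℕ → ℤ} {ok : ℕ → ℤ → Prop}
    {D D' : ℕ → Prop} (h : ∀ j < n, D j ↔ D' j) :
    partials E n m B b ok D = partials E n m B b ok D' := by
  have key : ∀ {D D' : ℕ → Prop}, (∀ j < n, D j ↔ D' j) → ∀ {x}, IsPartial E n m B b ok D x →
      IsPartial E n m B b ok D' x := fun h _ hx =>
    ⟨fun j hj hD => hx.bound j hj ((h j hj).2 hD), fun j hj hD => hx.zero j hj fun h' => hD ((h j hj).1 h'),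
      fun c hc hcc => hx.closed c hc fun j hj hD => hcc j hj fun h' => hD ((h j hj).2 h')⟩
  exact congrArg (combine E n '' ·) (Set.ext fun x => ⟨key h, key fun j hj => (h j hj).symm⟩)

namespace RAM

open Program

section

variable {n m : ℕ} {I : ILP (Fin n) (Fin m)} {X B : ℕ} {s : State} {D : ℕ → Prop}

/-! ### The optimization in a box -/

theorem TableState.congr {D' : ℕ → Prop} (h : TableState I B X D s) (hD : ∀ j < n, D j ↔ D' j) :
    TableState I B X D' s := by
  obtain ⟨hM, p, cnt, h27, hcnt, hL, hrep⟩ := h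
  refine ⟨fun j hj => by rw [← hD j hj]; exact hM j hj, p, cnt, h27, hcnt, hL, ?_⟩
  rwa [partialsOf, ← DP.partials_congr hD]

theorem TableState.of_agree {R A : List ℕ} {s' : State} (h : TableState I B X D s)
    (hs : Agree R A s s') (hR : 27 ∉ R ∧ 28 ∉ R ∧ 29 ∉ R) (hA : 9 ∉ A ∧ 11 ∉ A) :
    TableState I B X D s' := by
  obtain ⟨hM, p, cnt, h27, hcnt, hL, hrep⟩ := h
  refine ⟨by rwa [hs.arr 11 hA.2], p, cnt, (hs.reg 27 hR.1).trans h27, hcnt,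
    ⟨(hs.reg 28 hR.2.1).trans hL.start, (hs.reg 29 hR.2.2).trans hL.finish, DP.represents_empty⟩, ?_⟩
  exact hrep.congr (by omega) fun r _ i _ => by simp only [recordAt, hs.arr 9 hA.1]

/-- Before any variable is processed only zero rows are closed. The zero vector is inserted iff
their right-hand sides vanish; otherwise the table is empty and stays so, as the instance is
infeasible. -/
theorem initTable_spec (hI : Loaded I s) (hX : n + m < X)
    (hU : FewRecords n m X (partialVectors I B fun _ => False)) :
    wp X initTable (TableState I B X fun _ => False) s := by
  simp only [initTable, wp_seq]
  refine wp_for n [39] [11] (by decide) (by decide) (by decide) (by decide)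
    hI.sizes.vars (by omega) (fun a s' => Marks a (fun _ => False) (s'.arr 11))
    (fun j hj => by omega) ?_ ?_
  · rintro a ha s1 hs1 h39 hM j hj
    simp only [State.setReg_arr, State.setArr_arr, if_true, Function.update_apply, Expr.eval_reg,
      Expr.eval_const, h39, Nat.cast_inj]
    by_cases hja : j = a
    · simp [hja]
    · simpa [hja] using (hM j (by omega)).2 not_false
  rintro s1 hs1 hM
  have hI1 := hI.of_agree hs1 (by decide) (by decide)
  refine wp_conseq (openRows_spec hI1 (by omega) hM) [38, 39, 40] [12] (by decide) (by decide) ?_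
  rintro s2 hO hs2
  have hI2 := hI1.of_agree hs2 (by decide) (by decide)
  refine wp_for (n + m + 1) [38] [10] (by decide) (by decide) (by decide) (by decide)
    hI2.sizes.len (by omega) (fun a s' => ∀ i < a, s'.arr 10 (i : ℕ) = 0) (by simp) ?_ ?_
  · rintro a ha s3 hs3 h38 h i hi
    simp only [State.setReg_arr, State.setArr_arr, if_true, Function.update_apply, Expr.eval_reg,
      Expr.eval_const, h38, Nat.cast_inj]
    split_ifs with h'
    · rfl
    · exact h i (by omega)
  rintro s3 hs3 h10
  simp only [wp_assign, Expr.eval_const, Expr.eval_reg]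
  set s4 := ((s3.setReg 27 0).setReg 28 0).setReg 29 0 with hs4d
  have hs4 : Agree [27, 28, 29] [] s3 s4 :=
    ((agree_setReg (by decide)).trans (agree_setReg (by decide))).trans (agree_setReg (by decide))
  have hI4 : Loaded I s4 := (hI2.of_agree hs3 (by decide) (by decide)).of_agree hs4 (by decide)
    (by decide)
  have hL : NewLayer n m s4 0 0 ∅ := ⟨by simp [hs4d], by simp [hs4d], DP.represents_empty⟩
  refine wp_conseq (tryInsert_spec (v := fun _ => 0) hI4 hX hL (by omega) h10
    (by rw [hs4.arr 12 (by decide), hs3.arr 12 (by decide)]; exact hO))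
    [29, 34, 35, 36, 37, 38] [9] (by decide) (by decide) ?_
  rintro s5 ⟨-, cnt, hL5⟩ hs5
  have hrep : DP.Represents m (n + m + 1) (fun r => recordAt n m s5 (0 + r)) cnt
      (partialsOf I B fun _ => False) := by
    refine DP.represents_init (fun _ _ => not_false) ?_
    have := hL5.rep
    rw [Set.empty_union] at this
    convert this using 1
    ext v
    exact and_congr_right fun h => by rw [h]; rfl
  refine ⟨?_, 0, cnt, ?_, hU _ _ _ ?_ hrep, ⟨by simpa using hL5.finish, by simpa using hL5.finish,
    DP.represents_empty⟩, hrep⟩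
  · simp only [State.setReg_arr, hs5.arr 11 (by decide), hs4.arr 11 (by decide),
      hs3.arr 11 (by decide), hs2.arr 11 (by decide)]
    exact hM
  · simp [hs5.reg 27 (by decide), hs4d]
  · rintro _ ⟨x, hx, rfl⟩
    exact ⟨x, hx, fun _ _ => rfl⟩

theorem processClass_spec (hI : Loaded I s) (hX : n + m < X) (hBX : 2 * B < X) (h23 : s.reg 23 = B)
    {L : ℕ} (h24 : s.reg 24 = L)
    -- Every `D` between the labels below `L` and those up to `L` is allowed, because the bound is
    -- used after each single variable of the class.
    (hU : ∀ D : ℕ → Prop, (∀ j < n, s.arr 7 (j : ℕ) < L → D j) →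
      (∀ j < n, (L : ℤ) < s.arr 7 (j : ℕ) → ¬ D j) → FewRecords n m X (partialVectors I B D))
    (hT : TableState I B X (fun j => s.arr 7 (j : ℕ) < L) s) :
    wp X processClass (TableState I B X (fun j => s.arr 7 (j : ℕ) < (L + 1 : ℕ))) s := by
  simp only [processClass, wp_seq, wp_assign, Expr.eval_const]
  refine wp_for n [25, 26, 27, 28, 29, 30, 31, 32, 33, 34, 35, 36, 37, 38, 39, 40, 43]
    [9, 10, 11, 12] (by decide) (by decide) (by decide) (by decide) (by simp [hI.sizes.vars])
    (by omega) (fun a s' => s'.reg 26 = ((a * (n + m + 1) : ℕ) : ℤ) ∧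
      TableState I B X (fun j => s.arr 7 (j : ℕ) < L ∨ s.arr 7 (j : ℕ) = L ∧ j < a) s') ?_ ?_ ?_
  · refine ⟨by simp, ?_⟩
    exact ((hT.of_agree (R := [26, 25]) (A := []) (agree_setReg (by decide)) (by decide)
      (by decide)).of_agree (R := [26, 25]) (A := []) (agree_setReg (by decide)) (by decide)
      (by decide)).congr (by simp)
  · rintro a ha s1 hs1 h25 ⟨h26, hT1⟩
    have hs : Agree [25, 26, 27, 28, 29, 30, 31, 32, 33, 34, 35, 36, 37, 38, 39, 40, 43]
      [9, 10, 11, 12] s s1 := (agree_setReg (by decide)).trans hs1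
    have hI1 := hI.of_agree hs (by decide) (by decide)
    have h24' : s1.reg 24 = L := (hs.reg 24 (by decide)).trans h24
    have hlen : s1.reg 6 = ((n + m + 1 : ℕ) : ℤ) := hI1.sizes.len
    have hadd : ((a * (n + m + 1) : ℕ) : ℤ) + ((n + m + 1 : ℕ) : ℤ) =
      (((a + 1) * (n + m + 1) : ℕ) : ℤ) := by push_cast; ring
    have hskip : s.arr 7 (a : ℕ) ≠ L → (∀ j < n,
        (s.arr 7 (j : ℕ) < L ∨ s.arr 7 (j : ℕ) = L ∧ j < a) ↔
          (s.arr 7 (j : ℕ) < L ∨ s.arr 7 (j : ℕ) = L ∧ j < a + 1)) := fun hne j _ => by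
      refine or_congr_right (and_congr_right fun h => ⟨fun h' => by omega, fun h' => ?_⟩)
      have : j ≠ a := by rintro rfl; exact hne h
      omega
    simp only [wp_seq, wp_ite, wp_skip, wp_assign, Expr.eval_sub', Expr.eval_add', Expr.eval_reg,
      Expr.eval_read, h25, h24', h26, hlen, hs.arr 7 (by decide), hadd]
    have hfin : ∀ s2, TableState I B X
        (fun j => s.arr 7 (j : ℕ) < L ∨ s.arr 7 (j : ℕ) = L ∧ j < a + 1) s2 →
        TableState I B X (fun j => s.arr 7 (j : ℕ) < L ∨ s.arr 7 (j : ℕ) = L ∧ j < a + 1)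
        ((s2.setReg 26 (((a + 1) * (n + m + 1) : ℕ) : ℤ)).setReg 25 ((a + 1 : ℕ) : ℤ)) :=
      fun s2 h => (h.of_agree (R := [26, 25]) (A := []) (agree_setReg (by decide)) (by decide)
        (by decide)).of_agree (R := [26, 25]) (A := []) (agree_setReg (by decide)) (by decide)
        (by decide)
    refine ⟨fun hp => ⟨by simp, hfin _ (hT1.congr (hskip (by omega)))⟩, fun hp =>
      ⟨fun hq => ⟨by simp, hfin _ (hT1.congr (hskip (by omega)))⟩, fun hq => ?_⟩⟩
    have haL : s.arr 7 (a : ℕ) = L := by omega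
    refine wp_conseq (processVariable_spec (D' := fun j => s.arr 7 (j : ℕ) < L ∨
        s.arr 7 (j : ℕ) = L ∧ j < a + 1) hI1 hX hBX ha (by rw [hs.reg 23 (by decide), h23]) h25 h26
      hT1 (by omega) (fun i hi => ?_) (hU _ (fun j _ h => Or.inl h) fun j _ h => by omega))
      [27, 28, 29, 30, 31, 32, 33, 34, 35, 36, 37, 38, 39, 40, 43] [9, 10, 11, 12] (by decide)
      (by decide) ?_
    · constructor
      · rintro (h | ⟨h, h'⟩)
        · exact Or.inl (Or.inl h)
        · by_cases hia : i = a
          · exact Or.inr hia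
          · exact Or.inl (Or.inr ⟨h, by omega⟩)
      · rintro ((h | ⟨h, h'⟩) | rfl)
        · exact Or.inl h
        · exact Or.inr ⟨h, by omega⟩
        · exact Or.inr ⟨haL, by omega⟩
    · rintro s2 hT2 hs2
      simp only [hs2.reg 26 (by decide), h26, hs2.reg 6 (by decide), hlen, hadd]
      exact ⟨by simp, hfin _ hT2⟩
  · rintro s1 - ⟨-, hT1⟩
    refine hT1.congr fun j hj => ?_
    push_cast
    omega

theorem fewRecords_of_labelling {N l : ℕ} {lab : ℕ → ℤ} {Z : Finset ℕ}
    (hl : IsLabelling I.extended n m l m lab Z) (hN : I.BoundedBy N)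
    (hX : (2 * (n * (N * B)) + 1) ^ Z.card * (2 * B + 1) ^ l < X) {L : ℤ} (hL : 0 ≤ L)
    (hlt : ∀ j < n, lab j < L → D j) (hgt : ∀ j < n, L < lab j → ¬ D j) :
    FewRecords n m X (partialVectors I B D) := by
  intro get cnt K hK h
  refine (h.card_le hl (N := N) (fun j hj c hc => ?_) (by omega) hL hlt hgt
    fun v hv => hK hv).trans_lt hX
  simpa [ILP.extended, hj, hc] using hN.entry ⟨c, hc⟩ ⟨j, hj⟩

theorem optimize_tableState {N l : ℕ} {Z : Finset ℕ} (hI : Loaded I s) (hX : n + m < X)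
    (hBX : 2 * B < X) (h23 : s.reg 23 = B)
    (hl : IsLabelling I.extended n m l m (fun u => s.arr 7 u) Z) (hN : I.BoundedBy N)
    (hZ : (2 * (n * (N * B)) + 1) ^ Z.card * (2 * B + 1) ^ l < X) :
    wp X optimize (TableState I B X fun _ => True) s := by
  simp only [optimize, wp_seq]
  refine wp_conseq (initTable_spec hI hX (fewRecords_of_labelling hl hN hZ le_rfl
    (fun j hj h => ?_) fun _ _ _ => not_false))
    [27, 28, 29, 34, 35, 36, 37, 38, 39, 40] [9, 10, 11, 12] (by decide) (by decide) ?_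
  · have := (hl.var j hj).1
    omega
  rintro s1 hT hs1
  refine wp_for n [24, 25, 26, 27, 28, 29, 30, 31, 32, 33, 34, 35, 36, 37, 38, 39, 40, 43]
    [9, 10, 11, 12] (by decide) (by decide) (by decide) (by decide)
    (by rw [hs1.reg 4 (by decide), hI.sizes.vars]) (by omega)
    (fun a s' => TableState I B X (fun j => s.arr 7 (j : ℕ) < a) s') ?_ ?_ ?_
  · refine (hT.of_agree (R := [24]) (A := []) (agree_setReg (by decide)) (by decide)
      (by decide)).congr fun j hj => ?_
    have := (hl.var j hj).1
    simpa using this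
  · rintro a ha s2 hs2 h24 hT2
    have hs : Agree [24, 25, 26, 27, 28, 29, 30, 31, 32, 33, 34, 35, 36, 37, 38, 39, 40, 43]
      [9, 10, 11, 12] s s2 := (hs1.mono (by decide) (by decide)).trans hs2
    have h7 : s2.arr 7 = s.arr 7 := hs.arr 7 (by decide)
    rw [← h7] at hT2
    refine wp_conseq (processClass_spec (hI.of_agree hs (by decide) (by decide)) hX hBX
      (by rw [hs.reg 23 (by decide), h23]) h24 (fun D hlt hgt => ?_) hT2) _ _
      (List.Subset.refl _) (List.Subset.refl _) fun s3 hT3 _ => ?_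
    · rw [h7] at hlt hgt
      exact fewRecords_of_labelling hl hN hZ (by positivity) hlt hgt
    · rw [h7] at hT3
      exact hT3.of_agree (R := [24]) (A := []) (agree_setReg (by decide)) (by decide) (by decide)
  · rintro s2 hs2 hT2
    exact hT2.congr fun j hj => iff_true_intro (hl.var j hj).2

/-- The first record of the table is a feasible assignment with the best objective value among those
with values between `-B` and `B`, or the table is empty and there is no such assignment. -/
def HoldsBest (I : ILP (Fin n) (Fin m)) (B : ℕ) (s : State) : Prop :=
  ∃ p : ℕ, s.reg 27 = ((p * (n + m + 1) : ℕ) : ℤ) ∧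
    ((s.reg 28 = s.reg 27 ∧ ∀ x, I.IsFeasible x → ¬ ∀ v, |x v| ≤ B) ∨
    (s.reg 27 < s.reg 28 ∧ ∃ x, I.IsFeasible x ∧ (∀ v, |x v| ≤ B) ∧
      (∀ v : Fin n, recordAt n m s p (m + 1 + v) = x v) ∧
      recordAt n m s p m = ∑ v, I.obj v * x v ∧
      ∀ y, I.IsFeasible y → (∀ v, |y v| ≤ B) → ∑ v, I.obj v * y v ≤ ∑ v, I.obj v * x v))

/-- When all variables are processed, all constraints are closed and every record has the right-hand
side as its key. Distinctness of keys leaves at most one record, and completeness makes it optimal.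
-/
theorem TableState.holdsBest (h : TableState I B X (fun _ => True) s) : HoldsBest I B s := by
  obtain ⟨-, p, cnt, h27, -, hL, hrep⟩ := h
  refine ⟨p, h27, ?_⟩
  have h28 := hL.start
  have hcomp : ∀ y, I.IsFeasible y → (∀ v, |y v| ≤ B) → ∃ r < cnt,
      (∀ c : Fin m, recordAt n m s (p + r) c = I.rhs c) ∧
        ∑ v, I.obj v * y v ≤ recordAt n m s (p + r) m := by
    intro y hy hyB
    set y' : ℕ → ℤ := fun j => if hj : j < n then y ⟨j, hj⟩ else 0 with hy'
    have hyy : ∀ v : Fin n, y' v = y v := fun v => by simp [hy']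
    have hyy' : (fun v : Fin n => y' v) = y := funext hyy
    obtain ⟨r, hr, h1, h2⟩ := hrep.complete _ ⟨y', ILP.isPartial_iff.2
      ⟨by rwa [hyy'], fun v => by rw [hyy]; exact hyB v⟩, rfl⟩
    refine ⟨r, hr, fun c => ?_, ?_⟩
    · rw [h1 c c.2, (I.combine_extended y').1 c, ← hy.1 c]
      simp only [hyy]
    · rw [(I.combine_extended y').2.1] at h2
      simpa only [hyy] using h2
  rcases Nat.eq_zero_or_pos cnt with rfl | hpos
  · refine Or.inl ⟨by rw [h28, h27, Nat.add_zero], fun x hx hxB => ?_⟩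
    obtain ⟨r, hr, -⟩ := hcomp x hx hxB
    omega
  · refine Or.inr ⟨?_, ?_⟩
    · rw [h27, h28, Nat.cast_lt]
      exact Nat.mul_lt_mul_of_pos_right (by omega) (by omega)
    · obtain ⟨_, ⟨x, hx, rfl⟩, hg⟩ := hrep.sound 0 hpos
      simp only [Nat.add_zero] at hg
      obtain ⟨hxf, hxB⟩ := ILP.isPartial_iff.1 hx
      obtain ⟨e1, e2, e3⟩ := I.combine_extended x
      have hm : recordAt n m s p m = ∑ v, I.obj v * x v := by rw [hg m (by omega), e2]
      refine ⟨fun v => x v, hxf, hxB, fun v => by rw [hg _ (by omega), e3], hm,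
        fun y hy hyB => ?_⟩
      obtain ⟨r, hr, h1, h2⟩ := hcomp y hy hyB
      have hr0 : r = 0 := hrep.distinct r hr 0 hpos fun c hc => by
        simp only [Nat.add_zero]
        rw [h1 ⟨c, hc⟩, hg c (by omega), e1 ⟨c, hc⟩]
        exact (hxf.1 ⟨c, hc⟩).symm
      rw [hr0, Nat.add_zero, hm] at h2
      exact h2

/-! ### The answer -/

theorem output_spec (hI : Loaded I s) (hX : n + m < X) {p : ℕ}
    (h27 : s.reg 27 = ((p * (n + m + 1) : ℕ) : ℤ)) :
    wp X output (fun s' => ∀ v : Fin n, s'.arr 0 (v : ℕ) = recordAt n m s p (m + 1 + v)) s := by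
  refine wp_for n [38] [0] (by decide) (by decide) (by decide) (by decide) hI.sizes.vars (by omega)
    (fun a s' => ∀ j < a, s'.arr 0 (j : ℕ) = recordAt n m s p (m + 1 + j)) (by simp) ?_
    fun s' _ h v => h v v.2
  rintro a ha s1 hs1 h38 h j hj
  have e : ((p * (n + m + 1) : ℕ) : ℤ) + (m : ℤ) + 1 + (a : ℤ) =
    ((p * (n + m + 1) + (m + 1 + a) : ℕ) : ℤ) := by push_cast; ring
  simp only [State.setReg_arr, State.setArr_arr, if_true, Function.update_apply, Expr.eval_add',
    Expr.eval_read, Expr.eval_reg, Expr.eval_const, h38, hs1.reg 27 (by decide), h27,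
    hs1.reg 5 (by decide), hI.sizes.rows, hs1.arr 9 (by decide), e, Nat.cast_inj]
  split_ifs with h'
  · rw [h', recordAt]
  · exact h j (by omega)

/-- If the small box is empty, there is no solution, since some solution would be small. If the
large box is strictly better, a solution would again exist in the small box and could not be beaten.
Otherwise the record of the small box is a solution by `isSolution_of_double`. The hypothesis `h42`
is conditional because register `42` is meaningless if the large box is empty, but then so is the
small one. -/
theorem answer_spec {l z N : ℕ} {lab : Fin n → ℕ} {Z : Finset (Fin m)}
    (hZ : SplitsInto I.A l lab Z) (hz : Z.card ≤ z) (hN : I.BoundedBy N) (hI : Loaded I s)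
    (hX : n + m < X) (hB : HoldsBest I (ILP.variableBound N (l + z)) s)
    (h42 : (∃ x, I.IsFeasible x ∧ ∀ v, |x v| ≤ ((2 * ILP.variableBound N (l + z) : ℕ) : ℤ)) →
      ∃ x, I.IsFeasible x ∧ s.reg 42 = ∑ v, I.obj v * x v ∧ ∀ y, I.IsFeasible y →
        (∀ v, |y v| ≤ ((2 * ILP.variableBound N (l + z) : ℕ) : ℤ)) →
        ∑ v, I.obj v * y v ≤ ∑ v, I.obj v * x v) :
    wp X answer (fun s' => s'.IsAnswer I) s := by
  obtain ⟨p, h27, hB⟩ := hB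
  have e : s.arr 9 (s.reg 27 + s.reg 5) = recordAt n m s p m := by
    rw [recordAt, h27, hI.sizes.rows]; congr 1
  simp only [answer, wp_seq, wp_ite, wp_skip, wp_assign, Expr.eval_sub', Expr.eval_add',
    Expr.eval_reg, Expr.eval_read, Expr.eval_const, State.setReg_reg, State.setReg_arr]
  simp only [OfNat.ofNat_ne_zero, if_false, e]
  rcases hB with ⟨h28, hno⟩ | ⟨h28, x, hx, hxB, hrec, hobj, hbest⟩
  · refine ⟨fun h => by omega, fun _ => Or.inr ⟨by simp, fun hsol => ?_⟩⟩
    obtain ⟨x, hx, hxB⟩ := ILP.exists_small_solution hZ hz hN hsol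
    exact hno x hx.1 hxB
  · obtain ⟨x', hx', h42, hbest'⟩ := h42 ⟨x, hx, fun v => (hxB v).trans (by push_cast; omega)⟩
    refine ⟨fun _ => ⟨fun hlt => Or.inr ⟨by simp, fun hsol => ?_⟩, fun hle => ?_⟩,
      fun h => absurd (sub_pos.2 h28) h⟩
    · obtain ⟨y, hy, hyB⟩ := ILP.exists_small_solution hZ hz hN hsol
      have h1 := hbest y hy.1 hyB
      have h2 := hy.2 x' hx'
      linarith
    · have hI1 : Loaded I ((s.setReg 0 0).setReg 0 1) := (hI.of_agree (R := [0]) (A := [])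
        (agree_setReg (by decide)) (by decide) (by decide)).of_agree (R := [0]) (A := [])
        (agree_setReg (by decide)) (by decide) (by decide)
      refine wp_conseq (output_spec hI1 hX (p := p) (by simpa using h27)) [38] [0] (by decide)
        (by decide) ?_
      rintro s' hout hs'
      refine Or.inl ⟨by simp [hs'.reg 0 (by decide)], ?_⟩
      have hout' : (fun j : Fin n => s'.arr 0 (j : ℕ)) = x := funext fun v =>
        (hout v).trans (hrec v)
      rw [hout']
      refine ILP.isSolution_of_double hZ hz hN hx hxB fun y hy hyB => ?_
      have := hbest' y hy (by exact_mod_cast hyB)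
      linarith

end

end RAM

/-! ### Numerical bounds and correctness of the whole program. -/

/-- An upper bound on the number of global constraints plus the sizes of the classes. -/
def ILP.splitBound (k : ℕ) : ℕ := k + 1 + 4 ^ (k + 1)

/-- The number of iterations of every loop is bounded by this power of the length of the input. -/
def ILP.iterationExponent (k : ℕ) : ℕ :=
  (2 ^ (6 + 4 * splitBound k) + 5) * (splitBound k + 1)

namespace RAM

open Program

section

variable {n m : ℕ} {I : ILP (Fin n) (Fin m)} {N l z k : ℕ}

/-- The bounds that are needed for the analysis of the program. -/
structure Suffices (N n m k X : ℕ) : Prop where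
  input : N ≤ X
  sizes : n + m < X
  search : k < X
  rounds : ∀ l z, l ≤ k + 1 → z ≤ 4 ^ l → 6 + 4 * (l + z) ≤ X
  bound : ∀ l z, l ≤ k + 1 → z ≤ 4 ^ l → ILP.variableBound N (l + z) ≤ X
  box : ∀ l z B, l ≤ k + 1 → z ≤ 4 ^ l → B ≤ 2 * ILP.variableBound N (l + z) → 2 * B < X
  table : ∀ l z B, l ≤ k + 1 → z ≤ 4 ^ l → B ≤ 2 * ILP.variableBound N (l + z) →
    (2 * (n * (N * B)) + 1) ^ z * (2 * B + 1) ^ l < X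

/-- With `q` bounding `l + z`, the bound on the variables is at most `N ^ e`, and each of the at
most `q` factors in the table size is at most `N ^ (e + 5)`. One further factor `N ^ (e + 5)` makes
the inequality strict and dominates all other requirements. -/
theorem suffices_iterationExponent (hN : n + m + 2 ≤ N) (k : ℕ) :
    Suffices N n m k (N ^ ILP.iterationExponent k) := by
  set q := ILP.splitBound k with hq
  set e := 2 ^ (6 + 4 * q) with he
  have hN2 : 2 ≤ N := by omega
  have hN0 : 0 < N := by omega
  have hkq : k < q := by
    rw [hq, ILP.splitBound]
    exact (Nat.lt_succ_self k).trans_le (Nat.le_add_right _ _)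
  have hX : ILP.iterationExponent k = (e + 5) * q + (e + 5) := by
    rw [ILP.iterationExponent, ← hq, ← he]; ring
  have hle : ∀ a, a ≤ e + 5 → N ^ a ≤ N ^ ILP.iterationExponent k := fun a ha =>
    Nat.pow_le_pow_right hN0 (by rw [hX]; omega)
  have hlz : ∀ l z, l ≤ k + 1 → z ≤ 4 ^ l → z + l ≤ q := fun l z hl hz => by
    have : 4 ^ l ≤ 4 ^ (k + 1) := Nat.pow_le_pow_right (by norm_num) hl
    rw [hq, ILP.splitBound]; omega
  have hM : ∀ l z, l ≤ k + 1 → z ≤ 4 ^ l → ILP.variableBound N (l + z) ≤ N ^ e := fun l z hl hz => by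
    have := hlz l z hl hz
    exact Nat.pow_le_pow_right hN0 (Nat.pow_le_pow_right (by norm_num) (by omega))
  have hqX : 6 + 4 * q < N ^ ILP.iterationExponent k := by
    refine (Nat.lt_two_pow_self (n := 6 + 4 * q)).trans_le ?_
    rw [← he]
    exact ((Nat.lt_two_pow_self (n := e)).le.trans (Nat.pow_le_pow_left hN2 e)).trans
      (hle e (by omega))
  have hMpos : 1 ≤ N ^ e := Nat.one_le_pow _ _ hN0
  have h4 : 4 ≤ N ^ 2 := by nlinarith
  have h8 : 8 ≤ N ^ 3 := by
    rw [pow_succ]; nlinarith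
  have hbox : ∀ l z B, l ≤ k + 1 → z ≤ 4 ^ l → B ≤ 2 * ILP.variableBound N (l + z) →
      2 * B + 1 ≤ N ^ (e + 3) := fun l z B hl hz hB => by
    have := hM l z hl hz
    rw [pow_add]
    nlinarith
  have h1 : N ≤ N ^ ILP.iterationExponent k := by simpa using hle 1 (Nat.succ_pos _)
  refine ⟨h1, by omega, by omega, fun l z hl hz => ?_,
    fun l z hl hz => (hM l z hl hz).trans (hle e (by omega)), fun l z B hl hz hB => ?_,
    fun l z B hl hz hB => ?_⟩
  · have := hlz l z hl hz
    omega
  · have h2 := hbox l z B hl hz hB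
    have h3 := hle (e + 3) (by omega)
    omega
  · have h2 := (hbox l z B hl hz hB).trans (Nat.pow_le_pow_right hN0 (Nat.add_le_add_left (by norm_num : 3 ≤ 5) e))
    have h3 : 2 * (n * (N * B)) + 1 ≤ N ^ (e + 5) := by
      have hB' := hbox l z B hl hz hB
      have hn : n * N ≤ N ^ 2 := by nlinarith
      have h5 : N ^ (e + 5) = N ^ 2 * N ^ (e + 3) := by ring
      rw [h5]
      calc 2 * (n * (N * B)) + 1 = (n * N) * (2 * B) + 1 := by ring
        _ ≤ N ^ 2 * (2 * B) + N ^ 2 := by gcongr; omega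
        _ = N ^ 2 * (2 * B + 1) := by ring
        _ ≤ _ := Nat.mul_le_mul_left _ hB'
    calc (2 * (n * (N * B)) + 1) ^ z * (2 * B + 1) ^ l
        ≤ (N ^ (e + 5)) ^ z * (N ^ (e + 5)) ^ l := by gcongr
      _ = N ^ ((e + 5) * (z + l)) := by rw [← pow_add, ← pow_mul]
      _ < N ^ ILP.iterationExponent k := by
        refine Nat.pow_lt_pow_right (by omega) ?_
        have := Nat.mul_le_mul_left (e + 5) (hlz l z hl hz)
        rw [hX]
        exact this.trans_lt (Nat.lt_add_of_pos_right (Nat.succ_pos _))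

/-- The fracture number enters only through the components that stop the search. Everything
afterwards uses the labelling that was actually found, with `l ≤ k + 1` and at most `4 ^ l` global
constraints. -/
theorem solve_spec (hk : I.constraintFractureNumber = (k : ℕ∞)) {X : ℕ}
    (hX : Suffices (Unary.encode I).length n m k X) :
    wp X solve (fun s' => s'.IsAnswer I) (State.init (Unary.encode I)) := by
  obtain ⟨ι, S, comp, hc⟩ := exists_components I hk
  have hN := ILP.boundedBy_encode I
  have hsz := hN.size
  set N := (Unary.encode I).length
  simp only [solve, wp_seq]
  refine wp_conseq (parse_spec I hX.input) _ _ (List.Subset.refl _) (List.Subset.refl _) ?_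
  rintro s1 ⟨hI1, h0, h8⟩ -
  refine wp_conseq (search_spec hI1 hX.sizes.le h8 hc hX.search) [10, 11, 12, 13, 14, 15, 16, 17]
    [7, 8] (by decide) (by decide) ?_
  rintro s2 ⟨l, Z, h11, h13, hl, hz, hlab⟩ hs2
  have hI2 := hI1.of_agree hs2 (by decide) (by decide)
  refine wp_conseq (computeBound_spec (N := N) (by omega) (by rw [hs2.reg 0 (by decide), h0]) h11 h13
    (hX.bound l _ hl hz) (hX.rounds l _ hl hz)) [18, 19, 20, 21, 22] [] (by decide) (by decide) ?_
  rintro s3 h18 hs3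
  set M := ILP.variableBound N (l + Z.card) with hMd
  simp only [wp_assign, Expr.eval_add', Expr.eval_reg, h18]
  have hs4 : Agree [18, 19, 20, 21, 22, 23] [] s2 (s3.setReg 23 ((M : ℤ) + M)) :=
    (hs3.mono (by decide) (by decide)).trans (agree_setReg (by decide))
  have hs4' : Agree [23] [] s3 (s3.setReg 23 ((M : ℤ) + M)) := agree_setReg (by decide)
  have h23 : (s3.setReg 23 ((M : ℤ) + M)).reg 23 = ((2 * M : ℕ) : ℤ) := by
    simp only [State.setReg_reg, if_true]
    push_cast
    ring
  set s4 := s3.setReg 23 ((M : ℤ) + M)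
  have hI4 := hI2.of_agree hs4 (by decide) (by decide)
  refine wp_conseq (optimize_tableState hI4 hX.sizes (hX.box l _ _ hl hz le_rfl) h23
    (by rw [hs4.arr 7 (by decide)]; exact hlab) hN (hX.table l _ _ hl hz le_rfl))
    [24, 25, 26, 27, 28, 29, 30, 31, 32, 33, 34, 35, 36, 37, 38, 39, 40, 43] [9, 10, 11, 12]
    (by decide) (by decide) ?_
  rintro s5 hT5 hs5
  have h18' : s5.reg 18 = M := by
    rw [hs5.reg 18 (by decide), hs4'.reg 18 (by decide), h18]
  have hI5 := hI4.of_agree hs5 (by decide) (by decide)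
  simp only [Expr.eval_read, Expr.eval_add', Expr.eval_reg, hI5.sizes.rows, State.setReg_reg]
  simp only [Nat.reduceEqDiff, if_false, h18']
  set v := s5.arr 9 (s5.reg 27 + m) with hv
  have hs6 : Agree [23, 42] [] s5 ((s5.setReg 42 v).setReg 23 M) :=
    (agree_setReg (by decide)).trans (agree_setReg (by decide))
  have h42 : ((s5.setReg 42 v).setReg 23 M).reg 42 = v := by simp
  have h23' : ((s5.setReg 42 v).setReg 23 M).reg 23 = M := by simp
  set s6 := (s5.setReg 42 v).setReg 23 M
  have hI6 := hI5.of_agree hs6 (by decide) (by decide)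
  refine wp_conseq (optimize_tableState hI6 hX.sizes (hX.box l _ M hl hz (by omega)) h23'
    (by rw [hs6.arr 7 (by decide), hs5.arr 7 (by decide), hs4.arr 7 (by decide)]; exact hlab) hN
    (hX.table l _ M hl hz (by omega)))
    [24, 25, 26, 27, 28, 29, 30, 31, 32, 33, 34, 35, 36, 37, 38, 39, 40, 43] [9, 10, 11, 12]
    (by decide) (by decide) ?_
  rintro s7 hT7 hs7
  have hI7 := hI6.of_agree hs7 (by decide) (by decide)
  obtain ⟨hsplit, hcard⟩ := hlab.splitsInto
  refine answer_spec hsplit hcard hN hI7 hX.sizes hT7.holdsBest ?_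
  rintro ⟨y, hy, hyB⟩
  obtain ⟨p, h27, ⟨-, hno⟩ | ⟨-, x, hx, -, -, hobj, hbest⟩⟩ := hT5.holdsBest
  · exact absurd hyB (hno y hy)
  · refine ⟨x, hx, ?_, hbest⟩
    rw [hs7.reg 42 (by decide), h42, hv, h27, ← hobj, recordAt]
    congr 1

end

end RAM

theorem ILP.primrec_iterationExponent : Primrec ILP.iterationExponent := by
  have hpow : ∀ b : ℕ, Primrec fun a : ℕ => b ^ a := fun b =>
    (Primrec.nat_rec₁ 1 (Primrec.nat_mul.comp Primrec.snd (Primrec.const b)).to₂).of_eq fun a => by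
      induction a with
      | zero => rfl
      | succ a ih => rw [pow_succ, ← ih]
  have hq : Primrec splitBound := Primrec.nat_add.comp Primrec.succ ((hpow 4).comp Primrec.succ)
  exact Primrec.nat_mul.comp (Primrec.nat_add.comp ((hpow 2).comp (Primrec.nat_add.comp
    (Primrec.const 6) (Primrec.nat_mul.comp (Primrec.const 4) hq))) (Primrec.const 5))
    (Primrec.succ.comp hq)

theorem mainTheorem4 :
    ∃ (P : RAM.Program) (f : ℕ → ℕ), Computable f ∧
      ∀ (n m : ℕ) (I : ILP (Fin n) (Fin m)) (k : ℕ),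
        I.constraintFractureNumber = (k : ℕ∞) →
          P.SolvesWithin I (f k * (Unary.encode I).length ^ f k) := by
  let S := RAM.Program.solve.size
  let d := RAM.Program.solve.depth
  -- One number serves as factor and exponent. As `N ≥ 2`, the program size satisfies `S ≤ 2 ^ S ≤ N
  -- ^ S`, and `N ^ E + 1 ≤ N ^ (E + 1)` for the number of loop iterations.
  refine ⟨RAM.Program.solve, fun k => S + (ILP.iterationExponent k + 1) * d + 1, ?_, ?_⟩
  · exact (Primrec.succ.comp (Primrec.nat_add.comp (Primrec.const S) (Primrec.nat_mul.comp
      (Primrec.succ.comp ILP.primrec_iterationExponent) (Primrec.const d)))).to_comp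
  intro n m I k hk
  have hN := (ILP.boundedBy_encode I).size
  obtain ⟨t, s, hr, ht, hs⟩ := RAM.exists_runs_of_wp
    (RAM.solve_spec hk (RAM.suffices_iterationExponent hN k))
  refine ⟨t, s, hr, (ht.trans (RAM.Program.bound_le _ _)).trans ?_, hs⟩
  set N := (Unary.encode I).length
  set E := ILP.iterationExponent k
  have hX : N ^ E + 1 ≤ N ^ (E + 1) := by
    have : 1 ≤ N ^ E := Nat.one_le_pow _ _ (by omega)
    rw [pow_succ]
    nlinarith
  calc S * (N ^ E + 1) ^ d ≤ N ^ S * (N ^ (E + 1)) ^ d :=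
        Nat.mul_le_mul (Nat.lt_two_pow_self.le.trans (Nat.pow_le_pow_left (by omega) S))
          (Nat.pow_le_pow_left hX d)
    _ = N ^ (S + (E + 1) * d) := by rw [← pow_mul, ← pow_add]
    _ ≤ N ^ (S + (E + 1) * d + 1) := Nat.pow_le_pow_right (by omega) (by omega)
    _ ≤ (S + (E + 1) * d + 1) * N ^ (S + (E + 1) * d + 1) :=
        Nat.le_mul_of_pos_left _ (by omega)
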